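/- **Setting.** A cellulation $\Lambda$ of a connected closed oriented surface carries one qubit on every edge. A computational basis state $|\mathbf s\rangle$ is a *loop configuration* if every vertex meets an even number of occupied edges, i.e. $A_v|\mathbf s\rangle=|\mathbf s\rangle$ with $A_v=\prod_{e\ni v}Z_e$ for every vertex $v$. For closed loops $\bar\omega_1,\dots,\bar\omega_n$ of the dual lattice and $s\in\{0,1\}^n$, let $\rho^{s}$ be the uniform mixture of $|\mathbf s\rangle\langle\mathbf s|$ over the loop configurations $\mathbf s$ that cross $\bar\omega_i$ with parity $s_i$ for every $i$. On the $L\times L$ square lattice on the torus, take $\bar\omega_x,\bar\omega_y$ to be straight dual loops such that the crossing parities are the winding parities of $\mathbf s$ around the $x$ and the $y$ direction. This gives $\rho_{\rm cl}^{s_xs_y}$ and the classical loop state $\rho_{\rm cl}=\rho_{\rm cl}^{00}$. On a surface of genus $k$, take $2k$ dual loops that are independent in $\mathbb Z_2$-homology, and $\rho_{\rm cl}=\rho^{0}$. States are families $\sigma=(\sigma_L)_L$ of density matrices on lattices $\Lambda_L$ of linear size $L$. Write $\sigma\simeq\tau$ if $\|\sigma_L-\tau_L\|_1$ decays faster than every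 power of $1/L$. A region is a set of qubits, each of which occupies the quadrilateral tile spanned by the end points of its edge and the two adjacent faces. The distance $\mathrm{dist}$ is the graph distance on the qubits in which two qubits are adjacent when their closed tiles meet. The Markov length $\xi(\sigma)$ is the infimum of the $\xi>0$ such that $I_{\sigma_L}(A:C|B)\le \mathrm{poly}(L)\,e^{-\mathrm{dist}(A,C)/\xi}$ for all $L$ and all partitions $\Lambda_L=A\sqcup B\sqcup C$ with $A$ and $A\cup B$ simply connected, $C$ nonempty, and $A$ not touching $C$. For $0\le\xi_0<\infty$, $\mathcal Q(\rho;\xi_0)$ is the set of families $\sigma$ with $\xi(\sigma)\le\xi_0$ whose reduced states satisfy $\sigma_A\simeq\rho_A$ uniformly in the simply connected regions $A$. Finally, $\mathsf{conv}$ of a set of families consists of the families that lie in the convex hull at each $L$. **Theorem.** (a) *Torus.* For $s_x,s_y\in\{0,1\}$: 1. For every $L$, $\rho_{\rm cl}^{s_xs_y}$ is the stabilizer state with the commuting, independent generators $\{A_v\}_{v\ne v_0}\cup\{(-1)^{s_x}Z_{\bar\omega_x},(-1)^{s_y}Z_{\bar\omega_y}\}$, for every vertex $v_0$ and all choices of $\bar\omega_x,\bar\omega_y$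 in their homology classes. 2. $\xi(\rho_{\rm cl}^{s_xs_y})=0$. 3. For every $L$ and every simply connected region $A$, the four states $\rho_{\rm cl}^{s_xs_y}$ have exactly the same reduced state on $A$. 4. For every finite $\xi_0\ge0$, $\mathsf{conv}\{\rho_{\rm cl}^{00},\rho_{\rm cl}^{01},\rho_{\rm cl}^{10},\rho_{\rm cl}^{11}\}\subseteq\mathcal Q(\rho_{\rm cl};\xi_0)$. Conversely, every $\sigma\in\mathcal Q(\rho_{\rm cl};\xi_0)$ satisfies $\sigma\simeq\tau$ for some $\tau$ in this convex hull, so that the two sets are equal in the thermodynamic limit. 5. For every $L$ this convex hull is a tetrahedron: the four states are affinely independent, and it has exactly $4$ extreme points. Moreover $\big\|\sum_s c_s\rho_{\rm cl}^{s}\big\|_1=\sum_s|c_s|$ for real $c_s$. (b) *Genus $k$.* Let $\Lambda_L$ be cellulations of closed oriented surfaces of genus $k\ge0$ such that the number of edges is at most polynomial in $L$ and, for some $c>0$ and all large $L$, every qubit has a partition $A\sqcup B\sqcup C$ as above in which $A$ contains it and all the qubits whose tiles touch its tile, and $\mathrm{dist}(A,C)\ge cL$. Choose on every $\Lambda_L$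 a system of $2k$ dual loops that are independent in $\mathbb Z_2$-homology. Then the same statements 1–5 hold for the $2^{2k}$ states $\rho^{s}$, $s\in\{0,1\}^{2k}$; in particular $\mathcal Q(\rho_{\rm cl};\xi_0)$ is, in the thermodynamic limit, a simplex with $2^{2k}$ vertices. -/

import Mathlib

open Filter Topology
open scoped ComplexOrder

/-!
## Cellulated closed oriented surfaces

A cellulation of a connected closed oriented surface is given by its darts (oriented edges), the
rotation `rot` which sends a dart to the next one, counterclockwise, with the same initial vertex,
and the orientation reversal `flip`. Vertices, edges and faces are the cycles of `rot`, of `flip`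
and of `rot⁻¹ * flip`. The face of a dart is the one on its left.
-/

structure CellulatedSurface where
  Dart : Type
  Vertex : Type
  Edge : Type
  Face : Type
  [fintypeDart : Fintype Dart]
  [fintypeVertex : Fintype Vertex]
  [fintypeEdge : Fintype Edge]
  [fintypeFace : Fintype Face]
  [decEqDart : DecidableEq Dart]
  [decEqVertex : DecidableEq Vertex]
  [decEqEdge : DecidableEq Edge]
  [decEqFace : DecidableEq Face]
  rot : Equiv.Perm Dart
  flip : Equiv.Perm Dart
  vert : Dart → Vertex
  edge : Dart → Edge
  face : Dart → Face
  nonempty : Nonempty Dart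
  flip_flip : ∀ d, flip (flip d) = d
  flip_ne : ∀ d, flip d ≠ d
  connected : ∀ d d', ∃ g ∈ Subgroup.closure {rot, flip}, g d = d'
  vert_surjective : Function.Surjective vert
  edge_surjective : Function.Surjective edge
  face_surjective : Function.Surjective face
  vert_eq_iff : ∀ d d', vert d = vert d' ↔ rot.SameCycle d d'
  edge_eq_iff : ∀ d d', edge d = edge d' ↔ flip.SameCycle d d'
  face_eq_iff : ∀ d d', face d = face d' ↔ (rot⁻¹ * flip).SameCycle d d'

attribute [instance] CellulatedSurface.fintypeDart CellulatedSurface.fintypeVertex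
  CellulatedSurface.fintypeEdge CellulatedSurface.fintypeFace CellulatedSurface.decEqDart
  CellulatedSurface.decEqVertex CellulatedSurface.decEqEdge CellulatedSurface.decEqFace

namespace CellulatedSurface

/-- The surface has genus `k`: Euler's formula `V - E + F = 2 - 2k`. -/
def HasGenus (Λ : CellulatedSurface) (k : ℕ) : Prop :=
  (Fintype.card Λ.Vertex : ℤ) - Fintype.card Λ.Edge + Fintype.card Λ.Face = 2 - 2 * k

/-!
### Regions

There is one qubit on every edge. The qubit on the edge `e` occupies the quadrilateral tile whose
corners are the two end points of `e` and the (centres of the) two faces next to `e`. These tiles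
form a quadrangulation of the surface; its vertices are the vertices and the faces of the
cellulation, and it has one side for every dart `d`: the segment that joins `vert d` to `face d`,
and that separates the tile of `edge d` from the tile of `edge (rot d)`. A region is a set of
qubits, that is, a union of closed tiles.
-/

/-- The vertices of the quadrangulation. -/
abbrev Point (Λ : CellulatedSurface) : Type := Λ.Vertex ⊕ Λ.Face

/-- An oriented side of the quadrangulation: `(d, true)` goes from `vert d` to `face d`, and
`(d, false)` goes back. -/
abbrev Step (Λ : CellulatedSurface) : Type := Λ.Dart × Bool

def Step.source {Λ : CellulatedSurface} (s : Λ.Step) : Λ.Point :=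
  if s.2 then Sum.inl (Λ.vert s.1) else Sum.inr (Λ.face s.1)

def Step.target {Λ : CellulatedSurface} (s : Λ.Step) : Λ.Point :=
  if s.2 then Sum.inr (Λ.face s.1) else Sum.inl (Λ.vert s.1)

def Step.reverse {Λ : CellulatedSurface} (s : Λ.Step) : Λ.Step := (s.1, !s.2)

/-- The side belongs to the union of the closed tiles of `A`. -/
def Step.InRegion {Λ : CellulatedSurface} (A : Finset Λ.Edge) (s : Λ.Step) : Prop :=
  Λ.edge s.1 ∈ A ∨ Λ.edge (Λ.rot s.1) ∈ A

/-- The point belongs to the union of the closed tiles of `A`. -/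
def PointInRegion (Λ : CellulatedSurface) (A : Finset Λ.Edge) (x : Λ.Point) : Prop :=
  ∃ d, Λ.edge d ∈ A ∧ (x = Sum.inl (Λ.vert d) ∨ x = Sum.inr (Λ.face d))

/-- `p` is an edge path from `x` to `y` along the sides of the tiles of `A`. -/
def IsPath (Λ : CellulatedSurface) (A : Finset Λ.Edge) (x y : Λ.Point) : List Λ.Step → Prop
  | [] => x = y
  | s :: p => s.InRegion A ∧ s.source = x ∧ IsPath Λ A s.target y p

/-- The closed path around the tile of `edge d`, from `vert d` through `face d`, through the other
end point of the edge and through the other face back to `vert d`. -/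
def tileBoundary (Λ : CellulatedSurface) (d : Λ.Dart) : List Λ.Step :=
  [(d, true), (Λ.rot⁻¹ (Λ.flip d), false), (Λ.flip d, true), (Λ.rot⁻¹ d, false)]

/-- An elementary homotopy in the region `A`: removal of a backtracking or of the boundary of a
tile of `A`. -/
inductive Move (Λ : CellulatedSurface) (A : Finset Λ.Edge) : List Λ.Step → List Λ.Step → Prop
  | backtrack (p q : List Λ.Step) (s : Λ.Step) (hs : s.InRegion A) :
      Move Λ A (p ++ [s, s.reverse] ++ q) (p ++ q)
  | tile (p q : List Λ.Step) (d : Λ.Dart) (hd : Λ.edge d ∈ A) :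
      Move Λ A (p ++ Λ.tileBoundary d ++ q) (p ++ q)

/-- Homotopy, within `A` and relative to the base point `x`, of closed edge paths at `x`. -/
def LoopHomotopic (Λ : CellulatedSurface) (A : Finset Λ.Edge) (x : Λ.Point) :
    List Λ.Step → List Λ.Step → Prop :=
  Relation.EqvGen fun p q => Λ.IsPath A x x p ∧ Λ.IsPath A x x q ∧ Λ.Move A p q

/-- The union of the closed tiles of `A` is nonempty, path connected, and has a trivial edge path
group at every base point. -/
def IsSimplyConnected (Λ : CellulatedSurface) (A : Finset Λ.Edge) : Prop :=
  A.Nonempty ∧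
  (∀ x y, Λ.PointInRegion A x → Λ.PointInRegion A y → ∃ p, Λ.IsPath A x y p) ∧
  ∀ x, Λ.PointInRegion A x → ∀ p, Λ.IsPath A x x p → Λ.LoopHomotopic A x p []

/-- The closed tiles of the two qubits have a point in common. -/
def Touch (Λ : CellulatedSurface) (e e' : Λ.Edge) : Prop :=
  ∃ d d', Λ.edge d = e ∧ Λ.edge d' = e' ∧ (Λ.vert d = Λ.vert d' ∨ Λ.face d = Λ.face d')

def tileGraph (Λ : CellulatedSurface) : SimpleGraph Λ.Edge := SimpleGraph.fromRel Λ.Touch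

/-- The lattice distance of two nonempty regions. -/
noncomputable def regionDist (Λ : CellulatedSurface) (A C : Finset Λ.Edge) : ℕ :=
  sInf {n | ∃ a ∈ A, ∃ c ∈ C, n = Λ.tileGraph.dist a c}

/-- The partitions `A | B | C` with `C = (A ∪ B)ᶜ` that enter the Markov length: `A` and `A ∪ B`
are simply connected, and `A` does not touch `C`, so that `B` is an annulus-shaped buffer around
`A`. -/
def IsMarkovPartition (Λ : CellulatedSurface) (A B : Finset Λ.Edge) : Prop :=
  Disjoint A B ∧ Λ.IsSimplyConnected A ∧ Λ.IsSimplyConnected (A ∪ B) ∧ (A ∪ B)ᶜ.Nonempty ∧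
  ∀ a ∈ A, ∀ c ∈ (A ∪ B)ᶜ, ¬ Λ.Touch a c

/-!
### Qubits, reduced states, entropies
-/

/-- Computational (Pauli `Z`) basis states of the qubits in a set `A`. -/
abbrev Config (Λ : CellulatedSurface) : Type := Λ.Edge → ZMod 2

/-- Operators on the Hilbert space of all the qubits. -/
abbrev Op (Λ : CellulatedSurface) : Type := Matrix Λ.Config Λ.Config ℂ

def glue {Λ : CellulatedSurface} (A : Finset Λ.Edge) (a : A → ZMod 2)
    (c : {e // e ∉ A} → ZMod 2) : Λ.Config :=
  fun e => if h : e ∈ A then a ⟨e, h⟩ else c ⟨e, h⟩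

/-- The reduced state `σ_A`: the partial trace over the qubits outside `A`. -/
def reduced {Λ : CellulatedSurface} (σ : Λ.Op) (A : Finset Λ.Edge) :
    Matrix (A → ZMod 2) (A → ZMod 2) ℂ :=
  Matrix.of fun a b => ∑ c : {e // e ∉ A} → ZMod 2, σ (glue A a c) (glue A b c)

end CellulatedSurface

section Matrices

variable {n : Type*} [Fintype n] [DecidableEq n]

def IsDensityMatrix (σ : Matrix n n ℂ) : Prop := σ.PosSemidef ∧ σ.trace = 1

open Classical in
/-- The von Neumann entropy `-tr (σ log σ)` of a Hermitian matrix, through its eigenvalues. -/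
noncomputable def vonNeumannEntropy (σ : Matrix n n ℂ) : ℝ :=
  if h : σ.IsHermitian then ∑ i, Real.negMulLog (h.eigenvalues i) else 0

/-- The trace norm: the sum of the singular values. -/
noncomputable def traceNorm (M : Matrix n n ℂ) : ℝ :=
  ∑ i, √((Matrix.isHermitian_conjTranspose_mul_self M).eigenvalues i)

end Matrices

namespace CellulatedSurface

/-- The conditional mutual information `I(A : C | B)` of `σ` with `C = (A ∪ B)ᶜ`, so that
`BC = Aᶜ` for disjoint `A` and `B`. -/
noncomputable def cmi {Λ : CellulatedSurface} (σ : Λ.Op) (A B : Finset Λ.Edge) : ℝ :=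
  vonNeumannEntropy (reduced σ (A ∪ B)) + vonNeumannEntropy (reduced σ Aᶜ)
    - vonNeumannEntropy σ - vonNeumannEntropy (reduced σ B)

/-!
### Loop ensembles
-/

/-- The vertex term of `A_v`: the edges at `v`, counted modulo 2. -/
def star (Λ : CellulatedSurface) (v : Λ.Vertex) : Λ.Edge → ZMod 2 :=
  fun e => ∑ d with Λ.vert d = v ∧ Λ.edge d = e, 1

def pairing {Λ : CellulatedSurface} (w s : Λ.Edge → ZMod 2) : ZMod 2 := ∑ e, w e * s e

/-- Loop configurations: an even number of occupied edges meets every vertex. -/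
def IsLoopConfig (Λ : CellulatedSurface) (s : Λ.Config) : Prop :=
  ∀ v, ∑ d with Λ.vert d = v, s (Λ.edge d) = 0

/-- Closed loops (modulo 2) of the dual lattice, as sets of crossed edges: an even number of edges
is crossed on the boundary of every face. -/
def IsDualCycle (Λ : CellulatedSurface) (w : Λ.Edge → ZMod 2) : Prop :=
  ∀ f, ∑ d with Λ.face d = f, w (Λ.edge d) = 0

/-- `w` and `w'` differ by deformations across vertices. -/
def Homologous {Λ : CellulatedSurface} (w w' : Λ.Edge → ZMod 2) : Prop :=
  ∃ u : Λ.Vertex → ZMod 2, w' = w + ∑ v, u v • Λ.star v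

/-- Loops `w i` of the dual lattice, no nontrivial combination of which is contractible. On a
surface of genus `k`, a system of `2k` such loops represents all the inequivalent holes. -/
def IsIndependentHoles (Λ : CellulatedSurface) {ι : Type} [Fintype ι]
    (w : ι → Λ.Edge → ZMod 2) : Prop :=
  (∀ i, Λ.IsDualCycle (w i)) ∧ ∀ a : ι → ZMod 2, Homologous 0 (∑ i, a i • w i) → a = 0

open Classical in
/-- The loop configurations `s` that cross each dual loop `w i` with parity `p i`. -/
noncomputable def loopSector (Λ : CellulatedSurface) {ι : Type} (w : ι → Λ.Edge → ZMod 2)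
    (p : ι → ZMod 2) : Finset Λ.Config :=
  {s | Λ.IsLoopConfig s ∧ ∀ i, pairing (w i) s = p i}

/-- The uniform mixture of the basis states in the loop sector. -/
noncomputable def loopState (Λ : CellulatedSurface) {ι : Type} (w : ι → Λ.Edge → ZMod 2)
    (p : ι → ZMod 2) : Λ.Op :=
  ((Λ.loopSector w p).card : ℂ)⁻¹ • ∑ s ∈ Λ.loopSector w p, Matrix.single s s 1

end CellulatedSurface

/-!
### Stabilizer states
-/

inductive PauliLabel
  | I | X | Y | Z

def PauliLabel.mat : PauliLabel → Matrix (ZMod 2) (ZMod 2) ℂ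
  | I => 1
  | X => Matrix.of fun a b => if a = b then 0 else 1
  | Y => Matrix.of fun a b => if a = b then 0 else if a = 0 then -Complex.I else Complex.I
  | Z => Matrix.of fun a b => if a = b then (if a = 0 then 1 else -1) else 0

namespace CellulatedSurface

/-- The tensor product of one-qubit Pauli matrices. -/
def pauliString {Λ : CellulatedSurface} (k : Λ.Edge → PauliLabel) : Λ.Op :=
  Matrix.of fun s t => ∏ e, (k e).mat (s e) (t e)

/-- `±` a tensor product of one-qubit Pauli matrices. -/
def IsPauliOperator {Λ : CellulatedSurface} (M : Λ.Op) : Prop :=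
  ∃ k : Λ.Edge → PauliLabel, M = pauliString k ∨ M = -pauliString k

/-- `Z_w`, the product of the Pauli `Z` operators over the edges in `w`. -/
def zString {Λ : CellulatedSurface} (w : Λ.Edge → ZMod 2) : Λ.Op :=
  pauliString fun e => if w e = 0 then PauliLabel.I else PauliLabel.Z

/-- `ρ` is the stabilizer state with the commuting and multiplicatively independent generators
`g i`: the density matrix proportional to `∏ i, (1 + g i) / 2`. -/
def IsStabilizerState {Λ : CellulatedSurface} (ρ : Λ.Op) {ι : Type} [Fintype ι]
    (g : ι → Λ.Op) : Prop :=
  (∀ i, IsPauliOperator (g i)) ∧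
  IsDensityMatrix ρ ∧
  ∃ hg : ∀ i j, Commute (g i) (g j),
    (∀ T : Finset ι, T.Nonempty → T.noncommProd g (fun i _ j _ _ => hg i j) ≠ 1) ∧
    ∃ c : ℂ, ρ = c • Finset.univ.noncommProd (fun i => (2⁻¹ : ℂ) • (1 + g i))
      (fun i _ j _ _ => (((Commute.one_left _).add_left
        ((Commute.one_right _).add_right (hg i j))).smul_left _).smul_right _)

/-- The vertex operators `A_v` for `v ≠ v₀`, and the signed operators `(-1)^(p i) Z_(w i)`. -/
def loopGenerators (Λ : CellulatedSurface) (v₀ : Λ.Vertex) {ι : Type}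
    (w : ι → Λ.Edge → ZMod 2) (p : ι → ZMod 2) : {v // v ≠ v₀} ⊕ ι → Λ.Op
  | Sum.inl v => zString (Λ.star v)
  | Sum.inr i => (-1 : ℂ) ^ (p i).val • zString (w i)

end CellulatedSurface

/-!
### Families of states, Markov length, locally indistinguishable sets

A many-body system is a family of surfaces `Λ L` indexed by the linear size `L`.
-/

abbrev StateFamily (Λ : ℕ+ → CellulatedSurface) : Type := ∀ L, (Λ L).Op

/-- `x L = L^{-∞}`: decay faster than any inverse power of `L`. -/
def IsNegligible (x : ℕ+ → ℝ) : Prop :=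
  Asymptotics.SuperpolynomialDecay atTop (fun L : ℕ+ => (L : ℝ)) x

/-- Equality of many-body states in the thermodynamic limit. -/
def AsympEq {Λ : ℕ+ → CellulatedSurface} (σ τ : StateFamily Λ) : Prop :=
  IsNegligible fun L => traceNorm (σ L - τ L)

/-- `I(A : C | B) ≤ poly(L) exp (-dist(A, C) / ξ)` for all the partitions `A | B | C`. -/
def HasMarkovBound {Λ : ℕ+ → CellulatedSurface} (σ : StateFamily Λ) (ξ : ℝ) : Prop :=
  ∃ (K : ℝ) (m : ℕ), ∀ L, ∀ A B, (Λ L).IsMarkovPartition A B →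
    CellulatedSurface.cmi (σ L) A B ≤
      K * (L : ℝ) ^ m * Real.exp (-((Λ L).regionDist A (A ∪ B)ᶜ : ℝ) / ξ)

/-- The Markov length (infinite if there is no bound). -/
noncomputable def markovLength {Λ : ℕ+ → CellulatedSurface} (σ : StateFamily Λ) : ENNReal :=
  ⨅ (ξ : ℝ) (_ : 0 < ξ ∧ HasMarkovBound σ ξ), ENNReal.ofReal ξ

/-- The reduced states on simply connected regions are equal in the thermodynamic limit, uniformly
in the region. -/
def LocallyIndistinguishable {Λ : ℕ+ → CellulatedSurface} (σ ρ : StateFamily Λ) : Prop :=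
  ∃ ε : ℕ+ → ℝ, IsNegligible ε ∧ ∀ L, ∀ A, (Λ L).IsSimplyConnected A →
    traceNorm (CellulatedSurface.reduced (σ L) A - CellulatedSurface.reduced (ρ L) A) ≤ ε L

/-- The locally indistinguishable set `Q(ρ; ξ₀)`. -/
def locallyIndistinguishableSet {Λ : ℕ+ → CellulatedSurface} (ρ : StateFamily Λ) (ξ₀ : ENNReal) :
    Set (StateFamily Λ) :=
  {σ | (∀ L, IsDensityMatrix (σ L)) ∧ markovLength σ ≤ ξ₀ ∧ LocallyIndistinguishable σ ρ}

/-- The families of states that lie, at every `L`, in the convex hull of the given states. -/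
def convFamily {Λ : ℕ+ → CellulatedSurface} {κ : Type} (ρ : κ → StateFamily Λ) :
    Set (StateFamily Λ) :=
  {σ | ∀ L, σ L ∈ convexHull ℝ (Set.range fun p => ρ p L)}

/-- `Λ L` is a two-dimensional lattice of linear size `L`: the number of qubits grows at most
polynomially, and for large `L` every qubit, with the ones that touch it, lies in a disk with an
annular buffer of width at least `c * L` around it. -/
def IsLatticeFamily (Λ : ℕ+ → CellulatedSurface) : Prop :=
  (∃ (K : ℝ) (m : ℕ), ∀ L : ℕ+, (Fintype.card (Λ L).Edge : ℝ) ≤ K * (L : ℝ) ^ m) ∧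
  ∃ c : ℝ, 0 < c ∧ ∀ᶠ L : ℕ+ in atTop, ∀ e, ∃ A B, (Λ L).IsMarkovPartition A B ∧
    (∀ e', (Λ L).Touch e e' → e' ∈ A) ∧ c * L ≤ (Λ L).regionDist A (A ∪ B)ᶜ

/-!
### The square lattice on a torus
-/

namespace SquareTorus

/-- Vertices of the `L × L` square lattice with periodic boundary conditions. -/
abbrev Site (L : ℕ) : Type := ZMod L × ZMod L

/-- The darts at a site, in counterclockwise order: `0` east, `1` north, `2` west, `3` south. -/
abbrev Dart (L : ℕ) : Type := Site L × Fin 4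

/-- The edge `(v, 0)` joins `v` to `v + (1, 0)`, and `(v, 1)` joins `v` to `v + (0, 1)`. -/
abbrev Edge (L : ℕ) : Type := Site L × Fin 2

def unit (L : ℕ) (k : Fin 4) : Site L := ![(1, 0), (0, 1), (-1, 0), (0, -1)] k

def rot (L : ℕ) : Equiv.Perm (Dart L) where
  toFun d := (d.1, d.2 + 1)
  invFun d := (d.1, d.2 - 1)
  left_inv d := by simp
  right_inv d := by simp

theorem flip_aux (L : ℕ) (d : Dart L) :
    ((d.1 + unit L d.2 + unit L (d.2 + 2), d.2 + 2 + 2) : Dart L) = d := by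
  obtain ⟨⟨x, y⟩, k⟩ := d
  fin_cases k <;> simp [unit]

def flip (L : ℕ) : Equiv.Perm (Dart L) where
  toFun d := (d.1 + unit L d.2, d.2 + 2)
  invFun d := (d.1 + unit L d.2, d.2 + 2)
  left_inv d := flip_aux L d
  right_inv d := flip_aux L d

def edge (L : ℕ) (d : Dart L) : Edge L :=
  ![(d.1, 0), (d.1, 1), (d.1 - (1, 0), 0), (d.1 - (0, 1), 1)] d.2

/-- The face on the left of a dart; a face is labelled by its lower left corner. -/
def face (L : ℕ) (d : Dart L) : Site L :=
  ![d.1, d.1 - (1, 0), d.1 - (1, 1), d.1 - (0, 1)] d.2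

theorem eq_of_sameCycle {α β : Type} (f : Equiv.Perm α) (g : α → β) (h : ∀ a, g (f a) = g a)
    {a b : α} (hab : f.SameCycle a b) : g a = g b := by
  have key : ∀ n : ℤ, ∀ a, g ((f ^ n) a) = g a := by
    intro n
    induction n using Int.induction_on with
    | zero => intro a; simp
    | succ n ih => intro a; rw [zpow_add_one, Equiv.Perm.mul_apply, ih, h]
    | pred n ih =>
      intro a
      rw [zpow_sub_one, Equiv.Perm.mul_apply, ih, ← h (f⁻¹ a)]
      simp
  obtain ⟨n, rfl⟩ := hab
  exact (key n a).symm

theorem sameCycle_step {α : Type} (f : Equiv.Perm α) {a b : α} (h : f a = b) : f.SameCycle b a := by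
  subst h
  exact (Equiv.Perm.SameCycle.refl f a).apply_left

theorem vert_cycle (L : ℕ) (d : Dart L) : (rot L).SameCycle d (d.1, 0) := by
  obtain ⟨v, k⟩ := d
  have h1 : (rot L).SameCycle (v, 1) (v, 0) := sameCycle_step _ rfl
  have h2 : (rot L).SameCycle (v, 2) (v, 1) := sameCycle_step _ rfl
  have h3 : (rot L).SameCycle (v, 3) (v, 2) := sameCycle_step _ rfl
  fin_cases k
  · exact .refl _ _
  · exact h1
  · exact h2.trans h1
  · exact h3.trans (h2.trans h1)

theorem edge_cycle (L : ℕ) (d : Dart L) :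
    (flip L).SameCycle d ((edge L d).1, if (edge L d).2 = 0 then 0 else 1) := by
  obtain ⟨v, k⟩ := d
  fin_cases k
  · exact .refl _ _
  · exact .refl _ _
  · refine sameCycle_step _ ?_
    simp [flip, edge, unit]
  · refine sameCycle_step _ ?_
    simp [flip, edge, unit]

theorem face_cycle (L : ℕ) (d : Dart L) :
    ((rot L)⁻¹ * flip L).SameCycle d (face L d, 0) := by
  have h1 : ∀ v, ((rot L)⁻¹ * flip L).SameCycle (v, 1) (v - (1, 0), 0) := by
    intro v
    refine sameCycle_step _ ?_
    change ((v - (1, 0) + unit L 0, 0 + 2 - 1) : Dart L) = _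
    simp [unit]
  have h2 : ∀ v, ((rot L)⁻¹ * flip L).SameCycle (v, 2) (v - (0, 1), 1) := by
    intro v
    refine sameCycle_step _ ?_
    change ((v - (0, 1) + unit L 1, 1 + 2 - 1) : Dart L) = _
    simp [unit]
  have h3 : ∀ v, ((rot L)⁻¹ * flip L).SameCycle (v, 3) (v + (1, 0), 2) := by
    intro v
    refine sameCycle_step _ ?_
    change ((v + (1, 0) + unit L 2, 2 + 2 - 1) : Dart L) = _
    obtain ⟨x, y⟩ := v
    simp [unit]
    rfl
  obtain ⟨v, k⟩ := d
  fin_cases k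
  · exact .refl _ _
  · exact h1 v
  · have h := (h2 v).trans (h1 _)
    have e : face L (v, 2) = v - (0, 1) - (1, 0) := by
      obtain ⟨x, y⟩ := v
      simp [face]
    change ((rot L)⁻¹ * flip L).SameCycle (v, 2) (face L (v, 2), 0)
    rw [e]
    exact h
  · have h := (h3 v).trans ((h2 _).trans (h1 _))
    have e : face L (v, 3) = v + (1, 0) - (0, 1) - (1, 0) := by
      obtain ⟨x, y⟩ := v
      simp [face]
    change ((rot L)⁻¹ * flip L).SameCycle (v, 3) (face L (v, 3), 0)
    rw [e]
    exact h

theorem edge_flip (L : ℕ) (d : Dart L) : edge L (flip L d) = edge L d := by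
  obtain ⟨⟨x, y⟩, k⟩ := d
  fin_cases k
  · change ((((x, y) + (1, 0)) - (1, 0), 0) : Edge L) = ((x, y), 0)
    simp
  · change ((((x, y) + (0, 1)) - (0, 1), 1) : Edge L) = ((x, y), 1)
    simp
  · change (((x, y) + (-1, 0), 0) : Edge L) = ((x, y) - (1, 0), 0)
    simp [sub_eq_add_neg]
  · change (((x, y) + (0, -1), 1) : Edge L) = ((x, y) - (0, 1), 1)
    simp [sub_eq_add_neg]

theorem face_step (L : ℕ) (d : Dart L) : face L (((rot L)⁻¹ * flip L) d) = face L d := by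
  obtain ⟨⟨x, y⟩, k⟩ := d
  fin_cases k
  · change (x, y) + (1, 0) - (1, 0) = (x, y)
    simp
  · change (x, y) + (0, 1) - (1, 1) = (x, y) - (1, 0)
    simp
  · change (x, y) + (-1, 0) - (0, 1) = (x, y) - (1, 1)
    simp [sub_eq_add_neg]
  · change (x, y) + (0, -1) = (x, y) - (0, 1)
    simp [sub_eq_add_neg]

theorem connected (L : ℕ) [NeZero L] (d d' : Dart L) :
    ∃ g ∈ Subgroup.closure {rot L, flip L}, g d = d' := by
  let R : Dart L → Dart L → Prop := fun a b => ∃ g ∈ Subgroup.closure {rot L, flip L}, g a = b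
  have trans : ∀ {a b c}, R a b → R b c → R a c := by
    rintro a b c ⟨g, hg, rfl⟩ ⟨h, hh, rfl⟩
    exact ⟨h * g, mul_mem hh hg, rfl⟩
  have symm : ∀ {a b}, R a b → R b a := by
    rintro a b ⟨g, hg, rfl⟩
    exact ⟨g⁻¹, inv_mem hg, by simp⟩
  have hrot : ∀ a, R a (rot L a) := fun a => ⟨rot L, Subgroup.subset_closure (by simp), rfl⟩
  have hflip : ∀ a, R a (flip L a) := fun a => ⟨flip L, Subgroup.subset_closure (by simp), rfl⟩
  have hk : ∀ v k, R (v, 0) (v, k) := by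
    intro v k
    have h1 : R (v, 0) (v, 1) := hrot _
    have h2 : R (v, 1) (v, 2) := hrot _
    have h3 : R (v, 2) (v, 3) := hrot _
    fin_cases k
    · exact ⟨1, one_mem _, rfl⟩
    · exact h1
    · exact trans h1 h2
    · exact trans h1 (trans h2 h3)
  have hx : ∀ v, R (v, 0) (v + (1, 0), 0) := fun v =>
    trans (hflip (v, 0)) (symm (hk _ 2))
  have hy : ∀ v, R (v, 0) (v + (0, 1), 0) := fun v =>
    trans (hk v 1) (trans (hflip (v, 1)) (symm (hk _ 3)))
  have hxn : ∀ n : ℕ, R ((0, 0), 0) (((n : ZMod L), 0), 0) := by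
    intro n
    induction n with
    | zero => exact ⟨1, one_mem _, by simp⟩
    | succ n ih =>
      have := trans ih (hx _)
      simpa using this
  have hyn : ∀ (x : ZMod L) (n : ℕ), R ((x, 0), 0) ((x, (n : ZMod L)), 0) := by
    intro x n
    induction n with
    | zero => exact ⟨1, one_mem _, by simp⟩
    | succ n ih =>
      have := trans ih (hy _)
      simpa using this
  have hall : ∀ d : Dart L, R ((0, 0), 0) d := by
    rintro ⟨⟨x, y⟩, k⟩
    have h1 := hxn x.val
    have h2 := hyn x y.val
    rw [ZMod.natCast_zmod_val] at h1 h2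
    exact trans h1 (trans h2 (hk _ _))
  exact trans (symm (hall d)) (hall d')

end SquareTorus

/-- The `L × L` square lattice on the torus. -/
def squareTorus (L : ℕ) [NeZero L] : CellulatedSurface where
  Dart := SquareTorus.Dart L
  Vertex := SquareTorus.Site L
  Edge := SquareTorus.Edge L
  Face := SquareTorus.Site L
  rot := SquareTorus.rot L
  flip := SquareTorus.flip L
  vert := Prod.fst
  edge := SquareTorus.edge L
  face := SquareTorus.face L
  nonempty := ⟨(0, 0)⟩
  flip_flip := SquareTorus.flip_aux L
  flip_ne := by
    rintro ⟨v, k⟩ h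
    have : k + 2 = k := congrArg Prod.snd h
    clear h
    revert k
    decide
  connected := SquareTorus.connected L
  vert_surjective v := ⟨(v, 0), rfl⟩
  edge_surjective := by
    rintro ⟨v, k⟩
    fin_cases k
    · exact ⟨(v, 0), rfl⟩
    · exact ⟨(v, 1), rfl⟩
  face_surjective v := ⟨(v, 0), rfl⟩
  vert_eq_iff d d' := by
    refine ⟨fun h => ?_, SquareTorus.eq_of_sameCycle _ _ fun _ => rfl⟩
    have h1 := SquareTorus.vert_cycle L d
    rw [h] at h1
    exact h1.trans (SquareTorus.vert_cycle L d').symm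
  edge_eq_iff d d' := by
    refine ⟨fun h => ?_, SquareTorus.eq_of_sameCycle _ _ (SquareTorus.edge_flip L)⟩
    have h1 := SquareTorus.edge_cycle L d
    rw [h] at h1
    exact h1.trans (SquareTorus.edge_cycle L d').symm
  face_eq_iff d d' := by
    refine ⟨fun h => ?_, SquareTorus.eq_of_sameCycle _ _ (SquareTorus.face_step L)⟩
    have h1 := SquareTorus.face_cycle L d
    rw [h] at h1
    exact h1.trans (SquareTorus.face_cycle L d').symm

/-- The dual loops that measure the winding parities on the torus: `torusWinding L 0` crosses the
edges from `(0, y)` to `(1, y)`, so that it counts the loops around the `x` direction, and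
`torusWinding L 1` crosses the edges from `(x, 0)` to `(x, 1)`. -/
def torusWinding (L : ℕ) [NeZero L] : Fin 2 → (squareTorus L).Edge → ZMod 2
  | 0 => fun e : SquareTorus.Edge L => if e.1.1 = 0 ∧ e.2 = 0 then 1 else 0
  | 1 => fun e : SquareTorus.Edge L => if e.1.2 = 0 ∧ e.2 = 1 then 1 else 0

/-- The family of the square lattices on the torus. -/
def torusFamily (L : ℕ+) : CellulatedSurface := squareTorus L

/-- The loop ensemble on the torus with winding parities `sx` and `sy`. -/
noncomputable def torusLoopState (sx sy : ZMod 2) : StateFamily torusFamily :=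
  fun L => (squareTorus L).loopState (torusWinding L) ![sx, sy]

/-!
The states involved are diagonal in the computational basis, and the proof is linear algebra over
`ZMod 2` combined with elementary entropy inequalities.

*The sectors.* The loop configurations with given winding parities form a coset of the group of
those with even parities, so `loopState` is the uniform distribution on a coset. Its generators are
diagonal with entries `± 1`, and the product of the projections `(1 + g) / 2` is the indicator
function of the coset (`isStabilizerState_loopState`); independence of the generators is
independence of the dual loops modulo stars, together with the fact that the only relation among
the stars is that all of them sum to zero. Different cosets are disjoint, which gives the trace norm
of a linear combination and hence the simplex (`traceNorm_sum_smul_loopState`,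
`linearIndependent_loopState`).

*Indistinguishability.* Every cochain on the sides of the tiles of a simply connected region which
is closed has a potential (`IsSimplyConnected.exists_potential`). Hence dual loops in the region are
contractible, and by the Fredholm alternative there is a loop configuration outside the region with
any given winding parities (`exists_isLoopConfig_off`). Adding it exchanges the sectors without
changing the reduced state (`reduced_loopState_eq`).

*Markov property.* Given the qubits around a simply connected region `A`, a mixture of loop
ensembles is uniform on a coset of the group `cyclesIn A` of the loop configurations inside `A`.
Thus both conditional entropies in the conditional mutual information are the logarithm of the order
of this group, and it vanishes (`vonNeumannEntropy_reduced_union`, `cmi_eq_zero`).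

*Rigidity.* Let `σ` be a state which is locally close to the loop ensembles, with a small
conditional mutual information for a partition in which `A` contains a given qubit and its
neighbours. The average of `σ` over the operators `Z` in `A` and the loop operators `X` in `A` has
the largest entropy compatible with the reduced state of `σ` outside `A`, and the local data
together with the small conditional mutual information imply that `σ` almost has this entropy. By
Klein's inequality with a quadratic remainder `σ` is close to its average, that is, almost invariant
under these operators (`traceNorm_sub_twirl_sq_le`, `pauliDefect_le`). The errors add up under
products (`pauliDefect_sum_le`), the single-qubit operators `Z` generate all the operators `Z`, and
on a surface of genus `k` the boundaries of the faces generate all the loop configurations with even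
winding parities, by Euler's formula (`exists_eq_sum_smul_faceBoundary`). So `σ` is almost diagonal
and almost uniform on every sector, with an error which is a polynomial in the size times square
roots of the local errors (`exists_mem_convexHull_traceNorm_sub_le`). Superpolynomially small errors
remain so (`isNegligible_rigidity_bound`), which is the asymptotic equality
(`exists_mem_convFamily_asympEq`).

*The torus.* The vertices and the faces of the square lattice form a square grid, rotated by 45
degrees, whose plaquettes are the tiles. Squares of tiles which do not wrap around the torus are
simply connected (`GridChart.isSimplyConnected_block`), and concentric squares around a qubit give
the partitions required of a family of lattices (`isLatticeFamily_torusFamily`).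
-/

set_option linter.unusedSectionVars false

/-! ### The spectrum of Hermitian matrices -/

section Spectral

open Matrix

variable {n k : Type*} [Fintype n] [DecidableEq n] [Fintype k] [DecidableEq k]

theorem Matrix.IsHermitian.eq_unitary_diagonal {M : Matrix n n ℂ} (hM : M.IsHermitian) :
    M = (hM.eigenvectorUnitary : Matrix n n ℂ) *
      diagonal (fun i => (hM.eigenvalues i : ℂ)) * (hM.eigenvectorUnitary : Matrix n n ℂ)ᴴ := by
  conv_lhs => rw [hM.spectral_theorem, Unitary.conjStarAlgAut_apply]
  rfl

theorem Matrix.IsHermitian.eigenvectorUnitary_conjTranspose_mul {M : Matrix n n ℂ}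
    (hM : M.IsHermitian) :
    (hM.eigenvectorUnitary : Matrix n n ℂ)ᴴ * (hM.eigenvectorUnitary : Matrix n n ℂ) = 1 :=
  (Matrix.mem_unitaryGroup_iff').1 hM.eigenvectorUnitary.2

theorem Matrix.IsHermitian.eigenvectorUnitary_mul_conjTranspose {M : Matrix n n ℂ}
    (hM : M.IsHermitian) :
    (hM.eigenvectorUnitary : Matrix n n ℂ) * (hM.eigenvectorUnitary : Matrix n n ℂ)ᴴ = 1 :=
  (Matrix.mem_unitaryGroup_iff).1 hM.eigenvectorUnitary.2

/-- The nonzero spectrum, with multiplicities, can be read off from any decomposition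
`W * diagonal μ * Wᴴ` with an isometry `W`, which need not be surjective. -/
theorem Matrix.IsHermitian.sum_eigenvalues_eq {M : Matrix n n ℂ} (hM : M.IsHermitian)
    (W : Matrix n k ℂ) (μ : k → ℝ) (hW : Wᴴ * W = 1)
    (h : M = W * diagonal (fun i => (μ i : ℂ)) * Wᴴ) (f : ℝ → ℝ) (hf : f 0 = 0) :
    ∑ i, f (hM.eigenvalues i) = ∑ j, f (μ j) := by
  have h1 := charpoly_mul_comm' W (diagonal (fun i => (μ i : ℂ)) * Wᴴ)
  rw [← Matrix.mul_assoc, ← h, Matrix.mul_assoc, hW, Matrix.mul_one] at h1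
  have h2 : (diagonal (fun i => (μ i : ℂ))).charpoly.roots =
      Multiset.map (fun i => (μ i : ℂ)) Finset.univ.val := by
    rw [Matrix.charpoly_diagonal]
    rw [Polynomial.roots_prod]
    · simp [Multiset.bind_singleton]
    · exact Finset.prod_ne_zero_iff.2 fun i _ => Polynomial.X_sub_C_ne_zero _
  have h3 := congrArg Polynomial.roots h1
  rw [Polynomial.roots_mul (mul_ne_zero (pow_ne_zero _ Polynomial.X_ne_zero)
      (Matrix.charpoly_monic _).ne_zero), Polynomial.roots_mul (mul_ne_zero (pow_ne_zero _
      Polynomial.X_ne_zero) (Matrix.charpoly_monic _).ne_zero), h2,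
    hM.roots_charpoly_eq_eigenvalues] at h3
  have h4 := congrArg (fun s => (s.map (fun z : ℂ => f z.re)).sum) h3
  simpa [hf, Multiset.map_nsmul, Multiset.sum_nsmul, Function.comp_def] using h4

theorem vonNeumannEntropy_eq_of_isometry {M : Matrix n n ℂ}
    (W : Matrix n k ℂ) (μ : k → ℝ) (hW : Wᴴ * W = 1)
    (h : M = W * diagonal (fun i => (μ i : ℂ)) * Wᴴ) :
    vonNeumannEntropy M = ∑ j, Real.negMulLog (μ j) := by
  have hM : M.IsHermitian := by
    rw [h, Matrix.IsHermitian, conjTranspose_mul, conjTranspose_mul, conjTranspose_conjTranspose,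
      diagonal_conjTranspose, Matrix.mul_assoc]
    congr 3
    ext i
    simp
  rw [vonNeumannEntropy, dif_pos hM]
  exact hM.sum_eigenvalues_eq W μ hW h _ (by simp)

/-- The trace norm of a Hermitian matrix from a diagonalization. -/
theorem traceNorm_eq_of_isometry {M : Matrix n n ℂ}
    (W : Matrix n k ℂ) (μ : k → ℝ) (hW : Wᴴ * W = 1)
    (h : M = W * diagonal (fun i => (μ i : ℂ)) * Wᴴ) :
    traceNorm M = ∑ j, |μ j| := by
  rw [traceNorm, (isHermitian_conjTranspose_mul_self M).sum_eigenvalues_eq W (fun j => μ j ^ 2) hW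
    ?_ (fun x => √x) (by simp)]
  · simp [Real.sqrt_sq_eq_abs]
  · have : Mᴴ = M := by
      rw [h, conjTranspose_mul, conjTranspose_mul, conjTranspose_conjTranspose,
        diagonal_conjTranspose, Matrix.mul_assoc]
      congr 3
      ext i
      simp
    rw [this, h]
    calc _ = W * diagonal (fun i => (μ i : ℂ)) * (Wᴴ * W) * diagonal (fun i => (μ i : ℂ)) * Wᴴ := by
          simp only [Matrix.mul_assoc]
      _ = _ := by
          rw [hW, Matrix.mul_one, Matrix.mul_assoc W, diagonal_mul_diagonal]
          simp [sq]

theorem traceNorm_eq_sum_abs_eigenvalues {M : Matrix n n ℂ} (hM : M.IsHermitian) :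
    traceNorm M = ∑ i, |hM.eigenvalues i| :=
  traceNorm_eq_of_isometry _ _ hM.eigenvectorUnitary_conjTranspose_mul hM.eq_unitary_diagonal

theorem traceNorm_diagonal (c : n → ℝ) :
    traceNorm (diagonal fun i => (c i : ℂ)) = ∑ i, |c i| :=
  traceNorm_eq_of_isometry 1 c (by simp) (by simp)

theorem traceNorm_nonneg (M : Matrix n n ℂ) : 0 ≤ traceNorm M :=
  Finset.sum_nonneg fun _ _ => Real.sqrt_nonneg _

theorem traceNorm_zero : traceNorm (0 : Matrix n n ℂ) = 0 := by
  have := traceNorm_diagonal (fun _ : n => 0)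
  simpa using this

theorem traceNorm_conj {M : Matrix n n ℂ} (hM : M.IsHermitian) {V : Matrix n n ℂ}
    (hV : Vᴴ * V = 1) : traceNorm (V * M * Vᴴ) = traceNorm M := by
  rw [traceNorm_eq_sum_abs_eigenvalues hM]
  refine traceNorm_eq_of_isometry (V * (hM.eigenvectorUnitary : Matrix n n ℂ)) _ ?_ ?_
  · rw [conjTranspose_mul, Matrix.mul_assoc, ← Matrix.mul_assoc Vᴴ, hV, Matrix.one_mul,
      hM.eigenvectorUnitary_conjTranspose_mul]
  · conv_lhs => rw [hM.eq_unitary_diagonal]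
    simp only [conjTranspose_mul, Matrix.mul_assoc]

theorem vonNeumannEntropy_conj {M : Matrix n n ℂ} (hM : M.IsHermitian) {V : Matrix k n ℂ}
    (hV : Vᴴ * V = 1) : vonNeumannEntropy (V * M * Vᴴ) = vonNeumannEntropy M := by
  rw [vonNeumannEntropy_eq_of_isometry _ _ hM.eigenvectorUnitary_conjTranspose_mul
    hM.eq_unitary_diagonal]
  refine vonNeumannEntropy_eq_of_isometry (V * (hM.eigenvectorUnitary : Matrix n n ℂ)) _ ?_ ?_
  · rw [conjTranspose_mul, Matrix.mul_assoc, ← Matrix.mul_assoc Vᴴ, hV, Matrix.one_mul,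
      hM.eigenvectorUnitary_conjTranspose_mul]
  · conv_lhs => rw [hM.eq_unitary_diagonal]
    simp only [conjTranspose_mul, Matrix.mul_assoc]

/-! ### The trace norm -/

/-- The row sums of the absolute squares of a matrix with `V * Vᴴ = 1`. -/
theorem sum_normSq_row {V : Matrix n k ℂ} (hV : V * Vᴴ = 1) (i : n) :
    ∑ j, Complex.normSq (V i j) = 1 := by
  have := congrFun (congrFun hV i) i
  rw [Matrix.mul_apply, Matrix.one_apply_eq] at this
  have h2 := congrArg Complex.re this
  simpa [Complex.normSq_apply] using h2

theorem sum_normSq_col {V : Matrix n k ℂ} (hV : Vᴴ * V = 1) (j : k) :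
    ∑ i, Complex.normSq (V i j) = 1 := by
  have := sum_normSq_row (V := Vᴴ) (by simpa using hV) j
  simpa [Complex.normSq_apply] using this

theorem abs_re_trace_mul_le_traceNorm {M : Matrix n n ℂ} (hM : M.IsHermitian) {V : Matrix n n ℂ}
    (hV : Vᴴ * V = 1) : |(M * V).trace.re| ≤ traceNorm M := by
  set U : Matrix n n ℂ := (↑hM.eigenvectorUnitary : Matrix n n ℂ) with hU
  have hUU := hM.eigenvectorUnitary_conjTranspose_mul
  have hUU' := hM.eigenvectorUnitary_mul_conjTranspose
  rw [← hU] at hUU hUU'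
  have h1 : (M * V).trace = ∑ i, (hM.eigenvalues i : ℂ) * (Uᴴ * V * U) i i := by
    conv_lhs => rw [hM.eq_unitary_diagonal, ← hU, Matrix.mul_assoc, Matrix.mul_assoc,
      Matrix.trace_mul_comm, Matrix.mul_assoc]
    simp [Matrix.trace, Matrix.diagonal_mul, Matrix.mul_assoc]
  have hW : (Uᴴ * V * U)ᴴ * (Uᴴ * V * U) = 1 := by
    simp only [conjTranspose_mul, conjTranspose_conjTranspose]
    calc _ = Uᴴ * (Vᴴ * ((U * Uᴴ) * V)) * U := by simp only [Matrix.mul_assoc]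
      _ = 1 := by rw [hUU', Matrix.one_mul, hV, Matrix.mul_one, hUU]
  rw [traceNorm_eq_sum_abs_eigenvalues hM]
  refine (Complex.abs_re_le_norm _).trans ?_
  rw [h1]
  refine (norm_sum_le _ _).trans (Finset.sum_le_sum fun i _ => ?_)
  rw [norm_mul, Complex.norm_real, Real.norm_eq_abs]
  refine mul_le_of_le_one_right (abs_nonneg _) ?_
  have h2 := sum_normSq_col hW i
  have h3 : Complex.normSq ((Uᴴ * V * U) i i) ≤ 1 := by
    rw [← h2]
    exact Finset.single_le_sum (f := fun j => Complex.normSq ((Uᴴ * V * U) j i))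
      (fun _ _ => Complex.normSq_nonneg _) (Finset.mem_univ i)
  rw [Complex.normSq_eq_norm_sq] at h3
  nlinarith [norm_nonneg ((Uᴴ * V * U) i i)]

/-- The trace norm of a Hermitian matrix is attained at a unitary, its sign. -/
theorem exists_unitary_traceNorm_eq {M : Matrix n n ℂ} (hM : M.IsHermitian) :
    ∃ V : Matrix n n ℂ, Vᴴ * V = 1 ∧ (M * V).trace.re = traceNorm M := by
  set U : Matrix n n ℂ := (↑hM.eigenvectorUnitary : Matrix n n ℂ) with hU
  have hUU := hM.eigenvectorUnitary_conjTranspose_mul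
  rw [← hU] at hUU
  set s : n → ℂ := fun i => if 0 ≤ hM.eigenvalues i then 1 else -1 with hs
  refine ⟨U * diagonal s * Uᴴ, ?_, ?_⟩
  · simp only [conjTranspose_mul, conjTranspose_conjTranspose, diagonal_conjTranspose]
    calc _ = U * (diagonal (star s) * ((Uᴴ * U) * diagonal s)) * Uᴴ := by
          simp only [Matrix.mul_assoc]
      _ = U * Uᴴ := by
          rw [hUU, Matrix.one_mul, diagonal_mul_diagonal]
          have : (fun i => star s i * s i) = 1 := by
            ext i; simp only [hs, Pi.star_apply]; split_ifs <;> simp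
          rw [this]; simp
      _ = 1 := hM.eigenvectorUnitary_mul_conjTranspose
  · have : (M * (U * diagonal s * Uᴴ)).trace = ∑ i, ((|hM.eigenvalues i| : ℝ) : ℂ) := by
      conv_lhs => rw [hM.eq_unitary_diagonal, ← hU]
      calc _ = (U * (diagonal (fun i => (hM.eigenvalues i : ℂ)) * ((Uᴴ * U) *
            diagonal s)) * Uᴴ).trace := by simp only [Matrix.mul_assoc]
        _ = _ := by
          rw [hUU, Matrix.one_mul, Matrix.trace_mul_comm, ← Matrix.mul_assoc, hUU, Matrix.one_mul,
            diagonal_mul_diagonal, Matrix.trace_diagonal]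
          refine Finset.sum_congr rfl fun i _ => ?_
          simp only [hs]
          split_ifs with h
          · simp [abs_of_nonneg h]
          · simp [abs_of_neg (not_le.1 h)]
    rw [this, traceNorm_eq_sum_abs_eigenvalues hM]
    simp

theorem traceNorm_add_le {M N : Matrix n n ℂ} (hM : M.IsHermitian) (hN : N.IsHermitian) :
    traceNorm (M + N) ≤ traceNorm M + traceNorm N := by
  obtain ⟨V, hV, h⟩ := exists_unitary_traceNorm_eq (hM.add hN)
  rw [← h, Matrix.add_mul, Matrix.trace_add, Complex.add_re]
  exact add_le_add ((le_abs_self _).trans (abs_re_trace_mul_le_traceNorm hM hV))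
    ((le_abs_self _).trans (abs_re_trace_mul_le_traceNorm hN hV))

theorem traceNorm_neg (M : Matrix n n ℂ) : traceNorm (-M) = traceNorm M := by
  unfold traceNorm
  simp only [conjTranspose_neg, neg_mul_neg]

theorem traceNorm_sub_comm (M N : Matrix n n ℂ) : traceNorm (M - N) = traceNorm (N - M) := by
  rw [← traceNorm_neg, neg_sub]

theorem traceNorm_sub_le {M N K : Matrix n n ℂ} (hM : M.IsHermitian) (hN : N.IsHermitian)
    (hK : K.IsHermitian) :
    traceNorm (M - K) ≤ traceNorm (M - N) + traceNorm (N - K) := by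
  have := traceNorm_add_le (hM.sub hN) (hN.sub hK)
  simpa using this

theorem traceNorm_sum_le {ι : Type*} (s : Finset ι) (M : ι → Matrix n n ℂ)
    (hM : ∀ i ∈ s, (M i).IsHermitian) :
    traceNorm (∑ i ∈ s, M i) ≤ ∑ i ∈ s, traceNorm (M i) := by
  classical
  induction s using Finset.induction_on with
  | empty => simp [traceNorm_zero]
  | insert a s ha ih =>
    rw [Finset.sum_insert ha, Finset.sum_insert ha]
    have h1 : (∑ i ∈ s, M i).IsHermitian := by
      unfold Matrix.IsHermitian
      rw [conjTranspose_sum]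
      exact Finset.sum_congr rfl fun i hi => hM i (Finset.mem_insert_of_mem hi)
    exact (traceNorm_add_le (hM a (Finset.mem_insert_self _ _)) h1).trans
      (by gcongr; exact ih fun i hi => hM i (Finset.mem_insert_of_mem hi))

theorem sum_abs_re_diag_le_traceNorm {M : Matrix n n ℂ} (hM : M.IsHermitian) :
    ∑ i, |(M i i).re| ≤ traceNorm M := by
  set s : n → ℂ := fun i => if 0 ≤ (M i i).re then 1 else -1 with hs
  have h := abs_re_trace_mul_le_traceNorm hM (V := diagonal s) (by
    rw [diagonal_conjTranspose, diagonal_mul_diagonal]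
    have : (fun i => star s i * s i) = 1 := by
      ext i; simp only [hs, Pi.star_apply]; split_ifs <;> simp
    rw [this]; simp)
  refine le_trans (le_of_eq ?_) ((le_abs_self _).trans h)
  rw [Matrix.trace, Complex.re_sum]
  refine Finset.sum_congr rfl fun i _ => ?_
  rw [Matrix.diag_apply, Matrix.mul_diagonal]
  simp only [hs]
  split_ifs with h
  · simp [abs_of_nonneg h]
  · simp [abs_of_neg (not_le.1 h)]

/-- The squared Hilbert-Schmidt norm. -/
def hsNormSq (M : Matrix n k ℂ) : ℝ := ∑ i, ∑ j, Complex.normSq (M i j)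

theorem hsNormSq_nonneg (M : Matrix n k ℂ) : 0 ≤ hsNormSq M :=
  Finset.sum_nonneg fun _ _ => Finset.sum_nonneg fun _ _ => Complex.normSq_nonneg _

theorem hsNormSq_eq_trace (M : Matrix n k ℂ) : hsNormSq M = (M * Mᴴ).trace.re := by
  simp [hsNormSq, Matrix.trace, Matrix.mul_apply, Complex.normSq_apply]

theorem hsNormSq_conjTranspose (M : Matrix n k ℂ) : hsNormSq Mᴴ = hsNormSq M := by
  unfold hsNormSq
  rw [Finset.sum_comm]
  simp [Complex.normSq_apply]

/-- The Cauchy–Schwarz inequality for the Hilbert-Schmidt inner product. -/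
theorem norm_trace_mul_le (X : Matrix n k ℂ) (Y : Matrix k n ℂ) :
    ‖(X * Y).trace‖ ≤ √(hsNormSq X) * √(hsNormSq Y) := by
  have h1 : ‖(X * Y).trace‖ ≤ ∑ p : n × k, ‖X p.1 p.2‖ * ‖Y p.2 p.1‖ := by
    rw [Matrix.trace, Fintype.sum_prod_type]
    refine (norm_sum_le _ _).trans (Finset.sum_le_sum fun i _ => ?_)
    rw [Matrix.diag_apply, Matrix.mul_apply]
    refine (norm_sum_le _ _).trans (Finset.sum_le_sum fun j _ => ?_)
    rw [norm_mul]
  refine h1.trans ((Real.sum_mul_le_sqrt_mul_sqrt _ _ _).trans (le_of_eq ?_))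
  congr 2
  · rw [hsNormSq, Fintype.sum_prod_type]
    simp [Complex.normSq_eq_norm_sq]
  · rw [hsNormSq, Finset.sum_comm, Fintype.sum_prod_type]
    simp [Complex.normSq_eq_norm_sq]

theorem norm_trace_mul_mul_le (X : Matrix n k ℂ) (Y : Matrix k n ℂ) {V : Matrix n n ℂ}
    (hV : Vᴴ * V = 1) : ‖(X * Y * V).trace‖ ≤ √(hsNormSq X) * √(hsNormSq Y) := by
  rw [Matrix.mul_assoc]
  refine (norm_trace_mul_le X (Y * V)).trans (le_of_eq ?_)
  congr 2
  rw [hsNormSq_eq_trace, hsNormSq_eq_trace, conjTranspose_mul, Matrix.mul_assoc,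
    ← Matrix.mul_assoc V, mul_eq_one_comm.1 hV, Matrix.one_mul]

/-- Hölder's inequality for the trace norm of a sum of two products. -/
theorem traceNorm_le_of_eq_add {M : Matrix n n ℂ} (hM : M.IsHermitian) (X X' : Matrix n k ℂ)
    (Y Y' : Matrix k n ℂ) (h : M = X * Y + X' * Y') :
    traceNorm M ≤ √(hsNormSq X) * √(hsNormSq Y) + √(hsNormSq X') * √(hsNormSq Y') := by
  obtain ⟨V, hV, hV'⟩ := exists_unitary_traceNorm_eq hM
  rw [← hV', h, Matrix.add_mul, Matrix.trace_add, Complex.add_re]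
  exact add_le_add ((Complex.re_le_norm _).trans (norm_trace_mul_mul_le _ _ hV))
    ((Complex.re_le_norm _).trans (norm_trace_mul_mul_le _ _ hV))

end Spectral

section Entropy

open Matrix

variable {n k : Type*} [Fintype n] [DecidableEq n] [Fintype k] [DecidableEq k]

/-! ### Klein's inequality and its consequences for the entropy -/

/-- The scalar inequality behind Klein's inequality with a quadratic remainder. -/
theorem sq_sqrt_sub_sqrt_le {x y : ℝ} (hx : 0 ≤ x) (hy : 0 < y) :
    (√x - √y) ^ 2 ≤ x * Real.log x - x * Real.log y - x + y := by
  rcases hx.eq_or_lt with rfl | hx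
  · simp [Real.sq_sqrt hy.le]
  have ha : 0 < √x := Real.sqrt_pos.2 hx
  have hb : 0 < √y := Real.sqrt_pos.2 hy
  have h1 := Real.log_le_sub_one_of_pos (div_pos hb ha)
  rw [Real.log_div hb.ne' ha.ne', Real.log_sqrt hx.le, Real.log_sqrt hy.le] at h1
  have h2 : x * (√y / √x) = √x * √y := by
    rw [mul_div_assoc', div_eq_iff ha.ne']
    nlinarith [Real.mul_self_sqrt hx.le]
  have h3 := mul_le_mul_of_nonneg_left h1 hx.le
  nlinarith [Real.sq_sqrt hx.le, Real.sq_sqrt hy.le]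

theorem hsNormSq_mul_unitary (X : Matrix n k ℂ) {V : Matrix k k ℂ} (hV : Vᴴ * V = 1) :
    hsNormSq (X * V) = hsNormSq X := by
  rw [hsNormSq_eq_trace, hsNormSq_eq_trace, conjTranspose_mul, Matrix.mul_assoc,
    ← Matrix.mul_assoc V, mul_eq_one_comm.1 hV, Matrix.one_mul]

theorem hsNormSq_unitary_mul (X : Matrix n k ℂ) {V : Matrix n n ℂ} (hV : Vᴴ * V = 1) :
    hsNormSq (V * X) = hsNormSq X := by
  rw [← hsNormSq_conjTranspose, conjTranspose_mul, hsNormSq_mul_unitary, hsNormSq_conjTranspose]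
  simpa using mul_eq_one_comm.1 hV

theorem conj_diagonal_apply_self (K : Matrix n n ℂ) (x : n → ℝ) (j : n) :
    (Kᴴ * diagonal (fun i => (x i : ℂ)) * K) j j =
      ((∑ i, Complex.normSq (K i j) * x i : ℝ) : ℂ) := by
  rw [Matrix.mul_apply]
  push_cast
  refine Finset.sum_congr rfl fun i _ => ?_
  rw [Matrix.mul_diagonal, conjTranspose_apply, Complex.normSq_eq_conj_mul_self]
  simp only [RCLike.star_def]
  ring

theorem Matrix.IsHermitian.vonNeumannEntropy_eq {σ : Matrix n n ℂ} (hσ : σ.IsHermitian) :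
    vonNeumannEntropy σ = ∑ i, Real.negMulLog (hσ.eigenvalues i) := by
  rw [vonNeumannEntropy, dif_pos hσ]

theorem Matrix.IsHermitian.re_trace_eq {σ : Matrix n n ℂ} (hσ : σ.IsHermitian) :
    σ.trace.re = ∑ i, hσ.eigenvalues i := by
  rw [hσ.trace_eq_sum_eigenvalues]
  simp

/-- Klein's inequality for the relative entropy of `σ` and `W * diagonal y * Wᴴ`, with a
Hellinger distance as a remainder. -/
theorem klein_hellinger {σ : Matrix n n ℂ} (hσ : σ.PosSemidef) {W : Matrix n n ℂ}
    (hW : Wᴴ * W = 1) {y : n → ℝ} (hy : ∀ j, 0 ≤ y j)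
    (hsupp : ∀ j, y j = 0 → (Wᴴ * σ * W) j j = 0) :
    hsNormSq (Matrix.of fun i j => ((hσ.1.eigenvectorUnitary : Matrix n n ℂ)ᴴ * W) i j *
        ((√(hσ.1.eigenvalues i) - √(y j) : ℝ) : ℂ)) ≤
      -vonNeumannEntropy σ - ∑ j, ((Wᴴ * σ * W) j j).re * Real.log (y j)
        - σ.trace.re + ∑ j, y j := by
  set U : Matrix n n ℂ := (↑hσ.1.eigenvectorUnitary : Matrix n n ℂ) with hU
  have hUU : Uᴴ * U = 1 := hσ.1.eigenvectorUnitary_conjTranspose_mul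
  have hUU' : U * Uᴴ = 1 := hσ.1.eigenvectorUnitary_mul_conjTranspose
  set x := hσ.1.eigenvalues with hx
  set K := Uᴴ * W with hK
  have hx0 : ∀ i, 0 ≤ x i := hσ.eigenvalues_nonneg
  have hK1 : Kᴴ * K = 1 := by
    rw [hK, conjTranspose_mul, conjTranspose_conjTranspose, Matrix.mul_assoc,
      ← Matrix.mul_assoc U, hUU', Matrix.one_mul, hW]
  have hdiag : ∀ j, (Wᴴ * σ * W) j j =
      ((∑ i, Complex.normSq (K i j) * x i : ℝ) : ℂ) := by
    intro j
    rw [← conj_diagonal_apply_self]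
    conv_lhs => rw [hσ.1.eq_unitary_diagonal]
    simp only [hK, conjTranspose_mul, conjTranspose_conjTranspose, Matrix.mul_assoc, ← hU, ← hx]
  have hr := sum_normSq_row (mul_eq_one_comm.1 hK1)
  have hc := sum_normSq_col hK1
  have e1 : -vonNeumannEntropy σ =
      ∑ i, ∑ j, Complex.normSq (K i j) * (x i * Real.log (x i)) := by
    rw [hσ.1.vonNeumannEntropy_eq, ← Finset.sum_neg_distrib]
    refine Finset.sum_congr rfl fun i _ => ?_
    rw [← Finset.sum_mul, hr i, Real.negMulLog]
    ring
  have e2 : ∑ j, ((Wᴴ * σ * W) j j).re * Real.log (y j) =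
      ∑ i, ∑ j, Complex.normSq (K i j) * (x i * Real.log (y j)) := by
    rw [Finset.sum_comm]
    refine Finset.sum_congr rfl fun j _ => ?_
    rw [hdiag, Complex.ofReal_re, Finset.sum_mul]
    exact Finset.sum_congr rfl fun i _ => by ring
  have e3 : σ.trace.re = ∑ i, ∑ j, Complex.normSq (K i j) * x i := by
    rw [hσ.1.re_trace_eq]
    refine Finset.sum_congr rfl fun i _ => ?_
    rw [← Finset.sum_mul, hr i, one_mul]
  have e4 : ∑ j, y j = ∑ i, ∑ j, Complex.normSq (K i j) * y j := by
    rw [Finset.sum_comm]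
    refine Finset.sum_congr rfl fun j _ => ?_
    rw [← Finset.sum_mul, hc j, one_mul]
  rw [e1, e2, e3, e4, hsNormSq]
  simp only [← Finset.sum_sub_distrib, ← Finset.sum_add_distrib]
  refine Finset.sum_le_sum fun i _ => Finset.sum_le_sum fun j _ => ?_
  rw [Matrix.of_apply, Complex.normSq_mul, Complex.normSq_ofReal]
  rcases (hy j).eq_or_lt with h0 | h0
  · have h1 := hsupp j h0.symm
    rw [hdiag, Complex.ofReal_eq_zero, Finset.sum_eq_zero_iff_of_nonneg
      (fun i _ => mul_nonneg (Complex.normSq_nonneg _) (hx0 i))] at h1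
    have h2 := h1 i (Finset.mem_univ _)
    rw [← h0]
    rcases mul_eq_zero.1 h2 with h | h <;> simp [h]
  · have := mul_le_mul_of_nonneg_left (sq_sqrt_sub_sqrt_le (hx0 i) h0)
      (Complex.normSq_nonneg (K i j))
    nlinarith

/-- Klein's inequality for the relative entropy of `σ` and `W * diagonal y * Wᴴ`. -/
theorem klein {σ : Matrix n n ℂ} (hσ : σ.PosSemidef) {W : Matrix n n ℂ}
    (hW : Wᴴ * W = 1) {y : n → ℝ} (hy : ∀ j, 0 ≤ y j)
    (hsupp : ∀ j, y j = 0 → (Wᴴ * σ * W) j j = 0) :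
    vonNeumannEntropy σ ≤ -∑ j, ((Wᴴ * σ * W) j j).re * Real.log (y j)
        - σ.trace.re + ∑ j, y j := by
  have := (hsNormSq_nonneg _).trans (klein_hellinger hσ hW hy hsupp)
  linarith

/-- A form of Pinsker's inequality. -/
theorem traceNorm_sub_sq_le {σ : Matrix n n ℂ} (hσ : σ.PosSemidef) (hσ1 : σ.trace.re ≤ 1)
    {W : Matrix n n ℂ} (hW : Wᴴ * W = 1) {y : n → ℝ} (hy : ∀ j, 0 ≤ y j) (hy1 : ∑ j, y j ≤ 1)
    (hsupp : ∀ j, y j = 0 → (Wᴴ * σ * W) j j = 0) :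
    traceNorm (σ - W * diagonal (fun j => (y j : ℂ)) * Wᴴ) ^ 2 ≤
      4 * (-vonNeumannEntropy σ - ∑ j, ((Wᴴ * σ * W) j j).re * Real.log (y j)
        - σ.trace.re + ∑ j, y j) := by
  refine le_trans ?_ (mul_le_mul_of_nonneg_left (klein_hellinger hσ hW hy hsupp) (by norm_num))
  set U : Matrix n n ℂ := (↑hσ.1.eigenvectorUnitary : Matrix n n ℂ) with hU
  have hUU : Uᴴ * U = 1 := hσ.1.eigenvectorUnitary_conjTranspose_mul
  have hUU' : U * Uᴴ = 1 := hσ.1.eigenvectorUnitary_mul_conjTranspose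
  set x := hσ.1.eigenvalues with hx
  set K := Uᴴ * W with hK
  have hx0 : ∀ i, 0 ≤ x i := hσ.eigenvalues_nonneg
  set N : Matrix n n ℂ := Matrix.of fun i j => K i j * ((√(x i) - √(y j) : ℝ) : ℂ) with hN
  set dx : Matrix n n ℂ := diagonal fun i => ((√(x i) : ℝ) : ℂ) with hdx
  set dy : Matrix n n ℂ := diagonal fun i => ((√(y i) : ℝ) : ℂ) with hdy
  have hdy1 : diagonal (fun j => (y j : ℂ)) = dy * dy := by
    rw [hdy, diagonal_mul_diagonal]
    congr 1; ext j
    rw [← Complex.ofReal_mul, Real.mul_self_sqrt (hy j)]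
  have hdx1 : diagonal (fun j => (x j : ℂ)) = dx * dx := by
    rw [hdx, diagonal_mul_diagonal]
    congr 1; ext j
    rw [← Complex.ofReal_mul, Real.mul_self_sqrt (hx0 j)]
  have hN1 : N = dx * K - K * dy := by
    ext i j
    simp only [hN, hdx, hdy, Matrix.of_apply, Matrix.sub_apply, Matrix.diagonal_mul,
      Matrix.mul_diagonal]
    push_cast; ring
  have hWW' : W * Wᴴ = 1 := mul_eq_one_comm.1 hW
  have key : σ - W * diagonal (fun j => (y j : ℂ)) * Wᴴ =
      (U * dx) * (N * Wᴴ) + (U * N) * (dy * Wᴴ) := by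
    have h1 : (U * dx) * (N * Wᴴ) + (U * N) * (dy * Wᴴ) =
        U * (dx * dx) * (K * Wᴴ) - (U * K) * (dy * dy) * Wᴴ := by
      rw [hN1]
      noncomm_ring
    have h2 : K * Wᴴ = Uᴴ := by rw [hK, Matrix.mul_assoc, hWW', Matrix.mul_one]
    have h3 : U * K = W := by rw [hK, ← Matrix.mul_assoc, hUU', Matrix.one_mul]
    rw [h1, h2, h3, ← hdx1, ← hdy1]
    congr 1
    exact hσ.1.eq_unitary_diagonal
  have hherm : (σ - W * diagonal (fun j => (y j : ℂ)) * Wᴴ).IsHermitian := by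
    refine hσ.1.sub ?_
    refine isHermitian_mul_mul_conjTranspose _ ?_
    rw [Matrix.IsHermitian, diagonal_conjTranspose]
    congr 1; ext i; simp
  have hb := traceNorm_le_of_eq_add hherm _ _ _ _ key
  have hWc : (Wᴴ)ᴴ * Wᴴ = 1 := by simpa using hWW'
  rw [hsNormSq_unitary_mul _ hUU, hsNormSq_mul_unitary _ hWc, hsNormSq_unitary_mul _ hUU,
    hsNormSq_mul_unitary _ hWc] at hb
  have hdxs : hsNormSq dx ≤ 1 := by
    have : hsNormSq dx = σ.trace.re := by
      rw [hσ.1.re_trace_eq, hsNormSq]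
      refine Finset.sum_congr rfl fun i _ => ?_
      rw [Finset.sum_eq_single i]
      · rw [hdx, Matrix.diagonal_apply_eq, Complex.normSq_ofReal, Real.mul_self_sqrt (hx0 i)]
      · intro j _ hj; simp [hdx, Matrix.diagonal_apply_ne _ hj.symm]
      · simp
    rw [this]; exact hσ1
  have hdys : hsNormSq dy ≤ 1 := by
    have : hsNormSq dy = ∑ j, y j := by
      rw [hsNormSq]
      refine Finset.sum_congr rfl fun i _ => ?_
      rw [Finset.sum_eq_single i]
      · rw [hdy, Matrix.diagonal_apply_eq, Complex.normSq_ofReal, Real.mul_self_sqrt (hy i)]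
      · intro j _ hj; simp [hdy, Matrix.diagonal_apply_ne _ hj.symm]
      · simp
    rw [this]; exact hy1
  have h5 : √(hsNormSq dx) ≤ 1 := Real.sqrt_le_one.2 hdxs
  have h6 : √(hsNormSq dy) ≤ 1 := Real.sqrt_le_one.2 hdys
  have h7 := Real.sqrt_nonneg (hsNormSq N)
  have h8 : traceNorm (σ - W * diagonal (fun j => (y j : ℂ)) * Wᴴ) ≤ 2 * √(hsNormSq N) := by
    nlinarith
  have h9 := Real.sq_sqrt (hsNormSq_nonneg N)
  nlinarith [traceNorm_nonneg (σ - W * diagonal (fun j => (y j : ℂ)) * Wᴴ)]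

/-- Continuity of the von Neumann entropy, in an additive form with a free parameter `η`. -/
theorem vonNeumannEntropy_le_add [Nonempty n] {σ τ : Matrix n n ℂ} (hσ : σ.PosSemidef)
    (hτ : τ.PosSemidef) (hτ1 : τ.trace.re ≤ 1) {η : ℝ} (hη : 0 < η) (hη1 : η ≤ 1 / 2) :
    vonNeumannEntropy σ ≤ vonNeumannEntropy τ +
      traceNorm (σ - τ) * (Real.log (Fintype.card n / η) + 1) + η := by
  set W : Matrix n n ℂ := (↑hτ.1.eigenvectorUnitary : Matrix n n ℂ) with hWdef
  have hW : Wᴴ * W = 1 := hτ.1.eigenvectorUnitary_conjTranspose_mul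
  set t := hτ.1.eigenvalues with ht
  have ht0 : ∀ j, 0 ≤ t j := hτ.eigenvalues_nonneg
  have ht1 : ∀ j, t j ≤ 1 := fun j => by
    refine le_trans ?_ hτ1
    rw [hτ.1.re_trace_eq]
    exact Finset.single_le_sum (f := t) (fun i _ => ht0 i) (Finset.mem_univ j)
  have hd : (1 : ℝ) ≤ Fintype.card n := by exact_mod_cast Fintype.card_pos
  -- The spectrum of `τ` is shifted away from zero, so that its logarithm is bounded.
  set y : n → ℝ := fun j => t j + η / Fintype.card n with hy
  have hηd : 0 < η / Fintype.card n := by positivity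
  have hy0 : ∀ j, 0 < y j := fun j => by have := ht0 j; simp only [hy]; linarith
  have hk := klein hσ hW (fun j => (hy0 j).le) (fun j h => absurd h (hy0 j).ne')
  set ℓ := Real.log (Fintype.card n / η) with hℓ
  have hlog : ∀ j, |Real.log (y j)| ≤ ℓ := by
    intro j
    rw [abs_le]
    constructor
    · rw [hℓ, ← Real.log_inv, inv_div]
      exact Real.log_le_log hηd (by have := ht0 j; simp only [hy]; linarith)
    · refine Real.log_le_log (hy0 j) ?_
      have h1 : η / Fintype.card n ≤ 1 / 2 := (div_le_self hη.le hd).trans hη1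
      have h2 : (2 : ℝ) ≤ Fintype.card n / η := by
        rw [le_div_iff₀ hη]; linarith
      have := ht1 j
      simp only [hy]; linarith
  have hℓ0 : 0 ≤ ℓ := (abs_nonneg _).trans (hlog (Classical.arbitrary n))
  set s : n → ℝ := fun j => ((Wᴴ * σ * W) j j).re with hs
  have hWτ : Wᴴ * τ * W = diagonal (fun j => (t j : ℂ)) := by
    conv_lhs => rw [hτ.1.eq_unitary_diagonal]
    rw [← hWdef]
    calc _ = (Wᴴ * W) * diagonal (fun j => (t j : ℂ)) * (Wᴴ * W) := by
          simp only [Matrix.mul_assoc]; rfl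
      _ = _ := by rw [hW, Matrix.one_mul, Matrix.mul_one]
  have hst : ∑ j, |s j - t j| ≤ traceNorm (σ - τ) := by
    have h1 : Wᴴ * (σ - τ) * (Wᴴ)ᴴ = Wᴴ * σ * W - diagonal (fun j => (t j : ℂ)) := by
      rw [conjTranspose_conjTranspose, Matrix.mul_sub, Matrix.sub_mul, hWτ]
    have h2 := traceNorm_conj (hσ.1.sub hτ.1) (V := Wᴴ)
      (by simpa using mul_eq_one_comm.1 hW)
    rw [← h2]
    refine le_trans (le_of_eq ?_) (sum_abs_re_diag_le_traceNorm
      (isHermitian_mul_mul_conjTranspose _ (hσ.1.sub hτ.1)))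
    rw [h1]
    simp [hs]
  have htr : τ.trace.re - σ.trace.re ≤ traceNorm (σ - τ) := by
    have := abs_re_trace_mul_le_traceNorm (hσ.1.sub hτ.1) (V := 1) (by simp)
    rw [Matrix.mul_one, Matrix.trace_sub, Complex.sub_re] at this
    have := neg_le_of_abs_le this
    linarith
  have hysum : ∑ j, y j = τ.trace.re + η := by
    rw [hτ.1.re_trace_eq, Finset.sum_add_distrib, Finset.sum_const, Finset.card_univ,
      nsmul_eq_mul, mul_div_cancel₀ _ (by positivity)]
  have hmain : -∑ j, s j * Real.log (y j) ≤ vonNeumannEntropy τ + traceNorm (σ - τ) * ℓ := by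
    have h1 : ∀ j, -(s j * Real.log (y j)) ≤ Real.negMulLog (t j) + |s j - t j| * ℓ := by
      intro j
      have h2 : -(t j * Real.log (y j)) ≤ Real.negMulLog (t j) := by
        rcases (ht0 j).eq_or_lt with h | h
        · simp [← h]
        · rw [Real.negMulLog, neg_mul]
          refine neg_le_neg (mul_le_mul_of_nonneg_left (Real.log_le_log h ?_) h.le)
          simp only [hy]; linarith
      have h3 : -((s j - t j) * Real.log (y j)) ≤ |s j - t j| * ℓ := by
        refine (neg_le_abs _).trans ?_
        rw [abs_mul]
        exact mul_le_mul_of_nonneg_left (hlog j) (abs_nonneg _)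
      linarith
    rw [← Finset.sum_neg_distrib]
    refine (Finset.sum_le_sum fun j _ => h1 j).trans ?_
    rw [Finset.sum_add_distrib, ← Finset.sum_mul, hτ.1.vonNeumannEntropy_eq]
    gcongr
  rw [hysum] at hk
  linarith

/-! ### Twirling -/

/-- A matrix which commutes with the Hermitian matrix `τ` commutes with the functions of `τ`. -/
theorem commute_conj_diagonal_comp {τ g W : Matrix n n ℂ} (hW : Wᴴ * W = 1) {y : n → ℝ}
    (hτ : τ = W * diagonal (fun j => (y j : ℂ)) * Wᴴ) (hg : g * τ = τ * g) (f : ℝ → ℝ) :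
    g * (W * diagonal (fun j => (f (y j) : ℂ)) * Wᴴ) =
      W * diagonal (fun j => (f (y j) : ℂ)) * Wᴴ * g := by
  have hW' : W * Wᴴ = 1 := mul_eq_one_comm.1 hW
  set M := Wᴴ * g * W with hM
  have hgM : g = W * M * Wᴴ := by
    rw [hM]
    calc g = (W * Wᴴ) * g * (W * Wᴴ) := by rw [hW', Matrix.one_mul, Matrix.mul_one]
      _ = _ := by simp only [Matrix.mul_assoc]
  have conj : ∀ D : Matrix n n ℂ, g * (W * D * Wᴴ) = W * (M * D) * Wᴴ ∧
      W * D * Wᴴ * g = W * (D * M) * Wᴴ := by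
    intro D
    rw [hgM]
    constructor
    · calc _ = W * M * (Wᴴ * W) * D * Wᴴ := by simp only [Matrix.mul_assoc]
        _ = _ := by rw [hW, Matrix.mul_one]; simp only [Matrix.mul_assoc]
    · calc _ = W * D * (Wᴴ * W) * M * Wᴴ := by simp only [Matrix.mul_assoc]
        _ = _ := by rw [hW, Matrix.mul_one]; simp only [Matrix.mul_assoc]
  have h1 : M * diagonal (fun j => (y j : ℂ)) = diagonal (fun j => (y j : ℂ)) * M := by
    rw [hτ, (conj _).1, (conj _).2] at hg
    have h2 := congrArg (fun X => Wᴴ * X * W) hg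
    have h3 : ∀ X : Matrix n n ℂ, Wᴴ * (W * X * Wᴴ) * W = X := by
      intro X
      calc _ = (Wᴴ * W) * X * (Wᴴ * W) := by simp only [Matrix.mul_assoc]
        _ = X := by rw [hW, Matrix.one_mul, Matrix.mul_one]
    simpa only [h3] using h2
  rw [(conj _).1, (conj _).2]
  congr 2
  ext i j
  have h2 := congrFun (congrFun h1 i) j
  rw [Matrix.mul_diagonal, Matrix.diagonal_mul] at h2 ⊢
  by_cases h : y i = y j
  · rw [h, mul_comm]
  · have : M i j = 0 := by
      have h4 : ((y j : ℂ) - y i) * M i j = 0 := by linear_combination h2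
      rcases mul_eq_zero.1 h4 with h5 | h5
      · exact absurd (by exact_mod_cast (sub_eq_zero.1 h5).symm) h
      · exact h5
    simp [this]

/-- If averaging over a finite family of unitaries hardly increases the entropy of a state, then
it hardly changes the state. -/
theorem traceNorm_sub_twirl_sq_le {ι : Type*} [Fintype ι] {σ τ : Matrix n n ℂ}
    (hσ : σ.PosSemidef) (hσ1 : σ.trace.re ≤ 1) (g : ι → Matrix n n ℂ)
    (hg : ∀ i, (g i)ᴴ * g i = 1) (hτ : (Fintype.card ι : ℂ) • τ = ∑ i, g i * σ * (g i)ᴴ)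
    (hinv : ∀ i, g i * τ * (g i)ᴴ = τ) (i₀ : ι) (hi₀ : g i₀ = 1) :
    traceNorm (σ - τ) ^ 2 ≤ 4 * (vonNeumannEntropy τ - vonNeumannEntropy σ) := by
  have hc : (0 : ℝ) < Fintype.card ι := by exact_mod_cast Fintype.card_pos_iff.2 ⟨i₀⟩
  have hc' : (Fintype.card ι : ℂ) ≠ 0 := by exact_mod_cast hc.ne'
  have hτ' : τ = ((Fintype.card ι : ℝ)⁻¹ : ℝ) • ∑ i, g i * σ * (g i)ᴴ := by
    rw [← hτ]
    ext a b
    simp [hc']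
  have hpsd : ∀ i, (g i * σ * (g i)ᴴ).PosSemidef := fun i => hσ.mul_mul_conjTranspose_same _
  have hτp : τ.PosSemidef := by
    rw [hτ']
    exact (posSemidef_sum _ fun i _ => hpsd i).smul (inv_nonneg.2 hc.le)
  have htr : τ.trace = σ.trace := by
    have h1 := congrArg Matrix.trace hτ
    rw [Matrix.trace_smul, Matrix.trace_sum] at h1
    have h2 : ∀ i, (g i * σ * (g i)ᴴ).trace = σ.trace := fun i => by
      rw [Matrix.trace_mul_comm, ← Matrix.mul_assoc, hg, Matrix.one_mul]
    simp only [h2, Finset.sum_const, Finset.card_univ, nsmul_eq_mul, smul_eq_mul] at h1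
    exact mul_left_cancel₀ hc' h1
  set W : Matrix n n ℂ := (↑hτp.1.eigenvectorUnitary : Matrix n n ℂ) with hWdef
  have hW : Wᴴ * W = 1 := hτp.1.eigenvectorUnitary_conjTranspose_mul
  set y := hτp.1.eigenvalues with hy
  have hy0 : ∀ j, 0 ≤ y j := hτp.eigenvalues_nonneg
  have hτe : τ = W * diagonal (fun j => (y j : ℂ)) * Wᴴ := hτp.1.eq_unitary_diagonal
  have hysum : ∑ j, y j = σ.trace.re := by rw [← htr, hτp.1.re_trace_eq]
  have hWτ : Wᴴ * τ * W = diagonal (fun j => (y j : ℂ)) := by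
    conv_lhs => rw [hτe]
    calc _ = (Wᴴ * W) * diagonal (fun j => (y j : ℂ)) * (Wᴴ * W) := by
          simp only [Matrix.mul_assoc]
      _ = _ := by rw [hW, Matrix.one_mul, Matrix.mul_one]
  have hsupp : ∀ j, y j = 0 → (Wᴴ * σ * W) j j = 0 := by
    intro j hj
    have h1 : ∑ i, (Wᴴ * (g i * σ * (g i)ᴴ) * W) j j = 0 := by
      have h2 := congrArg (fun X => (Wᴴ * X * W) j j) hτ
      simp only [Matrix.mul_smul, Matrix.smul_mul, hWτ, Matrix.mul_sum, Matrix.sum_mul] at h2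
      rw [Matrix.smul_apply, Matrix.diagonal_apply_eq, hj, Matrix.sum_apply] at h2
      simpa using h2.symm
    have h3 := (Finset.sum_eq_zero_iff_of_nonneg (fun i _ => by
      have := ((hpsd i).conjTranspose_mul_mul_same W).diag_nonneg (i := j)
      exact this)).1 h1 i₀ (Finset.mem_univ _)
    simpa [hi₀] using h3
  -- The logarithm of `τ` commutes with the unitaries, so that `σ` and `τ` have the same overlap
  -- with it, and the relative entropy of `σ` and `τ` is the difference of the entropies.
  set Lg := W * diagonal (fun j => (Real.log (y j) : ℂ)) * Wᴴ with hLg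
  have hgL : ∀ i, (g i)ᴴ * Lg * g i = Lg := by
    intro i
    have h1 : g i * τ = τ * g i := by
      calc g i * τ = g i * τ * ((g i)ᴴ * g i) := by rw [hg, Matrix.mul_one]
        _ = g i * τ * (g i)ᴴ * g i := by simp only [Matrix.mul_assoc]
        _ = _ := by rw [hinv]
    have h2 := commute_conj_diagonal_comp hW hτe h1 Real.log
    rw [Matrix.mul_assoc, ← hLg] at *
    rw [← h2, ← Matrix.mul_assoc, hg, Matrix.one_mul]
  have hov : ∀ X : Matrix n n ℂ, (X * Lg).trace = ∑ j, (Wᴴ * X * W) j j * Real.log (y j) := by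
    intro X
    rw [hLg, ← Matrix.mul_assoc, Matrix.trace_mul_comm, ← Matrix.mul_assoc, ← Matrix.mul_assoc]
    simp [Matrix.trace, Matrix.mul_diagonal]
  have hsame : (τ * Lg).trace = (σ * Lg).trace := by
    have h1 := congrArg (fun X => (X * Lg).trace) hτ
    simp only [Matrix.smul_mul, Matrix.sum_mul, Matrix.trace_smul, Matrix.trace_sum] at h1
    have h2 : ∀ i, (g i * σ * (g i)ᴴ * Lg).trace = (σ * Lg).trace := fun i => by
      rw [Matrix.mul_assoc, Matrix.mul_assoc, Matrix.trace_mul_comm, Matrix.mul_assoc, hgL]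
    simp only [h2, Finset.sum_const, Finset.card_univ, nsmul_eq_mul, smul_eq_mul] at h1
    exact mul_left_cancel₀ hc' h1
  have hent : ∑ j, ((Wᴴ * σ * W) j j).re * Real.log (y j) = -vonNeumannEntropy τ := by
    have h1 := congrArg Complex.re hsame
    rw [hov, hov, hWτ] at h1
    simp only [Complex.re_sum, Matrix.diagonal_apply_eq, Complex.re_mul_ofReal,
      Complex.ofReal_re] at h1
    rw [← h1, hτp.1.vonNeumannEntropy_eq, ← Finset.sum_neg_distrib]
    exact Finset.sum_congr rfl fun j _ => by rw [Real.negMulLog]; ring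
  have := traceNorm_sub_sq_le hσ hσ1 hW hy0 (hysum ▸ hσ1) hsupp
  rw [← hτe, hent, hysum] at this
  linarith

/-! ### Gentle measurements -/

/-- Projection onto a set of basis states of almost full weight hardly disturbs a state. -/
theorem traceNorm_sub_restrict_le {σ : Matrix n n ℂ} (hσ : σ.PosSemidef)
    (hσ1 : σ.trace.re ≤ 1) (p : n → Prop) [DecidablePred p] :
    traceNorm (σ - Matrix.of fun s t => if p s ∧ p t then σ s t else 0) ≤
      2 * √(∑ s with ¬ p s, (σ s s).re) := by
  set U : Matrix n n ℂ := (↑hσ.1.eigenvectorUnitary : Matrix n n ℂ) with hU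
  set x := hσ.1.eigenvalues with hx
  have hx0 : ∀ i, 0 ≤ x i := hσ.eigenvalues_nonneg
  set dx : Matrix n n ℂ := diagonal fun i => ((√(x i) : ℝ) : ℂ) with hdx
  set X := U * dx with hX
  have hσX : σ = X * Xᴴ := by
    have h1 : diagonal (fun j => (x j : ℂ)) = dx * dxᴴ := by
      rw [hdx, diagonal_conjTranspose, diagonal_mul_diagonal]
      congr 1; ext j
      rw [Pi.star_apply, RCLike.star_def, Complex.conj_ofReal, ← Complex.ofReal_mul,
        Real.mul_self_sqrt (hx0 j)]
    rw [hX, conjTranspose_mul]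
    calc σ = U * diagonal (fun j => (x j : ℂ)) * Uᴴ := hσ.1.eq_unitary_diagonal
      _ = _ := by rw [h1]; simp only [Matrix.mul_assoc]
  have hσs : ∀ s, (σ s s).re = ∑ j, Complex.normSq (X s j) := by
    intro s
    conv_lhs => rw [hσX]
    simp [Matrix.mul_apply, Complex.normSq_apply]
  set P : Matrix n n ℂ := diagonal fun s => if p s then 1 else 0 with hP
  set Q : Matrix n n ℂ := diagonal fun s => if p s then 0 else 1 with hQ
  have hPQ : P + Q = 1 := by
    rw [hP, hQ, diagonal_add, ← diagonal_one]
    congr 1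
    ext s; split_ifs <;> simp
  have hPH : Pᴴ = P := by
    rw [hP, diagonal_conjTranspose]; congr 1; ext s; simp only [Pi.star_apply]; split_ifs <;> simp
  have hQH : Qᴴ = Q := by
    rw [hQ, diagonal_conjTranspose]; congr 1; ext s; simp only [Pi.star_apply]; split_ifs <;> simp
  have hR : (Matrix.of fun s t => if p s ∧ p t then σ s t else 0) = P * σ * P := by
    ext s t
    rw [hP, Matrix.mul_diagonal, Matrix.diagonal_mul, Matrix.of_apply]
    by_cases h1 : p s <;> by_cases h2 : p t <;> simp [h1, h2]
  rw [hR]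
  have hherm : (σ - P * σ * P).IsHermitian := by
    refine hσ.1.sub ?_
    have := isHermitian_mul_mul_conjTranspose P hσ.1
    rwa [hPH] at this
  have hdec : σ - P * σ * P = (Q * X) * Xᴴ + (P * X) * (Q * X)ᴴ := by
    rw [conjTranspose_mul Q X, hQH]
    have h1 : (Q * X) * Xᴴ + (P * X) * (Xᴴ * Q) = Q * (X * Xᴴ) + P * (X * Xᴴ) * Q := by
      simp only [Matrix.mul_assoc]
    rw [h1, ← hσX, eq_sub_iff_add_eq'.2 hPQ]
    noncomm_ring
  have hb := traceNorm_le_of_eq_add hherm _ _ _ _ hdec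
  rw [hsNormSq_conjTranspose, hsNormSq_conjTranspose] at hb
  have e1 : hsNormSq (Q * X) = ∑ s with ¬ p s, (σ s s).re := by
    rw [hsNormSq, Finset.sum_filter]
    refine Finset.sum_congr rfl fun s _ => ?_
    rw [hσs]
    by_cases h : p s <;> simp [hQ, Matrix.diagonal_mul, h]
  have e2 : hsNormSq X ≤ 1 := by
    refine le_trans (le_of_eq ?_) hσ1
    rw [hsNormSq, Matrix.trace, Complex.re_sum]
    exact Finset.sum_congr rfl fun s _ => (hσs s).symm
  have e3 : hsNormSq (P * X) ≤ 1 := by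
    refine le_trans ?_ e2
    refine Finset.sum_le_sum fun s _ => Finset.sum_le_sum fun j _ => ?_
    rw [hP, Matrix.diagonal_mul]
    split_ifs
    · simp
    · simp [Complex.normSq_nonneg]
  rw [e1] at hb
  have h5 : √(hsNormSq X) ≤ 1 := Real.sqrt_le_one.2 e2
  have h6 : √(hsNormSq (P * X)) ≤ 1 := Real.sqrt_le_one.2 e3
  nlinarith [Real.sqrt_nonneg (∑ s with ¬ p s, (σ s s).re)]

end Entropy

/-! ### Partial traces -/

section PartialTrace

open Matrix

variable {α β γ : Type*} [Fintype α] [DecidableEq α] [Fintype β] [DecidableEq β] [Fintype γ]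
  [DecidableEq γ]

/-- The partial trace over the first factor of a system whose basis is identified with `α × β`. -/
def partialTrace (e : α × β ≃ γ) (M : Matrix γ γ ℂ) : Matrix β β ℂ :=
  Matrix.of fun b b' => ∑ a, M (e (a, b)) (e (a, b'))

theorem partialTrace_sub (e : α × β ≃ γ) (M N : Matrix γ γ ℂ) :
    partialTrace e (M - N) = partialTrace e M - partialTrace e N := by
  ext b b'
  simp [partialTrace]

theorem partialTrace_isHermitian (e : α × β ≃ γ) {M : Matrix γ γ ℂ} (hM : M.IsHermitian) :
    (partialTrace e M).IsHermitian := by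
  ext b b'
  simp only [partialTrace, conjTranspose_apply, Matrix.of_apply, star_sum]
  exact Finset.sum_congr rfl fun a _ => hM.apply _ _

theorem trace_partialTrace (e : α × β ≃ γ) (M : Matrix γ γ ℂ) :
    (partialTrace e M).trace = M.trace := by
  simp only [partialTrace, Matrix.trace, Matrix.diag_apply, Matrix.of_apply]
  rw [Finset.sum_comm, ← Fintype.sum_prod_type (f := fun p => M (e p) (e p))]
  exact e.sum_comp (fun x => M x x)

theorem partialTrace_posSemidef (e : α × β ≃ γ) {M : Matrix γ γ ℂ} (hM : M.PosSemidef) :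
    (partialTrace e M).PosSemidef := by
  have : partialTrace e M = ∑ a, M.submatrix (fun b => e (a, b)) (fun b => e (a, b)) := by
    ext b b'
    simp [partialTrace, Matrix.sum_apply]
  rw [this]
  exact posSemidef_sum _ fun a _ => hM.submatrix _

/-- The trace norm does not increase under partial traces. -/
theorem traceNorm_partialTrace_le (e : α × β ≃ γ) {M : Matrix γ γ ℂ} (hM : M.IsHermitian) :
    traceNorm (partialTrace e M) ≤ traceNorm M := by
  obtain ⟨V, hV, h⟩ := exists_unitary_traceNorm_eq (partialTrace_isHermitian e hM)
  -- The sign of the partial trace, tensored with the identity, is a test operator for `M`.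
  set V' : Matrix γ γ ℂ := Matrix.of fun x y =>
    if (e.symm x).1 = (e.symm y).1 then V (e.symm x).2 (e.symm y).2 else 0 with hV'
  have hV'1 : V'ᴴ * V' = 1 := by
    ext x y
    rw [Matrix.mul_apply, ← e.sum_comp, Fintype.sum_prod_type]
    have h1 : ∀ a b, V'ᴴ x (e (a, b)) * V' (e (a, b)) y =
        if a = (e.symm x).1 ∧ a = (e.symm y).1 then
          Vᴴ (e.symm x).2 b * V b (e.symm y).2 else 0 := by
      intro a b
      simp only [hV', conjTranspose_apply, Matrix.of_apply, Equiv.symm_apply_apply]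
      rw [apply_ite star, star_zero, ite_zero_mul_ite_zero]
    simp only [h1]
    have h2 : ∀ a, (∑ b, if a = (e.symm x).1 ∧ a = (e.symm y).1 then
          Vᴴ (e.symm x).2 b * V b (e.symm y).2 else 0) =
        if a = (e.symm x).1 ∧ a = (e.symm y).1 then
          (1 : Matrix β β ℂ) (e.symm x).2 (e.symm y).2 else 0 := by
      intro a
      split_ifs
      · rw [← hV, Matrix.mul_apply]
      · simp
    simp only [h2]
    by_cases hxy : x = y
    · subst hxy; simp
    · rw [Matrix.one_apply_ne hxy]
      refine Finset.sum_eq_zero fun a _ => ?_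
      split_ifs with h3
      · refine Matrix.one_apply_ne fun h4 => hxy (e.symm.injective (Prod.ext ?_ h4))
        rw [← h3.1, ← h3.2]
      · rfl
  refine le_trans (le_of_eq ?_) ((le_abs_self _).trans (abs_re_trace_mul_le_traceNorm hM hV'1))
  rw [← h]
  congr 1
  rw [Matrix.trace, Matrix.trace, ← e.sum_comp (fun x => (M * V').diag x), Fintype.sum_prod_type,
    Finset.sum_comm]
  simp only [Matrix.diag_apply, Matrix.mul_apply]
  refine Finset.sum_congr rfl fun b _ => ?_
  have h3 : ∀ a, ∑ y, M (e (a, b)) y * V' y (e (a, b)) =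
      ∑ b', M (e (a, b)) (e (a, b')) * V b' b := by
    intro a
    rw [← e.sum_comp, Fintype.sum_prod_type, Finset.sum_eq_single a]
    · simp [hV']
    · intro a' _ ha'; simp [hV', ha']
    · simp
  simp only [h3, partialTrace, Matrix.of_apply, Finset.sum_mul]
  exact Finset.sum_comm

/-- The entropy of a state which, given the second factor, is uniformly distributed on a coset of
a subgroup `Z` in the first factor: it exceeds the entropy of the second factor by `log |Z|`. -/
theorem vonNeumannEntropy_eq_partialTrace_add [AddCommGroup α] (Z : AddSubgroup α) [Fintype Z]
    (e : α × β ≃ γ) {ω : Matrix γ γ ℂ} (hω : ω.IsHermitian) (D : α → β → Prop)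
    (hD : ∀ a a' b, D a b → (D a' b ↔ a' - a ∈ Z))
    (hoff : ∀ a a' b b', ω (e (a, b)) (e (a', b')) ≠ 0 → a = a' ∧ D a b ∧ D a' b')
    (hinv : ∀ a b b', ∀ z ∈ Z, ω (e (a + z, b)) (e (a + z, b')) = ω (e (a, b)) (e (a, b'))) :
    vonNeumannEntropy ω = vonNeumannEntropy (partialTrace e ω) +
      ω.trace.re * Real.log (Fintype.card Z) := by
  classical
  set R := partialTrace e ω with hR
  have hRH : R.IsHermitian := partialTrace_isHermitian e hω
  set U : Matrix β β ℂ := (↑hRH.eigenvectorUnitary : Matrix β β ℂ) with hU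
  have hUU : Uᴴ * U = 1 := hRH.eigenvectorUnitary_conjTranspose_mul
  set μ := hRH.eigenvalues with hμ
  have hRe : R = U * diagonal (fun j => (μ j : ℂ)) * Uᴴ := hRH.eq_unitary_diagonal
  have hN : (0 : ℝ) < Fintype.card Z := by exact_mod_cast Fintype.card_pos
  have hN' : (Fintype.card Z : ℂ) ≠ 0 := by exact_mod_cast hN.ne'
  -- A representative of the coset selected by the second factor.
  set r : β → α := fun b =>
    if h : ∃ a, D a b then Quotient.out (QuotientAddGroup.mk (s := Z) h.choose) else 0 with hr
  have hrD : ∀ a b, D a b → r b = Quotient.out (QuotientAddGroup.mk (s := Z) a) := by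
    intro a b hab
    have h : ∃ a, D a b := ⟨a, hab⟩
    simp only [hr, dif_pos h]
    congr 1
    rw [QuotientAddGroup.eq, neg_add_eq_sub]
    exact (hD _ _ b h.choose_spec).1 hab
  have hrZ : ∀ a b, D a b → a - r b ∈ Z := by
    intro a b hab
    rw [hrD a b hab, ← neg_add_eq_sub, ← QuotientAddGroup.eq]
    exact Quotient.out_eq _
  -- The isometry that turns the uniform distribution on `Z` into the one on the coset.
  set W : Matrix γ (Z × β) ℂ := Matrix.of fun x p =>
    if (e.symm x).1 = r (e.symm x).2 + p.1 then U (e.symm x).2 p.2 else 0 with hW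
  have hWW : Wᴴ * W = 1 := by
    ext ⟨z, j⟩ ⟨z', j'⟩
    rw [Matrix.mul_apply, ← e.sum_comp, Fintype.sum_prod_type, Finset.sum_comm]
    have h1 : ∀ b, ∑ a, Wᴴ (z, j) (e (a, b)) * W (e (a, b)) (z', j') =
        if z = z' then Uᴴ j b * U b j' else 0 := by
      intro b
      rw [Finset.sum_eq_single (r b + z)]
      · simp only [hW, conjTranspose_apply, Matrix.of_apply, Equiv.symm_apply_apply,
          add_right_inj, if_true]
        by_cases h : z = z'
        · simp [h]
        · rw [if_neg (fun h' => h (Subtype.ext h')), if_neg h, mul_zero]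
      · intro a _ ha
        simp [hW, conjTranspose_apply, ha]
      · simp
    simp only [h1]
    by_cases h : z = z'
    · subst h
      simp only [if_true]
      rw [← Matrix.mul_apply, hUU]
      by_cases hj : j = j'
      · subst hj; simp
      · rw [Matrix.one_apply_ne hj, Matrix.one_apply_ne (by simpa using hj)]
    · rw [Matrix.one_apply_ne (fun h' => h (congrArg Prod.fst h'))]
      simp [h]
  have hkey : ∀ a a' b b', ω (e (a, b)) (e (a', b')) =
      ∑ z : Z, if a = r b + z ∧ a' = r b' + z then R b b' / Fintype.card Z else 0 := by
    intro a a' b b'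
    by_cases hc : a = a' ∧ D a b ∧ D a' b'
    · obtain ⟨rfl, h1, h2⟩ := hc
      have h3 : r b = r b' := by rw [hrD a b h1, hrD a b' h2]
      have h4 : R b b' = Fintype.card Z * ω (e (a, b)) (e (a, b')) := by
        have h5 : R b b' = ∑ a'', ω (e (a + a'', b)) (e (a + a'', b')) := by
          rw [hR, partialTrace, Matrix.of_apply]
          exact (Equiv.sum_comp (Equiv.addLeft a) (fun x => ω (e (x, b)) (e (x, b')))).symm
        have h6 : ∀ a'', a'' ∉ Z → ω (e (a + a'', b)) (e (a + a'', b')) = 0 := by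
          intro a'' ha''
          by_contra h7
          have h8 := (hD a (a + a'') b h1).1 (hoff _ _ _ _ h7).2.1
          rw [add_sub_cancel_left] at h8
          exact ha'' h8
        rw [h5, ← Finset.sum_subset (Finset.subset_univ (Finset.univ.filter (· ∈ Z)))
          (fun x _ hx => h6 x (by simpa using hx))]
        rw [Finset.sum_congr rfl (fun z hz => hinv a b b' z (by simpa using hz)),
          Finset.sum_const, nsmul_eq_mul, Fintype.card_subtype]
      rw [Finset.sum_eq_single ⟨a - r b, hrZ a b h1⟩]
      · rw [if_pos ⟨by simp, by simp [h3]⟩, h4, mul_div_cancel_left₀ _ hN']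
      · intro z _ hz
        rw [if_neg]
        rintro ⟨h5, -⟩
        exact hz (Subtype.ext (eq_sub_of_add_eq' h5.symm))
      · simp
    · have h0 : ω (e (a, b)) (e (a', b')) = 0 := by
        by_contra h; exact hc (hoff _ _ _ _ h)
      rw [h0]
      refine (Finset.sum_eq_zero fun z _ => ?_).symm
      split_ifs with hz
      · rw [div_eq_zero_iff]
        left
        by_contra h1
        rw [hR, partialTrace, Matrix.of_apply] at h1
        obtain ⟨a'', -, h2⟩ := Finset.exists_ne_zero_of_sum_ne_zero h1
        obtain ⟨-, h3, h4⟩ := hoff _ _ _ _ h2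
        have h5 : r b = r b' := by rw [hrD a'' b h3, hrD a'' b' h4]
        have h6 : a = a' := by rw [hz.1, hz.2, h5]
        have h7 : a - a'' ∈ Z := by
          have := Z.sub_mem z.2 (hrZ a'' b h3)
          rw [hz.1]
          convert this using 1
          abel
        exact hc ⟨h6, (hD a'' a b h3).2 h7, h6 ▸ (hD a'' a b' h4).2 h7⟩
      · rfl
  have hωW : ω = W * diagonal (fun p : Z × β => ((μ p.2 / Fintype.card Z : ℝ) : ℂ)) * Wᴴ := by
    ext x x'
    obtain ⟨⟨a, b⟩, rfl⟩ := e.surjective x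
    obtain ⟨⟨a', b'⟩, rfl⟩ := e.surjective x'
    rw [hkey, Matrix.mul_apply, Fintype.sum_prod_type]
    refine Finset.sum_congr rfl fun z _ => ?_
    simp only [hW, Matrix.mul_diagonal, conjTranspose_apply, Matrix.of_apply,
      Equiv.symm_apply_apply]
    by_cases h1 : a = r b + z <;> by_cases h2 : a' = r b' + z
    · rw [if_pos ⟨h1, h2⟩]
      simp only [if_pos h1, if_pos h2]
      conv_lhs => rw [hRe]
      rw [Matrix.mul_apply, Finset.sum_div]
      refine Finset.sum_congr rfl fun j _ => ?_
      rw [Matrix.mul_diagonal, conjTranspose_apply]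
      push_cast
      ring
    · simp [h2]
    · simp [h1]
    · simp [h1]
  rw [vonNeumannEntropy_eq_of_isometry W _ hWW hωW, hRH.vonNeumannEntropy_eq,
    ← trace_partialTrace e, ← hR, hRH.re_trace_eq, Fintype.sum_prod_type]
  simp only []
  rw [Finset.sum_const,
    Finset.card_univ, nsmul_eq_mul, Finset.mul_sum, Finset.sum_mul, ← Finset.sum_add_distrib]
  refine Finset.sum_congr rfl fun j _ => ?_
  rw [← hμ]
  by_cases h : μ j = 0
  · simp [h]
  · rw [Real.negMulLog, Real.negMulLog, Real.log_div h hN.ne']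
    field_simp
    ring

end PartialTrace

/-! ### Homology modulo two -/

/-- Solvability of a finite system of linear equations. -/
theorem exists_sum_mul_eq_iff {K m n : Type*} [Field K] [Fintype m] [Fintype n]
    (M : m → n → K) (y : m → K) :
    (∃ x : n → K, ∀ i, ∑ j, M i j * x j = y i) ↔
      ∀ k : m → K, (∀ j, ∑ i, k i * M i j = 0) → ∑ i, k i * y i = 0 := by
  classical
  constructor
  · rintro ⟨x, hx⟩ k hk
    simp only [← hx, Finset.mul_sum]
    rw [Finset.sum_comm]
    refine Finset.sum_eq_zero fun j _ => ?_
    simp only [← mul_assoc, ← Finset.sum_mul, hk j, zero_mul]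
  · intro h
    by_contra hne
    have hy : y ∉ LinearMap.range (Matrix.mulVecLin (Matrix.of M)) := by
      rintro ⟨x, hx⟩
      exact hne ⟨x, fun i => congrFun hx i⟩
    obtain ⟨f, hf, hle⟩ := Submodule.exists_le_ker_of_notMem hy
    have hfe : ∀ z : m → K, f z = ∑ i, f (Pi.single i 1) * z i := by
      intro z
      conv_lhs => rw [← Finset.univ_sum_single z]
      rw [map_sum]
      refine Finset.sum_congr rfl fun i _ => ?_
      have : Pi.single i (z i) = z i • (Pi.single i 1 : m → K) := by
        ext j; by_cases hj : j = i
        · subst hj; simp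
        · simp [hj]
      rw [this, map_smul, smul_eq_mul, mul_comm]
    refine hf ((hfe y).trans (h _ fun j => ?_))
    have h1 : f (Matrix.mulVecLin (Matrix.of M) (Pi.single j 1)) = 0 :=
      hle (LinearMap.mem_range_self _ _)
    rw [hfe] at h1
    simpa [Matrix.mulVecLin_apply] using h1

namespace CellulatedSurface

variable (Λ : CellulatedSurface)

/-- Every edge consists of two darts. -/
theorem edge_eq_iff_eq_or_flip (d d₀ : Λ.Dart) :
    Λ.edge d = Λ.edge d₀ ↔ d = d₀ ∨ d = Λ.flip d₀ := by
  constructor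
  · intro h
    obtain ⟨n, hn⟩ := (Λ.edge_eq_iff d₀ d).1 h.symm
    have h2 : Λ.flip ^ 2 = 1 := by ext x; simp [sq, Λ.flip_flip]
    rcases Int.even_or_odd' n with ⟨m, rfl | rfl⟩
    · left
      rw [zpow_mul, zpow_ofNat, h2, one_zpow] at hn
      exact hn.symm
    · right
      rw [zpow_add, zpow_mul, zpow_ofNat, h2, one_zpow, one_mul, zpow_one] at hn
      exact hn.symm
  · rintro (rfl | rfl)
    · rfl
    · exact ((Λ.edge_eq_iff _ _).2 (SquareTorus.sameCycle_step _ rfl))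

@[simp]
theorem edge_flip (d : Λ.Dart) : Λ.edge (Λ.flip d) = Λ.edge d :=
  (Λ.edge_eq_iff_eq_or_flip _ _).2 (Or.inr rfl)

@[simp]
theorem vert_rot (d : Λ.Dart) : Λ.vert (Λ.rot d) = Λ.vert d :=
  (Λ.vert_eq_iff _ _).2 (SquareTorus.sameCycle_step _ rfl)

@[simp]
theorem vert_rot_inv (d : Λ.Dart) : Λ.vert (Λ.rot⁻¹ d) = Λ.vert d := by
  conv_rhs => rw [← Λ.rot.apply_symm_apply d, vert_rot]
  rfl

@[simp]
theorem face_rot_inv_flip (d : Λ.Dart) : Λ.face (Λ.rot⁻¹ (Λ.flip d)) = Λ.face d :=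
  (Λ.face_eq_iff _ _).2 (SquareTorus.sameCycle_step _ rfl)

theorem face_rot_inv (d : Λ.Dart) : Λ.face (Λ.rot⁻¹ d) = Λ.face (Λ.flip d) := by
  conv_lhs => rw [← Λ.flip_flip d, face_rot_inv_flip]

theorem face_eq_face_flip_rot (d : Λ.Dart) : Λ.face d = Λ.face (Λ.flip (Λ.rot d)) := by
  rw [← face_rot_inv]
  exact congrArg Λ.face (Λ.rot.symm_apply_apply d).symm

/-- Functions of the darts which are invariant under the two permutations are constant, because the
surface is connected. -/
theorem eq_of_rot_flip_invariant {X : Type*} (h : Λ.Dart → X) (hr : ∀ d, h (Λ.rot d) = h d)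
    (hf : ∀ d, h (Λ.flip d) = h d) (d d' : Λ.Dart) : h d = h d' := by
  obtain ⟨g, hg, rfl⟩ := Λ.connected d d'
  have : ∀ x, h (g x) = h x := by
    induction hg using Subgroup.closure_induction with
    | mem g hg =>
      rcases hg with rfl | hg
      · exact hr
      · rw [Set.mem_singleton_iff] at hg
        subst hg
        exact hf
    | one => exact fun _ => rfl
    | mul a b _ _ ha hb => exact fun x => (ha _).trans (hb x)
    | inv a _ ha => exact fun x => (ha (a⁻¹ x)).symm.trans (congrArg h (a.apply_symm_apply x))
  exact (this d).symm

theorem sum_edge_fiber {X : Type*} [AddCommMonoid X] (u : Λ.Dart → X) (d : Λ.Dart) :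
    ∑ d' with Λ.edge d' = Λ.edge d, u d' = u d + u (Λ.flip d) := by
  have : (Finset.univ.filter fun d' => Λ.edge d' = Λ.edge d) = {d, Λ.flip d} := by
    ext d'
    simp [Λ.edge_eq_iff_eq_or_flip]
  rw [this, Finset.sum_pair (Λ.flip_ne d).symm]

theorem sum_dart_mul (h : Λ.Edge → ZMod 2) (u : Λ.Dart → ZMod 2) :
    ∑ d, h (Λ.edge d) * u d = ∑ e, h e * ∑ d with Λ.edge d = e, u d := by
  rw [← Finset.sum_fiberwise (s := Finset.univ) (g := Λ.edge)]
  refine Finset.sum_congr rfl fun e _ => ?_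
  rw [Finset.mul_sum]
  refine Finset.sum_congr rfl fun d hd => ?_
  rw [(Finset.mem_filter.1 hd).2]

/-- The incidence of edges with a cell `c` of a family of cells given by a map on darts, paired
with a chain. -/
theorem sum_incidence_mul {C : Type*} [DecidableEq C] (κ : Λ.Dart → C) (c : C)
    (s : Λ.Edge → ZMod 2) :
    ∑ e, (∑ d with κ d = c ∧ Λ.edge d = e, (1 : ZMod 2)) * s e =
      ∑ d with κ d = c, s (Λ.edge d) := by
  have h1 := Λ.sum_dart_mul s (fun d => if κ d = c then 1 else 0)
  simp only [mul_ite, mul_one, mul_zero, ← Finset.sum_filter, Finset.filter_filter] at h1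
  rw [h1]
  refine Finset.sum_congr rfl fun e _ => ?_
  rw [mul_comm]
  congr 2
  ext d
  simp [and_comm]

theorem pairing_star (v : Λ.Vertex) (s : Λ.Edge → ZMod 2) :
    pairing (Λ.star v) s = ∑ d with Λ.vert d = v, s (Λ.edge d) :=
  Λ.sum_incidence_mul Λ.vert v s

theorem isLoopConfig_iff (s : Λ.Config) :
    Λ.IsLoopConfig s ↔ ∀ v, pairing (Λ.star v) s = 0 := by
  simp only [pairing_star, IsLoopConfig]

/-- The boundary of a face, modulo 2. -/
def faceBoundary (f : Λ.Face) : Λ.Edge → ZMod 2 :=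
  fun e => ∑ d with Λ.face d = f ∧ Λ.edge d = e, 1

theorem pairing_faceBoundary (f : Λ.Face) (w : Λ.Edge → ZMod 2) :
    pairing (Λ.faceBoundary f) w = ∑ d with Λ.face d = f, w (Λ.edge d) :=
  Λ.sum_incidence_mul Λ.face f w

theorem isDualCycle_iff (w : Λ.Edge → ZMod 2) :
    Λ.IsDualCycle w ↔ ∀ f, pairing (Λ.faceBoundary f) w = 0 := by
  simp only [pairing_faceBoundary, IsDualCycle]

section Pairing

variable {Λ}

theorem pairing_comm (w s : Λ.Edge → ZMod 2) : pairing w s = pairing s w :=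
  Finset.sum_congr rfl fun _ _ => mul_comm _ _

theorem pairing_add (w s t : Λ.Edge → ZMod 2) :
    pairing w (s + t) = pairing w s + pairing w t := by
  simp [pairing, mul_add, Finset.sum_add_distrib]

theorem add_pairing (w s t : Λ.Edge → ZMod 2) :
    pairing (s + t) w = pairing s w + pairing t w := by
  simp [pairing, add_mul, Finset.sum_add_distrib]

theorem pairing_zero (w : Λ.Edge → ZMod 2) : pairing w 0 = 0 := by simp [pairing]

theorem sum_smul_pairing {ι : Type*} [Fintype ι] (a : ι → ZMod 2)
    (x : ι → Λ.Edge → ZMod 2) (s : Λ.Edge → ZMod 2) :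
    pairing (∑ i, a i • x i) s = ∑ i, a i * pairing (x i) s := by
  simp only [pairing, Finset.sum_apply, Pi.smul_apply, smul_eq_mul, Finset.sum_mul,
    Finset.mul_sum]
  rw [Finset.sum_comm]
  simp only [mul_assoc]

end Pairing

/-- A combination of incidence vectors of cells, at an edge. -/
theorem sum_smul_incidence_apply {C : Type*} [Fintype C] [DecidableEq C] (κ : Λ.Dart → C)
    (u : C → ZMod 2) (d : Λ.Dart) :
    ∑ c, u c * (∑ d' with κ d' = c ∧ Λ.edge d' = Λ.edge d, (1 : ZMod 2)) =
      u (κ d) + u (κ (Λ.flip d)) := by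
  rw [← Λ.sum_edge_fiber (fun d' => u (κ d')), ← Finset.sum_fiberwise (s := Finset.univ.filter _)
    (g := κ)]
  refine Finset.sum_congr rfl fun c _ => ?_
  rw [Finset.mul_sum, Finset.filter_filter]
  refine Finset.sum_congr ?_ fun d' hd' => ?_
  · ext d'; simp [and_comm]
  · simp only [Finset.mem_filter_univ] at hd'
    rw [hd'.2, mul_one]

theorem sum_smul_star_apply (u : Λ.Vertex → ZMod 2) (d : Λ.Dart) :
    (∑ v, u v • Λ.star v) (Λ.edge d) = u (Λ.vert d) + u (Λ.vert (Λ.flip d)) := by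
  simp only [Finset.sum_apply, Pi.smul_apply, smul_eq_mul, star]
  exact Λ.sum_smul_incidence_apply Λ.vert u d

theorem sum_smul_faceBoundary_apply (u : Λ.Face → ZMod 2) (d : Λ.Dart) :
    (∑ f, u f • Λ.faceBoundary f) (Λ.edge d) = u (Λ.face d) + u (Λ.face (Λ.flip d)) := by
  simp only [Finset.sum_apply, Pi.smul_apply, smul_eq_mul, faceBoundary]
  exact Λ.sum_smul_incidence_apply Λ.face u d

/-- The only relation among the stars is that all of them sum to zero. -/
theorem eq_const_of_sum_smul_star_eq_zero {u : Λ.Vertex → ZMod 2}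
    (h : ∑ v, u v • Λ.star v = 0) (v v' : Λ.Vertex) : u v = u v' := by
  obtain ⟨d, rfl⟩ := Λ.vert_surjective v
  obtain ⟨d', rfl⟩ := Λ.vert_surjective v'
  refine Λ.eq_of_rot_flip_invariant (fun d => u (Λ.vert d)) (fun d => by simp) (fun d => ?_) d d'
  have := congrFun h (Λ.edge d)
  rw [sum_smul_star_apply, Pi.zero_apply] at this
  exact (CharTwo.add_eq_zero.1 this).symm

/-- The only relation among the boundaries of faces is that all of them sum to zero. -/
theorem eq_const_of_sum_smul_faceBoundary_eq_zero {u : Λ.Face → ZMod 2}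
    (h : ∑ f, u f • Λ.faceBoundary f = 0) (f f' : Λ.Face) : u f = u f' := by
  obtain ⟨d, rfl⟩ := Λ.face_surjective f
  obtain ⟨d', rfl⟩ := Λ.face_surjective f'
  have key : ∀ d, u (Λ.face (Λ.flip d)) = u (Λ.face d) := by
    intro d
    have := congrFun h (Λ.edge d)
    rw [sum_smul_faceBoundary_apply, Pi.zero_apply] at this
    exact (CharTwo.add_eq_zero.1 this).symm
  refine Λ.eq_of_rot_flip_invariant (fun d => u (Λ.face d)) (fun d => ?_) key d d'
  exact (key _).symm.trans (congrArg u (Λ.face_eq_face_flip_rot d).symm)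

theorem sum_star_eq_zero : ∑ v, Λ.star v = 0 := by
  ext e
  obtain ⟨d, rfl⟩ := Λ.edge_surjective e
  have := Λ.sum_smul_star_apply (fun _ => 1) d
  simp only [one_smul] at this
  rw [this]
  rfl

theorem isDualCycle_sum_smul_star (u : Λ.Vertex → ZMod 2) :
    Λ.IsDualCycle (∑ v, u v • Λ.star v) := by
  intro f
  simp only [sum_smul_star_apply]
  rw [Finset.sum_add_distrib]
  have : ∑ d with Λ.face d = f, u (Λ.vert (Λ.flip d)) = ∑ d with Λ.face d = f, u (Λ.vert d) := by
    refine Finset.sum_equiv (Λ.rot⁻¹ * Λ.flip) (fun d => ?_) (fun d _ => ?_)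
    · simp only [Finset.mem_filter_univ, Equiv.Perm.mul_apply, face_rot_inv_flip]
    · rw [Equiv.Perm.mul_apply, vert_rot_inv]
  rw [this]
  exact CharTwo.add_self_eq_zero _

theorem isDualCycle_star (v : Λ.Vertex) : Λ.IsDualCycle (Λ.star v) := by
  have := Λ.isDualCycle_sum_smul_star (Pi.single v 1)
  rwa [Finset.sum_eq_single v (fun b _ hb => by simp [hb]) (by simp), Pi.single_eq_same,
    one_smul] at this

theorem IsDualCycle.add {w w' : Λ.Edge → ZMod 2} (hw : Λ.IsDualCycle w)
    (hw' : Λ.IsDualCycle w') : Λ.IsDualCycle (w + w') := by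
  intro f
  simp only [Pi.add_apply, Finset.sum_add_distrib, hw f, hw' f, add_zero]

theorem IsDualCycle.sum_smul {ι : Type*} [Fintype ι] {w : ι → Λ.Edge → ZMod 2}
    (hw : ∀ i, Λ.IsDualCycle (w i)) (a : ι → ZMod 2) : Λ.IsDualCycle (∑ i, a i • w i) := by
  rw [isDualCycle_iff]
  intro f
  rw [pairing_comm, sum_smul_pairing]
  refine Finset.sum_eq_zero fun i _ => ?_
  rw [pairing_comm, (Λ.isDualCycle_iff _).1 (hw i), mul_zero]

theorem isLoopConfig_faceBoundary (f : Λ.Face) : Λ.IsLoopConfig (Λ.faceBoundary f) := by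
  rw [isLoopConfig_iff]
  intro v
  rw [pairing_comm, (Λ.isDualCycle_iff _).1 (Λ.isDualCycle_star v)]

/-! ### Potentials on simply connected regions -/

/-- A function which sums to zero over the cycles of a permutation is a difference. -/
theorem exists_add_perm_eq {D C : Type} [Fintype D] [DecidableEq D] [Fintype C] [DecidableEq C]
    (φ : Equiv.Perm D) (κ : D → C) (hκ : ∀ d d', κ d = κ d' ↔ φ.SameCycle d d')
    (g : D → ZMod 2) (hg : ∀ c, ∑ d with κ d = c, g d = 0) :
    ∃ θ : D → ZMod 2, ∀ d, θ d + θ (φ d) = g d := by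
  have h1 := (exists_sum_mul_eq_iff (fun d d' : D => (if d' = d then (1 : ZMod 2) else 0) +
    if d' = φ d then 1 else 0) g).2 ?_
  · obtain ⟨θ, hθ⟩ := h1
    refine ⟨θ, fun d => ?_⟩
    rw [← hθ d]
    simp [add_mul, Finset.sum_add_distrib]
  · intro k hk
    have hk' : ∀ d, k (φ d) = k d := by
      intro d
      have h2 := hk (φ d)
      simp only [mul_add, Finset.sum_add_distrib, mul_ite, mul_one, mul_zero,
        EmbeddingLike.apply_eq_iff_eq] at h2
      rw [Finset.sum_ite_eq, Finset.sum_ite_eq] at h2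
      simp only [Finset.mem_univ, if_true] at h2
      exact CharTwo.add_eq_zero.1 h2
    rw [← Finset.sum_fiberwise (s := Finset.univ) (g := κ)]
    refine Finset.sum_eq_zero fun c _ => ?_
    rcases (Finset.univ.filter fun d => κ d = c).eq_empty_or_nonempty with h0 | ⟨d₀, hd₀⟩
    · rw [h0, Finset.sum_empty]
    · have h3 : ∀ d ∈ Finset.univ.filter fun d => κ d = c, k d * g d = k d₀ * g d := by
        intro d hd
        rw [SquareTorus.eq_of_sameCycle φ k hk' ((hκ d d₀).1 ((Finset.mem_filter.1 hd).2.trans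
          (Finset.mem_filter.1 hd₀).2.symm))]
      rw [Finset.sum_congr rfl h3, ← Finset.mul_sum, hg, mul_zero]

section Paths

variable {Λ}

/-- The sum of a function on the sides of the tiles along a path. -/
def pathSum (θ : Λ.Dart → ZMod 2) (p : List Λ.Step) : ZMod 2 := (p.map fun s => θ s.1).sum

theorem pathSum_append (θ : Λ.Dart → ZMod 2) (p q : List Λ.Step) :
    pathSum θ (p ++ q) = pathSum θ p + pathSum θ q := by simp [pathSum]

@[simp]
theorem Step.source_reverse (s : Λ.Step) : s.reverse.source = s.target := by
  obtain ⟨d, b⟩ := s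
  cases b <;> simp [Step.source, Step.target, Step.reverse]

@[simp]
theorem Step.target_reverse (s : Λ.Step) : s.reverse.target = s.source := by
  obtain ⟨d, b⟩ := s
  cases b <;> simp [Step.source, Step.target, Step.reverse]

@[simp]
theorem Step.reverse_reverse (s : Λ.Step) : s.reverse.reverse = s := by
  obtain ⟨d, b⟩ := s
  cases b <;> simp [Step.reverse]

variable {A : Finset Λ.Edge}

theorem IsPath.append {x y z : Λ.Point} {p q : List Λ.Step} (hp : Λ.IsPath A x y p)
    (hq : Λ.IsPath A y z q) : Λ.IsPath A x z (p ++ q) := by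
  induction p generalizing x with
  | nil => obtain rfl : x = y := hp; exact hq
  | cons s p ih => exact ⟨hp.1, hp.2.1, ih hp.2.2⟩

theorem isPath_singleton {s : Λ.Step} (hs : s.InRegion A) :
    Λ.IsPath A s.source s.target [s] := ⟨hs, rfl, rfl⟩

/-- The reverse path. -/
def reversePath (p : List Λ.Step) : List Λ.Step := (p.map Step.reverse).reverse

theorem reversePath_cons (s : Λ.Step) (p : List Λ.Step) :
    reversePath (s :: p) = reversePath p ++ [s.reverse] := by simp [reversePath]

theorem IsPath.reversePath {x y : Λ.Point} {p : List Λ.Step} (hp : Λ.IsPath A x y p) :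
    Λ.IsPath A y x (reversePath p) := by
  induction p generalizing x with
  | nil => exact Eq.symm hp
  | cons s p ih =>
    rw [reversePath_cons]
    refine (ih hp.2.2).append ?_
    have := isPath_singleton (A := A) (s := s.reverse) hp.1
    rwa [Step.source_reverse, Step.target_reverse, hp.2.1] at this

theorem pathSum_reversePath (θ : Λ.Dart → ZMod 2) (p : List Λ.Step) :
    pathSum θ (reversePath p) = pathSum θ p := by
  rw [pathSum, reversePath, List.map_reverse, List.sum_reverse, List.map_map]
  rfl

/-- The sum of a closed cochain along a closed path depends only on the homotopy class of the path.
-/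
theorem LoopHomotopic.pathSum_eq {θ : Λ.Dart → ZMod 2}
    (hθ : ∀ d, Λ.edge d ∈ A →
      θ d + θ (Λ.rot⁻¹ (Λ.flip d)) + θ (Λ.flip d) + θ (Λ.rot⁻¹ d) = 0)
    {x : Λ.Point} {p q : List Λ.Step} (h : Λ.LoopHomotopic A x p q) :
    pathSum θ p = pathSum θ q := by
  induction h with
  | rel p q h =>
    obtain ⟨-, -, h⟩ := h
    cases h with
    | backtrack p q s hs =>
      simp only [pathSum_append]
      have : pathSum θ [s, s.reverse] = 0 := by
        simp only [pathSum, List.map_cons, List.map_nil, List.sum_cons, List.sum_nil, add_zero]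
        exact CharTwo.add_self_eq_zero _
      rw [this, add_zero]
    | tile p q d hd =>
      simp only [pathSum_append]
      have : pathSum θ (Λ.tileBoundary d) = 0 := by
        rw [← hθ d hd]
        simp [pathSum, tileBoundary, add_assoc]
      rw [this, add_zero]
  | refl => rfl
  | symm _ _ _ ih => exact ih.symm
  | trans _ _ _ _ _ ih1 ih2 => exact ih1.trans ih2

theorem pointInRegion_source {s : Λ.Step} (hs : s.InRegion A) : Λ.PointInRegion A s.source := by
  obtain ⟨d, b⟩ := s
  cases b <;> rcases hs with hs | hs
  · exact ⟨d, hs, Or.inr rfl⟩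
  · exact ⟨Λ.flip (Λ.rot d), by simpa using hs,
      Or.inr (congrArg Sum.inr (Λ.face_eq_face_flip_rot d))⟩
  · exact ⟨d, hs, Or.inl rfl⟩
  · exact ⟨Λ.rot d, hs, Or.inl (congrArg Sum.inl (Λ.vert_rot d).symm)⟩

theorem pointInRegion_target {s : Λ.Step} (hs : s.InRegion A) : Λ.PointInRegion A s.target := by
  rw [← Step.source_reverse]
  exact pointInRegion_source (s := s.reverse) hs

/-- On a simply connected region, a cochain on the sides of the tiles which sums to zero around
every tile has a potential. -/
theorem IsSimplyConnected.exists_potential (hA : Λ.IsSimplyConnected A) {θ : Λ.Dart → ZMod 2}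
    (hθ : ∀ d, Λ.edge d ∈ A →
      θ d + θ (Λ.rot⁻¹ (Λ.flip d)) + θ (Λ.flip d) + θ (Λ.rot⁻¹ d) = 0) :
    ∃ u : Λ.Point → ZMod 2, ∀ d, Λ.edge d ∈ A ∨ Λ.edge (Λ.rot d) ∈ A →
      θ d = u (Sum.inl (Λ.vert d)) + u (Sum.inr (Λ.face d)) := by
  classical
  obtain ⟨⟨e₀, he₀⟩, hconn, htriv⟩ := hA
  obtain ⟨d₀, rfl⟩ := Λ.edge_surjective e₀
  set x₀ : Λ.Point := Sum.inl (Λ.vert d₀) with hx₀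
  have hx₀A : Λ.PointInRegion A x₀ := ⟨d₀, he₀, Or.inl rfl⟩
  -- The potential is the sum along some path from `x₀`; two paths with the same end point bound a
  -- contractible closed path.
  refine ⟨fun x => if h : Λ.PointInRegion A x then
    pathSum θ (hconn x₀ x hx₀A h).choose else 0, fun d hd => ?_⟩
  have hs : Step.InRegion A (d, true) := hd
  have h1 := pointInRegion_source hs
  have h2 := pointInRegion_target hs
  have e1 : Step.source ((d, true) : Λ.Step) = Sum.inl (Λ.vert d) := rfl
  have e2 : Step.target ((d, true) : Λ.Step) = Sum.inr (Λ.face d) := rfl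
  rw [e1] at h1
  rw [e2] at h2
  simp only [dif_pos h1, dif_pos h2]
  have p1 := (hconn x₀ _ hx₀A h1).choose_spec
  have p2 := (hconn x₀ _ hx₀A h2).choose_spec
  set q1 := (hconn x₀ _ hx₀A h1).choose
  set q2 := (hconn x₀ _ hx₀A h2).choose
  have hloop := (p1.append (isPath_singleton hs)).append p2.reversePath
  have h3 := (htriv x₀ hx₀A _ hloop).pathSum_eq hθ
  rw [pathSum_append, pathSum_append, pathSum_reversePath] at h3
  have h4 : pathSum θ [((d, true) : Λ.Step)] = θ d := by simp [pathSum]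
  have h5 : pathSum θ ([] : List Λ.Step) = 0 := rfl
  rw [h4, h5] at h3
  have h6 : θ d = θ d + (pathSum θ q1 + θ d + pathSum θ q2) := by rw [h3, add_zero]
  rw [h6]
  linear_combination (CharTwo.add_self_eq_zero (θ d))

end Paths

variable {Λ}

/-- A loop configuration in a simply connected region is a boundary: it crosses every closed dual
loop an even number of times. -/
theorem IsSimplyConnected.pairing_eq_zero_of_isLoopConfig {A : Finset Λ.Edge}
    (hA : Λ.IsSimplyConnected A) {w z : Λ.Edge → ZMod 2} (hw : Λ.IsDualCycle w)
    (hz : Λ.IsLoopConfig z) (hzA : ∀ e, e ∉ A → z e = 0) : pairing w z = 0 := by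
  -- Around every face, `w` is the difference of a function `θ` on the sides of the tiles; `θ` is
  -- closed.
  obtain ⟨θ, hθ⟩ := exists_add_perm_eq (Λ.rot⁻¹ * Λ.flip) Λ.face Λ.face_eq_iff
    (fun d => w (Λ.edge d)) hw
  simp only [Equiv.Perm.mul_apply] at hθ
  obtain ⟨u, hu⟩ := hA.exists_potential (θ := θ) (fun d _ => by
    have h1 := hθ d
    have h2 := hθ (Λ.flip d)
    rw [Λ.flip_flip, edge_flip] at h2
    rw [h1, add_assoc, h2]
    exact CharTwo.add_self_eq_zero _)
  -- On `A` the dual loop `w` is the coboundary of the potential at the vertices; summation by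
  -- parts.
  have key : ∀ e, w e * z e = z e * ∑ d with Λ.edge d = e, u (Sum.inl (Λ.vert d)) := by
    intro e
    by_cases he : e ∈ A
    · obtain ⟨d, rfl⟩ := Λ.edge_surjective e
      rw [Λ.sum_edge_fiber, ← hθ d, hu d (Or.inl he), hu (Λ.rot⁻¹ (Λ.flip d))
        (Or.inr (by simpa using he)), vert_rot_inv, face_rot_inv_flip]
      linear_combination z (Λ.edge d) * CharTwo.add_self_eq_zero (u (Sum.inr (Λ.face d)))
    · simp [hzA e he]
  rw [pairing, Finset.sum_congr rfl fun e _ => key e, ← Λ.sum_dart_mul,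
    ← Finset.sum_fiberwise (s := Finset.univ) (g := Λ.vert)]
  refine Finset.sum_eq_zero fun v _ => ?_
  have : ∀ d ∈ Finset.univ.filter fun d => Λ.vert d = v,
      z (Λ.edge d) * u (Sum.inl (Λ.vert d)) = z (Λ.edge d) * u (Sum.inl v) := by
    intro d hd; rw [(Finset.mem_filter.1 hd).2]
  rw [Finset.sum_congr rfl this, ← Finset.sum_mul, hz v, zero_mul]

/-- A closed dual loop in a simply connected region is contractible: it is crossed an even number
of times by every loop configuration. -/
theorem IsSimplyConnected.pairing_eq_zero_of_isDualCycle {A : Finset Λ.Edge}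
    (hA : Λ.IsSimplyConnected A) {w z : Λ.Edge → ZMod 2} (hw : Λ.IsDualCycle w)
    (hz : Λ.IsLoopConfig z) (hwA : ∀ e, e ∉ A → w e = 0) : pairing w z = 0 := by
  -- Around every vertex, `z` is the difference of a function `θ` on the sides of the tiles.
  obtain ⟨θ, hθ⟩ := exists_add_perm_eq Λ.rot⁻¹ Λ.vert
    (fun d d' => by rw [Λ.vert_eq_iff, Equiv.Perm.sameCycle_inv])
    (fun d => z (Λ.edge d)) hz
  obtain ⟨u, hu⟩ := hA.exists_potential (θ := θ) (fun d _ => by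
    have h1 := hθ d
    have h2 := hθ (Λ.flip d)
    rw [edge_flip] at h2
    calc _ = (θ d + θ (Λ.rot⁻¹ d)) + (θ (Λ.flip d) + θ (Λ.rot⁻¹ (Λ.flip d))) := by ring
      _ = 0 := by rw [h1, h2]; exact CharTwo.add_self_eq_zero _)
  -- On `A` the loops `z` bound the potential at the faces; summation by parts.
  have key : ∀ e, w e * z e = w e * ∑ d with Λ.edge d = e, u (Sum.inr (Λ.face d)) := by
    intro e
    by_cases he : e ∈ A
    · obtain ⟨d, rfl⟩ := Λ.edge_surjective e
      rw [Λ.sum_edge_fiber, ← hθ d, hu d (Or.inl he), hu (Λ.rot⁻¹ d)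
        (Or.inr (by simpa using he)), vert_rot_inv, face_rot_inv]
      linear_combination w (Λ.edge d) * CharTwo.add_self_eq_zero (u (Sum.inl (Λ.vert d)))
    · simp [hwA e he]
  rw [pairing, Finset.sum_congr rfl fun e _ => key e, ← Λ.sum_dart_mul,
    ← Finset.sum_fiberwise (s := Finset.univ) (g := Λ.face)]
  refine Finset.sum_eq_zero fun f _ => ?_
  have : ∀ d ∈ Finset.univ.filter fun d => Λ.face d = f,
      w (Λ.edge d) * u (Sum.inr (Λ.face d)) = w (Λ.edge d) * u (Sum.inr f) := by
    intro d hd; rw [(Finset.mem_filter.1 hd).2]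
  rw [Finset.sum_congr rfl this, ← Finset.sum_mul, hw f, zero_mul]

/-- A vector orthogonal to all the loop configurations is a sum of stars. -/
theorem exists_eq_sum_smul_star {x : Λ.Edge → ZMod 2}
    (hx : ∀ z, Λ.IsLoopConfig z → pairing x z = 0) :
    ∃ u : Λ.Vertex → ZMod 2, x = ∑ v, u v • Λ.star v := by
  have h1 := (exists_sum_mul_eq_iff (fun (e : Λ.Edge) (v : Λ.Vertex) => Λ.star v e) x).2 (by
    intro k hk
    have := hx k ((Λ.isLoopConfig_iff k).2 fun v => by
      rw [pairing_comm]; exact hk v)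
    rwa [pairing_comm] at this)
  obtain ⟨u, hu⟩ := h1
  refine ⟨u, funext fun e => ?_⟩
  rw [← hu e]
  simp [mul_comm]

/-- There are loop configurations with prescribed winding parities outside any region in which all
the closed dual loops are contractible. -/
theorem exists_isLoopConfig_off {ι : Type} [Fintype ι] {w : ι → Λ.Edge → ZMod 2}
    (hw : Λ.IsIndependentHoles w) (A : Finset Λ.Edge)
    (hA : ∀ x, Λ.IsDualCycle x → (∀ e, e ∉ A → x e = 0) → ∀ z, Λ.IsLoopConfig z → pairing x z = 0)
    (r : ι → ZMod 2) :
    ∃ t, Λ.IsLoopConfig t ∧ (∀ i, pairing (w i) t = r i) ∧ ∀ e ∈ A, t e = 0 := by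
  classical
  -- If there were none, some combination of stars and dual loops `w i` with an odd value on `r`
  -- would be a closed dual loop in `A`, hence a sum of stars, contradicting the independence of
  -- `w`.
  have h1 := (exists_sum_mul_eq_iff (fun (i : Λ.Vertex ⊕ ι) (e : {e // e ∉ A}) =>
    Sum.elim Λ.star w i e) (Sum.elim (fun _ => 0) r)).2 (by
    intro k hk
    set x := ∑ v, k (Sum.inl v) • Λ.star v + ∑ i, k (Sum.inr i) • w i with hx
    have hxc : Λ.IsDualCycle x :=
      (Λ.isDualCycle_sum_smul_star _).add _ (IsDualCycle.sum_smul Λ hw.1 _)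
    obtain ⟨u, hu⟩ := exists_eq_sum_smul_star (hA x hxc (fun e he => by
      have := hk ⟨e, he⟩
      simpa [hx, Fintype.sum_sum_type] using this))
    have h2 : (fun i => k (Sum.inr i)) = 0 := by
      refine hw.2 _ ⟨fun v => u v + k (Sum.inl v), ?_⟩
      simp only [add_smul, Finset.sum_add_distrib, ← hu, hx]
      ext e
      simp only [Pi.add_apply, Pi.zero_apply]
      linear_combination -CharTwo.add_self_eq_zero ((∑ v, k (Sum.inl v) • Λ.star v) e)
    rw [Fintype.sum_sum_type]
    simp [fun i => congrFun h2 i])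
  obtain ⟨t, ht⟩ := h1
  have hp : ∀ x : Λ.Edge → ZMod 2, pairing x (fun e => if h : e ∈ A then 0 else t ⟨e, h⟩) =
      ∑ e : {e // e ∉ A}, x e * t e := by
    intro x
    rw [pairing, ← Finset.sum_subset (Finset.subset_univ (Finset.univ.filter (· ∉ A)))
      (fun e _ he => by
        have : e ∈ A := by simpa using he
        simp [this])]
    rw [Finset.sum_subtype (p := fun e => e ∉ A) (Finset.univ.filter (· ∉ A)) (by simp)]
    exact Finset.sum_congr rfl fun e _ => by rw [dif_neg e.2]
  refine ⟨fun e => if h : e ∈ A then 0 else t ⟨e, h⟩, (Λ.isLoopConfig_iff _).2 fun v => ?_,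
    fun i => ?_, fun e he => by simp [he]⟩
  · rw [hp]; exact ht (Sum.inl v)
  · rw [hp]; exact ht (Sum.inr i)

/-! ### Loop configurations on a surface of genus `k` -/

/-- On a surface of genus `k`, `2 * k` independent dual loops and the stars span all the closed
dual loops. -/
theorem exists_eq_of_isDualCycle {k : ℕ} (hk : Λ.HasGenus k)
    {w : Fin (2 * k) → Λ.Edge → ZMod 2} (hw : Λ.IsIndependentHoles w) {x : Λ.Edge → ZMod 2}
    (hx : Λ.IsDualCycle x) : ∃ (u : Λ.Vertex → ZMod 2) (a : Fin (2 * k) → ZMod 2),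
      x = ∑ v, u v • Λ.star v + ∑ i, a i • w i := by
  classical
  let T : ((Λ.Vertex → ZMod 2) × (Fin (2 * k) → ZMod 2)) →ₗ[ZMod 2] (Λ.Edge → ZMod 2) :=
    (Fintype.linearCombination (ZMod 2) Λ.star).coprod (Fintype.linearCombination (ZMod 2) w)
  have hT : ∀ u a, T (u, a) = ∑ v, u v • Λ.star v + ∑ i, a i • w i := by
    intro u a
    simp [T, Fintype.linearCombination_apply]
  let S : (Λ.Edge → ZMod 2) →ₗ[ZMod 2] (Λ.Face → ZMod 2) :=
    { toFun := fun x f => pairing (Λ.faceBoundary f) x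
      map_add' := fun x y => by ext f; exact pairing_add _ _ _
      map_smul' := fun c x => by
        ext f
        simp only [pairing, Pi.smul_apply, smul_eq_mul, RingHom.id_apply, Finset.mul_sum]
        exact Finset.sum_congr rfl fun e _ => by ring }
  have hS : ∀ x, x ∈ LinearMap.ker S ↔ Λ.IsDualCycle x := by
    intro x
    rw [isDualCycle_iff, LinearMap.mem_ker]
    exact ⟨fun h f => congrFun h f, fun h => funext h⟩
  have hle : LinearMap.range T ≤ LinearMap.ker S := by
    rintro _ ⟨⟨u, a⟩, rfl⟩
    rw [hS, hT]
    exact (Λ.isDualCycle_sum_smul_star _).add _ (IsDualCycle.sum_smul Λ hw.1 _)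
  obtain ⟨d₀⟩ := Λ.nonempty
  -- The kernel of `T` consists of the constants.
  have hkerT : Module.finrank (ZMod 2) (LinearMap.ker T) ≤ 1 := by
    refine finrank_le_one (⟨(fun _ => 1, 0), ?_⟩ : LinearMap.ker T) ?_
    · rw [LinearMap.mem_ker, hT]
      simp [Λ.sum_star_eq_zero]
    · rintro ⟨⟨u, a⟩, h⟩
      rw [LinearMap.mem_ker, hT] at h
      have ha : a = 0 := by
        refine hw.2 a ⟨u, ?_⟩
        rw [zero_add]
        funext e
        exact (CharTwo.add_eq_zero.1 (congrFun h e)).symm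
      subst ha
      refine ⟨u (Λ.vert d₀), Subtype.ext (Prod.ext (funext fun v => ?_) ?_)⟩
      · simp only [Pi.zero_apply, zero_smul, Finset.sum_const_zero, add_zero] at h
        simpa using Λ.eq_const_of_sum_smul_star_eq_zero h _ v
      · simp
  -- The range of `S` contains all the vectors with sum zero.
  have hranS : Fintype.card Λ.Face ≤ Module.finrank (ZMod 2) (LinearMap.range S) + 1 := by
    let σ : (Λ.Face → ZMod 2) →ₗ[ZMod 2] ZMod 2 := Fintype.linearCombination (ZMod 2) fun _ => 1
    have h1 : LinearMap.ker σ ≤ LinearMap.range S := by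
      intro y hy
      have hy' : ∑ f, y f = 0 := by
        simpa [σ, Fintype.linearCombination_apply] using hy
      have h2 := (exists_sum_mul_eq_iff (fun (f : Λ.Face) (e : Λ.Edge) => Λ.faceBoundary f e)
        y).2 (by
          intro k hk
          have h3 := Λ.eq_const_of_sum_smul_faceBoundary_eq_zero (u := k) (by
            funext e; simpa using hk e)
          rw [Finset.sum_congr rfl fun f _ => by rw [h3 f (Λ.face d₀)], ← Finset.mul_sum, hy',
            mul_zero])
      obtain ⟨x, hx⟩ := h2
      exact ⟨x, funext hx⟩
    have h2 := Submodule.finrank_mono h1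
    have h3 := LinearMap.finrank_range_add_finrank_ker σ
    have h4 : Module.finrank (ZMod 2) (LinearMap.range σ) ≤ 1 := by
      simpa using Submodule.finrank_le (LinearMap.range σ)
    rw [Module.finrank_fintype_fun_eq_card] at h3
    omega
  have hT1 := LinearMap.finrank_range_add_finrank_ker T
  have hS1 := LinearMap.finrank_range_add_finrank_ker S
  rw [Module.finrank_prod, Module.finrank_fintype_fun_eq_card, Module.finrank_fintype_fun_eq_card,
    Fintype.card_fin] at hT1
  rw [Module.finrank_fintype_fun_eq_card] at hS1
  -- By Euler's formula, the two subspaces have the same dimension.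
  have heq : LinearMap.range T = LinearMap.ker S := by
    refine Submodule.eq_of_le_of_finrank_le hle ?_
    unfold HasGenus at hk
    omega
  obtain ⟨⟨u, a⟩, h⟩ := heq ▸ (hS x).2 hx
  exact ⟨u, a, by rw [← h, hT]⟩

/-- On a surface of genus `k`, a loop configuration with even winding parities is a sum of
boundaries of faces. -/
theorem exists_eq_sum_smul_faceBoundary {k : ℕ} (hk : Λ.HasGenus k)
    {w : Fin (2 * k) → Λ.Edge → ZMod 2} (hw : Λ.IsIndependentHoles w) {s : Λ.Config}
    (hs : Λ.IsLoopConfig s) (hsw : ∀ i, pairing (w i) s = 0) :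
    ∃ u : Λ.Face → ZMod 2, s = ∑ f, u f • Λ.faceBoundary f := by
  have h1 := (exists_sum_mul_eq_iff (fun (e : Λ.Edge) (f : Λ.Face) => Λ.faceBoundary f e) s).2 (by
    intro x hx
    obtain ⟨u, a, rfl⟩ := exists_eq_of_isDualCycle hk hw (x := x) ((Λ.isDualCycle_iff x).2
      fun f => by rw [pairing_comm]; exact hx f)
    change pairing _ s = 0
    rw [add_pairing, sum_smul_pairing, sum_smul_pairing]
    simp [hsw, (Λ.isLoopConfig_iff s).1 hs])
  obtain ⟨u, hu⟩ := h1
  refine ⟨u, funext fun e => ?_⟩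
  rw [← hu e]
  simp [mul_comm]

end CellulatedSurface

/-! ### Reduced states -/

section Reindex

open Matrix

variable {m n : Type*} [Fintype m] [DecidableEq m] [Fintype n] [DecidableEq n]

theorem vonNeumannEntropy_submatrix_equiv {M : Matrix n n ℂ} (hM : M.IsHermitian) (e : m ≃ n) :
    vonNeumannEntropy (M.submatrix e e) = vonNeumannEntropy M := by
  rw [← vonNeumannEntropy_conj hM (V := (1 : Matrix n n ℂ).submatrix e id)]
  · congr 1
    ext i j
    simp [Matrix.mul_apply, Matrix.one_apply]
  · ext i j
    rw [Matrix.mul_apply, ← e.symm.sum_comp]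
    simp [Matrix.one_apply, eq_comm]

end Reindex

namespace CellulatedSurface

variable {Λ : CellulatedSurface}

/-- A configuration is a configuration in the region and one outside of it. -/
def glueEquiv (A : Finset Λ.Edge) : ({e // e ∉ A} → ZMod 2) × (A → ZMod 2) ≃ Λ.Config where
  toFun p := glue A p.2 p.1
  invFun s := (fun e => s e, fun e => s e)
  left_inv p := by
    ext e
    · simp [glue, e.2]
    · simp [glue]
  right_inv s := by
    ext e
    simp [glue]

theorem reduced_isHermitian {σ : Λ.Op} (hσ : σ.IsHermitian) (A : Finset Λ.Edge) :
    (reduced σ A).IsHermitian := partialTrace_isHermitian (glueEquiv A) hσ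

theorem reduced_posSemidef {σ : Λ.Op} (hσ : σ.PosSemidef) (A : Finset Λ.Edge) :
    (reduced σ A).PosSemidef := partialTrace_posSemidef (glueEquiv A) hσ

theorem trace_reduced (σ : Λ.Op) (A : Finset Λ.Edge) : (reduced σ A).trace = σ.trace :=
  trace_partialTrace (glueEquiv A) σ

theorem reduced_sub (σ τ : Λ.Op) (A : Finset Λ.Edge) :
    reduced (σ - τ) A = reduced σ A - reduced τ A := partialTrace_sub (glueEquiv A) σ τ

theorem traceNorm_reduced_sub_le {σ τ : Λ.Op} (hσ : σ.IsHermitian) (hτ : τ.IsHermitian)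
    (A : Finset Λ.Edge) : traceNorm (reduced σ A - reduced τ A) ≤ traceNorm (σ - τ) := by
  rw [← reduced_sub]
  exact traceNorm_partialTrace_le (glueEquiv A) (hσ.sub hτ)

/-- A configuration on the union of two disjoint regions. -/
def unionEquiv {A R : Finset Λ.Edge} (h : Disjoint A R) :
    (A → ZMod 2) × (R → ZMod 2) ≃ (↥(A ∪ R) → ZMod 2) where
  toFun p e := if he : e.1 ∈ A then p.1 ⟨e, he⟩ else
    p.2 ⟨e, (Finset.mem_union.1 e.2).resolve_left he⟩
  invFun f := (fun e => f ⟨e, Finset.mem_union_left _ e.2⟩,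
    fun e => f ⟨e, Finset.mem_union_right _ e.2⟩)
  left_inv p := by
    ext e
    · simp
    · simp [Finset.disjoint_right.1 h e.2]
  right_inv f := by
    ext e
    simp

/-- A configuration outside a region, split by a disjoint region. -/
def complEquiv {A R : Finset Λ.Edge} (h : Disjoint A R) :
    (A → ZMod 2) × ({e // e ∉ A ∪ R} → ZMod 2) ≃ ({e // e ∉ R} → ZMod 2) where
  toFun p e := if he : e.1 ∈ A then p.1 ⟨e, he⟩ else
    p.2 ⟨e, fun h' => (Finset.mem_union.1 h').elim he e.2⟩
  invFun f := (fun e => f ⟨e, Finset.disjoint_left.1 h e.2⟩,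
    fun e => f ⟨e, fun h' => e.2 (Finset.mem_union_right _ h')⟩)
  left_inv p := by
    ext e
    · simp
    · have : e.1 ∉ A := fun h' => e.2 (Finset.mem_union_left _ h')
      simp [this]
  right_inv f := by
    ext e
    simp

theorem glue_unionEquiv {A R : Finset Λ.Edge} (h : Disjoint A R) (a : A → ZMod 2)
    (b : R → ZMod 2) (c : {e // e ∉ A ∪ R} → ZMod 2) :
    glue (A ∪ R) (unionEquiv h (a, b)) c = glue R b (complEquiv h (a, c)) := by
  ext e
  by_cases h1 : e ∈ A
  · have h2 : e ∉ R := Finset.disjoint_left.1 h h1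
    simp [glue, unionEquiv, complEquiv, h1, h2]
  · by_cases h2 : e ∈ R
    · simp [glue, unionEquiv, h1, h2]
    · simp [glue, complEquiv, h1, h2]

theorem partialTrace_reduced_union {A R : Finset Λ.Edge} (h : Disjoint A R) (σ : Λ.Op) :
    partialTrace (unionEquiv h) (reduced σ (A ∪ R)) = reduced σ R := by
  ext b b'
  simp only [partialTrace, reduced, Matrix.of_apply, glue_unionEquiv]
  rw [← Fintype.sum_prod_type (f := fun p : (A → ZMod 2) × ({e // e ∉ A ∪ R} → ZMod 2) =>
    σ (glue R b (complEquiv h p)) (glue R b' (complEquiv h p)))]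
  exact (complEquiv h).sum_comp (fun c => σ (glue R b c) (glue R b' c))

theorem traceNorm_reduced_union_le {A R : Finset Λ.Edge} (h : Disjoint A R) {σ τ : Λ.Op}
    (hσ : σ.IsHermitian) (hτ : τ.IsHermitian) :
    traceNorm (reduced σ R - reduced τ R) ≤
      traceNorm (reduced σ (A ∪ R) - reduced τ (A ∪ R)) := by
  rw [← partialTrace_reduced_union h, ← partialTrace_reduced_union h, ← partialTrace_sub]
  exact traceNorm_partialTrace_le _ ((reduced_isHermitian hσ _).sub (reduced_isHermitian hτ _))

theorem vonNeumannEntropy_reduced_of_eq_univ {σ : Λ.Op} (hσ : σ.IsHermitian)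
    {S : Finset Λ.Edge} (hS : S = Finset.univ) :
    vonNeumannEntropy (reduced σ S) = vonNeumannEntropy σ := by
  have hc : ∀ e, e ∈ S := fun e => hS ▸ Finset.mem_univ e
  let φ : (S → ZMod 2) ≃ Λ.Config :=
    { toFun := fun a e => a ⟨e, hc e⟩
      invFun := fun s e => s e
      left_inv := fun a => rfl
      right_inv := fun s => rfl }
  rw [← vonNeumannEntropy_submatrix_equiv hσ φ]
  congr 1
  ext a b
  have : IsEmpty {e // e ∉ S} := ⟨fun e => e.2 (hc e)⟩
  have h1 : ∀ (a : S → ZMod 2) (c : {e // e ∉ S} → ZMod 2), glue S a c = φ a := by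
    intro a c; ext e; simp [glue, hc e, φ]
  simp [reduced, h1]

/-- The weight of an event in a region is determined by the reduced state. -/
theorem sum_reduced_diag (σ : Λ.Op) (S : Finset Λ.Edge) (p : Λ.Config → Prop) [DecidablePred p]
    (q : (S → ZMod 2) → Prop) [DecidablePred q] (hpq : ∀ a c, p (glue S a c) ↔ q a) :
    ∑ s with p s, (σ s s).re = ∑ a with q a, (reduced σ S a a).re := by
  rw [Finset.sum_filter, Finset.sum_filter, ← (glueEquiv S).sum_comp, Fintype.sum_prod_type,
    Finset.sum_comm]
  refine Finset.sum_congr rfl fun a _ => ?_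
  simp only [glueEquiv, Equiv.coe_fn_mk, hpq, reduced, Matrix.of_apply, Complex.re_sum]
  split_ifs <;> simp

/-- The probability of an event in the region `S` is determined by the reduced state on `S` up to
the distance of the reduced states. -/
theorem abs_sum_diag_sub_le {σ ρ : Λ.Op} (hσ : σ.IsHermitian) (hρ : ρ.IsHermitian)
    (S : Finset Λ.Edge) (p : Λ.Config → Prop) [DecidablePred p]
    (hp : ∀ s t : Λ.Config, (∀ e ∈ S, s e = t e) → (p s ↔ p t)) :
    |∑ s with p s, (σ s s).re - ∑ s with p s, (ρ s s).re| ≤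
      traceNorm (reduced σ S - reduced ρ S) := by
  classical
  have h : ∀ a c, p (glue S a c) ↔ (fun a => p (glue S a 0)) a := fun a c =>
    hp _ _ fun e he => by simp [glue, he]
  rw [sum_reduced_diag σ S p _ h, sum_reduced_diag ρ S p _ h, ← Finset.sum_sub_distrib]
  refine (Finset.abs_sum_le_sum_abs _ _).trans ?_
  refine (Finset.sum_le_sum_of_subset_of_nonneg (Finset.filter_subset _ _)
    fun _ _ _ => abs_nonneg _).trans ?_
  refine le_trans (le_of_eq ?_) (sum_abs_re_diag_le_traceNorm
    ((reduced_isHermitian hσ S).sub (reduced_isHermitian hρ S)))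
  simp

/-! ### Conditional entropies of loop ensembles -/

/-- No vertex with an edge in `A` has an odd number of occupied edges. -/
def LoopNear (A : Finset Λ.Edge) (s : Λ.Config) : Prop :=
  ∀ d, Λ.edge d ∈ A → ∑ d' with Λ.vert d' = Λ.vert d, s (Λ.edge d') = 0

theorem IsLoopConfig.loopNear {s : Λ.Config} (hs : Λ.IsLoopConfig s) (A : Finset Λ.Edge) :
    LoopNear A s := fun _ _ => hs _

/-- Extension of a configuration by zero. -/
def extend (A : Finset Λ.Edge) : (A → ZMod 2) →+ Λ.Config where
  toFun a := glue A a 0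
  map_zero' := by ext e; simp [glue]
  map_add' a b := by
    ext e
    by_cases h : e ∈ A <;> simp [glue, h]

theorem extend_apply_mem {A : Finset Λ.Edge} (a : A → ZMod 2) {e : Λ.Edge} (he : e ∈ A) :
    extend A a e = a ⟨e, he⟩ := by simp [extend, glue, he]

theorem extend_apply_notMem {A : Finset Λ.Edge} (a : A → ZMod 2) {e : Λ.Edge} (he : e ∉ A) :
    extend A a e = 0 := by simp [extend, glue, he]

theorem isLoopConfig_add {s t : Λ.Config} (hs : Λ.IsLoopConfig s) (ht : Λ.IsLoopConfig t) :
    Λ.IsLoopConfig (s + t) := fun v => by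
  simp only [Pi.add_apply, Finset.sum_add_distrib, hs v, ht v, add_zero]

theorem isLoopConfig_zero : Λ.IsLoopConfig (0 : Λ.Config) := fun v => by simp

/-- The loop configurations inside a region. -/
def cyclesIn (A : Finset Λ.Edge) : AddSubgroup (A → ZMod 2) where
  carrier := {a | Λ.IsLoopConfig (extend A a)}
  add_mem' ha hb := by
    rw [Set.mem_ofPred_eq, map_add]
    exact isLoopConfig_add ha hb
  zero_mem' := by
    rw [Set.mem_ofPred_eq, map_zero]
    exact isLoopConfig_zero
  neg_mem' {a} ha := by
    rw [Set.mem_ofPred_eq, map_neg]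
    intro v
    have := ha v
    simp only [Pi.neg_apply, Finset.sum_neg_distrib, this, neg_zero]

noncomputable instance (A : Finset Λ.Edge) : Fintype (cyclesIn A) := Fintype.ofFinite _

theorem LoopNear.add {A : Finset Λ.Edge} {s t : Λ.Config} (hs : LoopNear A s)
    (ht : LoopNear A t) : LoopNear A (s + t) := fun d hd => by
  simp only [Pi.add_apply, Finset.sum_add_distrib, hs d hd, ht d hd, add_zero]

/-- A configuration inside a region without end points is a loop configuration. -/
theorem isLoopConfig_extend_of_loopNear {A : Finset Λ.Edge} {a : A → ZMod 2}
    (h : LoopNear A (extend A a)) : Λ.IsLoopConfig (extend A a) := by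
  intro v
  by_cases hv : ∃ d, Λ.vert d = v ∧ Λ.edge d ∈ A
  · obtain ⟨d, rfl, hd⟩ := hv
    exact h d hd
  · refine Finset.sum_eq_zero fun d hd => extend_apply_notMem a fun hd' => hv ⟨d, ?_, hd'⟩
    simpa using hd

/-- Whether a configuration has end points near `A` is decided by the edges which meet `A`. -/
theorem LoopNear.congr {A S : Finset Λ.Edge}
    (hS : ∀ d d', Λ.edge d ∈ A → Λ.vert d = Λ.vert d' → Λ.edge d' ∈ S) {s t : Λ.Config}
    (h : ∀ e ∈ S, s e = t e) : LoopNear A s ↔ LoopNear A t := by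
  unfold LoopNear
  refine forall_congr' fun d => imp_congr_right fun hd => ?_
  rw [Finset.sum_congr rfl fun d' hd' => h _ (hS d d' hd (Finset.mem_filter.1 hd').2.symm)]

/-- A state of loops near `A` which is diagonal on `A` and invariant under the loop configurations
in `A` is, given the qubits in a region `R` around `A`, uniform on a coset of these
configurations. -/
theorem vonNeumannEntropy_reduced_union {A R : Finset Λ.Edge} (hAR : Disjoint A R)
    (hS : ∀ d d', Λ.edge d ∈ A → Λ.vert d = Λ.vert d' → Λ.edge d' ∈ A ∪ R) {ω : Λ.Op}
    (hω : ω.IsHermitian)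
    (hoff : ∀ s t, ω s t ≠ 0 → (∀ e ∈ A, s e = t e) ∧ LoopNear A s ∧ LoopNear A t)
    (hinv : ∀ z ∈ cyclesIn A, ∀ s t, ω (s + extend A z) (t + extend A z) = ω s t) :
    vonNeumannEntropy (reduced ω (A ∪ R)) = vonNeumannEntropy (reduced ω R) +
      ω.trace.re * Real.log (Fintype.card (cyclesIn A)) := by
  have hglue : ∀ (a : A → ZMod 2) (b : R → ZMod 2) (c : {e // e ∉ A ∪ R} → ZMod 2),
      ∀ e ∈ A ∪ R, glue (A ∪ R) (unionEquiv hAR (a, b)) c e =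
        glue (A ∪ R) (unionEquiv hAR (a, b)) 0 e := by
    intro a b c e he
    simp only [glue, dif_pos he]
  have hadd : ∀ (a a' : A → ZMod 2) (b : R → ZMod 2) (c : {e // e ∉ A ∪ R} → ZMod 2),
      glue (A ∪ R) (unionEquiv hAR (a + a', b)) c =
        glue (A ∪ R) (unionEquiv hAR (a, b)) c + extend A a' := by
    intro a a' b c
    ext e
    by_cases h1 : e ∈ A
    · rw [Pi.add_apply, extend_apply_mem a' h1]
      simp [glue, h1, unionEquiv]
    · rw [Pi.add_apply, extend_apply_notMem a' h1]
      simp [glue, h1, unionEquiv]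
  rw [← partialTrace_reduced_union hAR, ← trace_reduced ω (A ∪ R)]
  refine vonNeumannEntropy_eq_partialTrace_add (cyclesIn A) (unionEquiv hAR)
    (reduced_isHermitian hω _)
    (fun a b => LoopNear A (glue (A ∪ R) (unionEquiv hAR (a, b)) 0)) ?_ ?_ ?_
  · intro a a' b h
    have h1 := hadd a (a' - a) b 0
    rw [add_sub_cancel] at h1
    rw [h1]
    constructor
    · intro h2
      refine isLoopConfig_extend_of_loopNear ?_
      have h3 := h2.add h
      have h4 : glue (A ∪ R) (unionEquiv hAR (a, b)) 0 + extend A (a' - a) +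
          glue (A ∪ R) (unionEquiv hAR (a, b)) 0 = extend A (a' - a) := by
        ext e
        simp only [Pi.add_apply]
        linear_combination CharTwo.add_self_eq_zero (glue (A ∪ R) (unionEquiv hAR (a, b)) 0 e)
      rwa [h4] at h3
    · intro h2
      exact h.add (IsLoopConfig.loopNear h2 A)
  · intro a a' b b' h
    rw [reduced, Matrix.of_apply] at h
    obtain ⟨c, -, hc⟩ := Finset.exists_ne_zero_of_sum_ne_zero h
    obtain ⟨h1, h2, h3⟩ := hoff _ _ hc
    refine ⟨?_, (LoopNear.congr hS (hglue a b c)).1 h2, (LoopNear.congr hS (hglue a' b' c)).1 h3⟩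
    ext e
    have := h1 e e.2
    simpa [glue, unionEquiv] using this
  · intro a b b' z hz
    simp only [reduced, Matrix.of_apply, hadd, hinv z hz]

theorem IsMarkovPartition.vert_mem {A B : Finset Λ.Edge} (h : Λ.IsMarkovPartition A B)
    (d d' : Λ.Dart) (hd : Λ.edge d ∈ A) (hv : Λ.vert d = Λ.vert d') : Λ.edge d' ∈ A ∪ B := by
  by_contra h1
  exact h.2.2.2.2 _ hd _ (Finset.mem_compl.2 h1) ⟨d, d', rfl, rfl, Or.inl hv⟩

/-- The entropy of a loop ensemble inside a region, given the rest of the system. -/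
theorem vonNeumannEntropy_eq_reduced_compl_add {A : Finset Λ.Edge} {ω : Λ.Op}
    (hω : ω.IsHermitian)
    (hoff : ∀ s t, ω s t ≠ 0 → (∀ e ∈ A, s e = t e) ∧ LoopNear A s ∧ LoopNear A t)
    (hinv : ∀ z ∈ cyclesIn A, ∀ s t, ω (s + extend A z) (t + extend A z) = ω s t) :
    vonNeumannEntropy ω = vonNeumannEntropy (reduced ω Aᶜ) +
      ω.trace.re * Real.log (Fintype.card (cyclesIn A)) := by
  rw [← vonNeumannEntropy_reduced_union disjoint_compl_right (by simp) hω hoff hinv,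
    vonNeumannEntropy_reduced_of_eq_univ hω (by simp)]

/-- The entropy of the region `A` given `B`, and given the whole complement of `A`, is the trace
times the logarithm of the number of loop configurations in `A`, so that their difference vanishes.
-/
theorem cmi_eq_zero {A B : Finset Λ.Edge} (hAB : Λ.IsMarkovPartition A B) {ω : Λ.Op}
    (hω : ω.IsHermitian)
    (hoff : ∀ s t, ω s t ≠ 0 → (∀ e ∈ A, s e = t e) ∧ LoopNear A s ∧ LoopNear A t)
    (hinv : ∀ z ∈ cyclesIn A, ∀ s t, ω (s + extend A z) (t + extend A z) = ω s t) :
    cmi ω A B = 0 := by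
  rw [cmi, vonNeumannEntropy_reduced_union hAB.1 hAB.vert_mem hω hoff hinv,
    vonNeumannEntropy_eq_reduced_compl_add hω hoff hinv]
  ring

end CellulatedSurface

/-! ### Simplices -/

section Simplex

variable {E κ : Type*} [AddCommGroup E] [Module ℝ E] [Fintype κ]

theorem mem_convexHull_range_iff {v : κ → E} {x : E} :
    x ∈ convexHull ℝ (Set.range v) ↔
      ∃ c : κ → ℝ, (∀ i, 0 ≤ c i) ∧ ∑ i, c i = 1 ∧ x = ∑ i, c i • v i := by
  classical
  constructor
  · intro hx
    refine convexHull_min (t := {x | ∃ c : κ → ℝ, (∀ i, 0 ≤ c i) ∧ ∑ i, c i = 1 ∧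
      x = ∑ i, c i • v i}) ?_ ?_ hx
    · rintro _ ⟨i, rfl⟩
      refine ⟨Pi.single i 1, fun j => ?_, by simp, ?_⟩
      · by_cases h : j = i
        · subst h; simp
        · simp [h]
      · rw [Finset.sum_eq_single i (fun j _ hj => by simp [hj]) (by simp)]
        simp
    · rintro _ ⟨c, hc, hc1, rfl⟩ _ ⟨c', hc', hc1', rfl⟩ a b ha hb hab
      refine ⟨fun i => a * c i + b * c' i, fun i => ?_, ?_, ?_⟩
      · exact add_nonneg (mul_nonneg ha (hc i)) (mul_nonneg hb (hc' i))
      · rw [Finset.sum_add_distrib, ← Finset.mul_sum, ← Finset.mul_sum, hc1, hc1', mul_one, mul_one,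
          hab]
      · simp only [add_smul, Finset.sum_add_distrib, Finset.smul_sum, mul_smul]
  · rintro ⟨c, hc, hc1, rfl⟩
    exact (convex_convexHull ℝ _).sum_mem (fun i _ => hc i) hc1
      (fun i _ => subset_convexHull ℝ _ (Set.mem_range_self i))

/-- The vertices of a simplex are its extreme points. -/
theorem extremePoints_convexHull_range_eq {v : κ → E} (hv : LinearIndependent ℝ v) :
    (convexHull ℝ (Set.range v)).extremePoints ℝ = Set.range v := by
  classical
  refine Set.Subset.antisymm extremePoints_convexHull_subset ?_
  rintro _ ⟨p, rfl⟩
  rw [mem_extremePoints_iff_left]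
  refine ⟨subset_convexHull ℝ _ (Set.mem_range_self p), ?_⟩
  intro x hx y hy hxy
  obtain ⟨c, hc, hc1, rfl⟩ := mem_convexHull_range_iff.1 hx
  obtain ⟨c', hc', hc1', rfl⟩ := mem_convexHull_range_iff.1 hy
  obtain ⟨a, b, ha, hb, hab, h⟩ := hxy
  have h1 : ∀ i, i ≠ p → c i = 0 := by
    intro i hi
    have h2 : ∑ j, (a * c j + b * c' j - Pi.single (M := fun _ => ℝ) p 1 j) • v j = 0 := by
      simp only [sub_smul, add_smul, mul_smul, Finset.sum_sub_distrib, Finset.sum_add_distrib,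
        ← Finset.smul_sum]
      rw [h, Finset.sum_eq_single p (fun j _ hj => by simp [hj]) (by simp)]
      simp
    have h3 := (Fintype.linearIndependent_iff.1 hv _ h2) i
    rw [Pi.single_eq_of_ne hi, sub_zero] at h3
    have h4 := mul_nonneg ha.le (hc i)
    have h5 := mul_nonneg hb.le (hc' i)
    have h6 : a * c i = 0 := by linarith
    exact (mul_eq_zero.1 h6).resolve_left ha.ne'
  have h2 : c p = 1 := by
    rw [← hc1, Finset.sum_eq_single p (fun j _ hj => h1 j hj) (by simp)]
  rw [Finset.sum_eq_single p (fun j _ hj => by rw [h1 j hj, zero_smul]) (by simp), h2, one_smul]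

end Simplex

namespace CellulatedSurface

variable {Λ : CellulatedSurface} {ι : Type} [Fintype ι] {w : ι → Λ.Edge → ZMod 2}

/-! ### Loop sectors -/

theorem mem_loopSector {p : ι → ZMod 2} {s : Λ.Config} :
    s ∈ Λ.loopSector w p ↔ Λ.IsLoopConfig s ∧ ∀ i, pairing (w i) s = p i := by
  simp [loopSector]

theorem add_mem_loopSector {p q : ι → ZMod 2} {s t : Λ.Config} (hs : s ∈ Λ.loopSector w p)
    (ht : t ∈ Λ.loopSector w q) : s + t ∈ Λ.loopSector w (p + q) := by
  rw [mem_loopSector] at *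
  exact ⟨isLoopConfig_add hs.1 ht.1, fun i => by rw [pairing_add, hs.2, ht.2, Pi.add_apply]⟩

theorem add_add_cancel_right_config (s t : Λ.Config) : s + t + t = s := by
  ext e
  simp only [Pi.add_apply]
  linear_combination CharTwo.add_self_eq_zero (t e)

theorem add_mem_loopSector_iff {p q : ι → ZMod 2} {s t : Λ.Config}
    (ht : t ∈ Λ.loopSector w q) : s + t ∈ Λ.loopSector w (p + q) ↔ s ∈ Λ.loopSector w p := by
  refine ⟨fun h => ?_, fun h => add_mem_loopSector h ht⟩
  have := add_mem_loopSector h ht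
  rw [add_add_cancel_right_config] at this
  convert this using 2
  ext i
  simp only [Pi.add_apply]
  linear_combination -CharTwo.add_self_eq_zero (q i)

theorem add_mem_loopSector_iff_of_zero {p : ι → ZMod 2} {s t : Λ.Config}
    (ht : t ∈ Λ.loopSector w 0) : s + t ∈ Λ.loopSector w p ↔ s ∈ Λ.loopSector w p := by
  have := add_mem_loopSector_iff (p := p) (s := s) ht
  rwa [add_zero] at this

theorem eq_of_mem_loopSector {p q : ι → ZMod 2} {s : Λ.Config} (hp : s ∈ Λ.loopSector w p)
    (hq : s ∈ Λ.loopSector w q) : p = q := by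
  rw [mem_loopSector] at *
  exact funext fun i => (hp.2 i).symm.trans (hq.2 i)

theorem loopSector_nonempty (hw : Λ.IsIndependentHoles w) (p : ι → ZMod 2) :
    (Λ.loopSector w p).Nonempty := by
  obtain ⟨t, h1, h2, -⟩ := exists_isLoopConfig_off hw ∅ (fun x _ hx z _ => by
    have : x = 0 := funext fun e => hx e (Finset.notMem_empty e)
    simp [this, pairing]) p
  exact ⟨t, mem_loopSector.2 ⟨h1, h2⟩⟩

/-- All the sectors are cosets of the trivial one. -/
theorem card_loopSector (hw : Λ.IsIndependentHoles w) (p : ι → ZMod 2) :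
    (Λ.loopSector w p).card = (Λ.loopSector w 0).card := by
  obtain ⟨t, ht⟩ := loopSector_nonempty hw p
  refine (Finset.card_bij (fun s _ => s + t) (fun s hs => ?_) (fun s _ s' _ h => ?_)
    (fun s hs => ?_)).symm
  · have := add_mem_loopSector hs ht
    rwa [zero_add] at this
  · exact add_right_cancel h
  · refine ⟨s + t, ?_, add_add_cancel_right_config s t⟩
    have h0 : (0 : ι → ZMod 2) + p = p := zero_add p
    rw [← add_mem_loopSector_iff (p := 0) ht, add_add_cancel_right_config, h0]
    exact hs

theorem extend_mem_loopSector (hw : Λ.IsIndependentHoles w) {A : Finset Λ.Edge}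
    (hA : Λ.IsSimplyConnected A) {z : A → ZMod 2} (hz : z ∈ cyclesIn A) :
    extend A z ∈ Λ.loopSector w 0 :=
  mem_loopSector.2 ⟨hz, fun i => hA.pairing_eq_zero_of_isLoopConfig (hw.1 i) hz
    fun _ he => extend_apply_notMem z he⟩

theorem loopState_apply (p : ι → ZMod 2) (s t : Λ.Config) :
    Λ.loopState w p s t =
      if s = t ∧ s ∈ Λ.loopSector w p then ((Λ.loopSector w p).card : ℂ)⁻¹ else 0 := by
  rw [loopState, Matrix.smul_apply, Matrix.sum_apply]
  simp only [Matrix.single_apply]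
  by_cases h : s = t ∧ s ∈ Λ.loopSector w p
  · obtain ⟨rfl, h⟩ := h
    rw [Finset.sum_eq_single_of_mem s h (fun b _ hb => by simp [hb])]
    simp [h]
  · rw [if_neg h, Finset.sum_eq_zero, smul_zero]
    intro b hb
    rw [if_neg]
    rintro ⟨rfl, rfl⟩
    exact h ⟨rfl, hb⟩

theorem loopState_eq_diagonal (p : ι → ZMod 2) :
    Λ.loopState w p = Matrix.diagonal fun s =>
      (((if s ∈ Λ.loopSector w p then ((Λ.loopSector w p).card : ℝ)⁻¹ else 0 : ℝ)) : ℂ) := by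
  ext s t
  rw [loopState_apply, Matrix.diagonal_apply]
  by_cases h1 : s = t
  · subst h1
    by_cases h2 : s ∈ Λ.loopSector w p <;> simp [h2]
  · simp [h1]

theorem isDensityMatrix_loopState (hw : Λ.IsIndependentHoles w) (p : ι → ZMod 2) :
    IsDensityMatrix (Λ.loopState w p) := by
  have hc : ((Λ.loopSector w p).card : ℝ) ≠ 0 := by
    exact_mod_cast (Finset.card_pos.2 (loopSector_nonempty hw p)).ne'
  rw [loopState_eq_diagonal]
  constructor
  · refine Matrix.PosSemidef.diagonal fun s => ?_
    change (0 : ℂ) ≤ _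
    rw [Complex.zero_le_real]
    split_ifs <;> positivity
  · rw [Matrix.trace_diagonal, ← Complex.ofReal_sum, ← Finset.sum_filter, Finset.filter_univ_mem,
      Finset.sum_const, nsmul_eq_mul, mul_inv_cancel₀ hc, Complex.ofReal_one]

/-- Two loop ensembles are exchanged by a loop configuration which avoids any given simply
connected region. -/
theorem reduced_loopState_eq (hw : Λ.IsIndependentHoles w) (p q : ι → ZMod 2)
    {A : Finset Λ.Edge} (hA : Λ.IsSimplyConnected A) :
    reduced (Λ.loopState w p) A = reduced (Λ.loopState w q) A := by
  obtain ⟨t, h1, h2, h3⟩ := exists_isLoopConfig_off hw A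
    (fun x hx hxA z hz => hA.pairing_eq_zero_of_isDualCycle hx hz hxA) (q - p)
  have ht : t ∈ Λ.loopSector w (q - p) := mem_loopSector.2 ⟨h1, h2⟩
  ext a b
  simp only [reduced, Matrix.of_apply]
  rw [← Equiv.sum_comp (Equiv.addRight (fun e : {e // e ∉ A} => t e))
    (fun c => Λ.loopState w q (glue A a c) (glue A b c))]
  have hg : ∀ (a : A → ZMod 2) c, glue A a (c + fun e : {e // e ∉ A} => t e) =
      glue A a c + t := by
    intro a c
    ext e
    by_cases he : e ∈ A
    · simp [glue, he, h3 e he]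
    · simp [glue, he]
  refine Finset.sum_congr rfl fun c _ => ?_
  rw [Equiv.coe_addRight, hg, hg, loopState_apply, loopState_apply, card_loopSector hw p,
    card_loopSector hw q]
  have h4 := add_mem_loopSector_iff (p := p) (s := glue A a c) ht
  rw [add_sub_cancel] at h4
  simp only [add_left_inj, h4]

/-! ### The simplex of loop ensembles -/

/-- The loop ensembles are at maximal distance: the trace norm is the `ℓ¹`-norm of the coefficients.
-/
theorem traceNorm_sum_smul_loopState [DecidableEq ι] (hw : Λ.IsIndependentHoles w)
    (c : (ι → ZMod 2) → ℝ) :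
    traceNorm (∑ p, c p • Λ.loopState w p) = ∑ p, |c p| := by
  classical
  have h1 : ∑ p, c p • Λ.loopState w p = Matrix.diagonal fun s => ((∑ p,
      if s ∈ Λ.loopSector w p then c p * ((Λ.loopSector w 0).card : ℝ)⁻¹ else 0 : ℝ) : ℂ) := by
    ext s t
    rw [Matrix.sum_apply, Matrix.diagonal_apply]
    by_cases h : s = t
    · subst h
      rw [if_pos rfl]
      push_cast
      refine Finset.sum_congr rfl fun p _ => ?_
      rw [Matrix.smul_apply, loopState_apply, card_loopSector hw p]
      by_cases hs : s ∈ Λ.loopSector w p <;> simp [hs]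
    · rw [if_neg h]
      refine Finset.sum_eq_zero fun p _ => ?_
      rw [Matrix.smul_apply, loopState_apply, if_neg (fun h' => h h'.1), smul_zero]
  rw [h1, traceNorm_diagonal]
  have hc : ((Λ.loopSector w 0).card : ℝ) ≠ 0 := by
    exact_mod_cast (Finset.card_pos.2 (loopSector_nonempty hw 0)).ne'
  -- The ensembles have disjoint supports.
  have h2 : ∀ s, |∑ p, if s ∈ Λ.loopSector w p then c p * ((Λ.loopSector w 0).card : ℝ)⁻¹
      else 0| = ∑ p, if s ∈ Λ.loopSector w p then |c p| * ((Λ.loopSector w 0).card : ℝ)⁻¹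
      else 0 := by
    intro s
    by_cases h : ∃ p, s ∈ Λ.loopSector w p
    · obtain ⟨p, hp⟩ := h
      have h3 : ∀ q, q ≠ p → s ∉ Λ.loopSector w q :=
        fun q hq hs => hq (eq_of_mem_loopSector hs hp)
      rw [Finset.sum_eq_single p (fun q _ hq => by simp [h3 q hq]) (by simp),
        Finset.sum_eq_single p (fun q _ hq => by simp [h3 q hq]) (by simp), if_pos hp, if_pos hp,
        abs_mul, abs_of_nonneg (by positivity : (0 : ℝ) ≤ ((Λ.loopSector w 0).card : ℝ)⁻¹)]
    · push Not at h
      simp [h]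
  simp only [h2]
  rw [Finset.sum_comm]
  refine Finset.sum_congr rfl fun p _ => ?_
  rw [← Finset.sum_filter, Finset.filter_univ_mem, Finset.sum_const, card_loopSector hw p,
    nsmul_eq_mul]
  field_simp

theorem linearIndependent_loopState (hw : Λ.IsIndependentHoles w) :
    LinearIndependent ℝ fun p : ι → ZMod 2 => Λ.loopState w p := by
  classical
  rw [Fintype.linearIndependent_iff]
  intro c hc p
  have := traceNorm_sum_smul_loopState hw c
  rw [hc, traceNorm_zero] at this
  exact abs_eq_zero.1 ((Finset.sum_eq_zero_iff_of_nonneg fun _ _ => abs_nonneg _).1 this.symm p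
    (Finset.mem_univ _))

theorem ncard_extremePoints_convexHull_loopState (hw : Λ.IsIndependentHoles w) :
    ((convexHull ℝ (Set.range fun p : ι → ZMod 2 => Λ.loopState w p)).extremePoints ℝ).ncard =
      2 ^ Fintype.card ι := by
  classical
  rw [extremePoints_convexHull_range_eq (linearIndependent_loopState hw), ← Set.image_univ,
    Set.ncard_image_of_injective _ (linearIndependent_loopState hw).injective, Set.ncard_univ,
    Nat.card_eq_fintype_card]
  simp

/-- Mixtures of the loop ensembles: they are diagonal, supported on loop configurations, and
invariant under sums of boundaries. -/
theorem convexHull_loopState_properties (hw : Λ.IsIndependentHoles w) {σ : Λ.Op}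
    (hσ : σ ∈ convexHull ℝ (Set.range fun p : ι → ZMod 2 => Λ.loopState w p)) :
    IsDensityMatrix σ ∧ (∀ s t, σ s t ≠ 0 → s = t ∧ Λ.IsLoopConfig s) ∧
      (∀ z ∈ Λ.loopSector w 0, ∀ s t, σ (s + z) (t + z) = σ s t) ∧
      ∀ A, Λ.IsSimplyConnected A → reduced σ A = reduced (Λ.loopState w 0) A := by
  classical
  obtain ⟨c, hc, hc1, rfl⟩ := mem_convexHull_range_iff.1 hσ
  refine ⟨⟨?_, ?_⟩, ?_, ?_, ?_⟩
  · exact Matrix.posSemidef_sum _ fun p _ => (isDensityMatrix_loopState hw p).1.smul (hc p)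
  · rw [Matrix.trace_sum]
    simp only [Matrix.trace_smul, (isDensityMatrix_loopState hw _).2]
    rw [← Finset.sum_smul, hc1, one_smul]
  · intro s t h
    rw [Matrix.sum_apply] at h
    obtain ⟨p, -, hp⟩ := Finset.exists_ne_zero_of_sum_ne_zero h
    rw [Matrix.smul_apply, loopState_apply] at hp
    have := (ite_ne_right_iff.1 (right_ne_zero_of_smul hp)).1
    exact ⟨this.1, (mem_loopSector.1 this.2).1⟩
  · intro z hz s t
    rw [Matrix.sum_apply, Matrix.sum_apply]
    refine Finset.sum_congr rfl fun p _ => ?_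
    rw [Matrix.smul_apply, Matrix.smul_apply, loopState_apply, loopState_apply]
    simp only [add_left_inj, add_mem_loopSector_iff_of_zero hz]
  · intro A hA
    have h1 : reduced (∑ p, c p • Λ.loopState w p) A =
        ∑ p, c p • reduced (Λ.loopState w p) A := by
      ext a b
      simp only [reduced, Matrix.of_apply, Matrix.sum_apply, Matrix.smul_apply]
      rw [Finset.sum_comm]
      simp only [Finset.smul_sum]
    rw [h1, Finset.sum_congr rfl fun p _ => by rw [reduced_loopState_eq hw p 0 hA],
      ← Finset.sum_smul, hc1, one_smul]

theorem cmi_eq_zero_of_mem_convexHull (hw : Λ.IsIndependentHoles w) {σ : Λ.Op}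
    (hσ : σ ∈ convexHull ℝ (Set.range fun p : ι → ZMod 2 => Λ.loopState w p))
    {A B : Finset Λ.Edge} (hAB : Λ.IsMarkovPartition A B) : cmi σ A B = 0 := by
  obtain ⟨h1, h2, h3, -⟩ := convexHull_loopState_properties hw hσ
  refine cmi_eq_zero hAB h1.1.1 (fun s t h => ?_)
    (fun z hz => h3 _ (extend_mem_loopSector hw hAB.2.1 hz))
  obtain ⟨rfl, hs⟩ := h2 s t h
  exact ⟨fun _ _ => rfl, hs.loopNear A, hs.loopNear A⟩

/-! ### Stabilizer generators -/

/-- The sign `(-1) ^ a`. -/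
noncomputable def zsign (a : ZMod 2) : ℂ := (-1) ^ a.val

theorem zsign_zero : zsign 0 = 1 := by simp [zsign]

theorem zsign_one : zsign 1 = -1 := by simp [zsign, ZMod.val_one]

theorem zsign_add (a b : ZMod 2) : zsign (a + b) = zsign a * zsign b := by
  have h : ∀ a : ZMod 2, a = 0 ∨ a = 1 := by decide
  have h11 : (1 + 1 : ZMod 2) = 0 := by decide
  rcases h a with rfl | rfl <;> rcases h b with rfl | rfl <;> simp [zsign_zero, zsign_one, h11]

theorem zsign_eq_one_iff (a : ZMod 2) : zsign a = 1 ↔ a = 0 := by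
  have h : ∀ a : ZMod 2, a = 0 ∨ a = 1 := by decide
  rcases h a with rfl | rfl
  · simp [zsign_zero]
  · rw [zsign_one]
    norm_num

theorem zsign_sum {κ : Type*} (T : Finset κ) (f : κ → ZMod 2) :
    zsign (∑ i ∈ T, f i) = ∏ i ∈ T, zsign (f i) := by
  classical
  induction T using Finset.induction_on with
  | empty => simp [zsign_zero]
  | insert a T ha ih => rw [Finset.sum_insert ha, Finset.prod_insert ha, zsign_add, ih]

theorem zString_eq_diagonal (x : Λ.Edge → ZMod 2) :
    zString x = Matrix.diagonal fun s : Λ.Config => zsign (pairing x s) := by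
  ext s t
  have h : ∀ a : ZMod 2, a = 0 ∨ a = 1 := by decide
  rw [zString, pauliString, Matrix.of_apply, Matrix.diagonal_apply]
  have h1 : ∀ e, (if x e = 0 then PauliLabel.I else PauliLabel.Z).mat (s e) (t e) =
      if s e = t e then zsign (x e * s e) else 0 := by
    intro e
    rcases h (x e) with hx | hx
    · simp [hx, PauliLabel.mat, Matrix.one_apply, zsign_zero]
    · rcases h (s e) with hs | hs <;> simp [hx, PauliLabel.mat, hs, zsign_zero, zsign_one]
  simp only [h1]
  split_ifs with hst
  · subst hst
    simp [pairing, zsign_sum]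
  · obtain ⟨e, he⟩ := Function.ne_iff.1 hst
    exact Finset.prod_eq_zero (Finset.mem_univ e) (if_neg he)

theorem noncommProd_eq_diagonal {κ n : Type*} [Fintype n] [DecidableEq n] (T : Finset κ)
    (g : κ → Matrix n n ℂ) (f : κ → n → ℂ) (hgf : ∀ i, g i = Matrix.diagonal (f i))
    (comm : (T : Set κ).Pairwise (Function.onFun Commute g)) :
    T.noncommProd g comm = Matrix.diagonal fun s => ∏ i ∈ T, f i s := by
  classical
  induction T using Finset.induction_on with
  | empty => simp [Finset.noncommProd_empty]
  | insert a T ha ih =>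
    rw [Finset.noncommProd_insert_of_notMem _ _ _ _ ha, ih, hgf, Matrix.diagonal_mul_diagonal]
    congr 1
    ext s
    rw [Finset.prod_insert ha]

theorem loopGenerators_eq_diagonal (v₀ : Λ.Vertex) (p : ι → ZMod 2) (j : {v // v ≠ v₀} ⊕ ι) :
    Λ.loopGenerators v₀ w p j = Matrix.diagonal fun s : Λ.Config =>
      zsign (Sum.elim (fun _ => 0) p j + pairing (Sum.elim (fun v => Λ.star v.1) w j) s) := by
  rcases j with v | i
  · simp [loopGenerators, zString_eq_diagonal]
  · rw [loopGenerators, zString_eq_diagonal, ← Matrix.diagonal_smul]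
    congr 1
    ext s
    rw [Pi.smul_apply, Sum.elim_inr, Sum.elim_inr, zsign_add, smul_eq_mul]
    rfl

theorem isPauliOperator_loopGenerators (v₀ : Λ.Vertex) (p : ι → ZMod 2)
    (j : {v // v ≠ v₀} ⊕ ι) : IsPauliOperator (Λ.loopGenerators v₀ w p j) := by
  rcases j with v | i
  · exact ⟨_, Or.inl rfl⟩
  · refine ⟨fun e => if w i e = 0 then PauliLabel.I else PauliLabel.Z, ?_⟩
    have h : ∀ a : ZMod 2, a = 0 ∨ a = 1 := by decide
    rcases h (p i) with h | h
    · left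
      rw [loopGenerators, h]
      simp only [ZMod.val_zero, pow_zero, one_smul]
      rfl
    · right
      rw [loopGenerators, h]
      simp only [ZMod.val_one, pow_one, neg_smul, one_smul]
      rfl

/-- The product of the stars over all the vertices is trivial, so that one of them is redundant. -/
theorem isLoopConfig_of_ne {v₀ : Λ.Vertex} {s : Λ.Config}
    (h : ∀ v, v ≠ v₀ → pairing (Λ.star v) s = 0) : Λ.IsLoopConfig s := by
  rw [isLoopConfig_iff]
  intro v
  by_cases hv : v = v₀
  · subst hv
    have h1 := sum_smul_pairing (fun _ => 1) Λ.star s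
    simp only [one_smul, one_mul, Λ.sum_star_eq_zero] at h1
    rw [Finset.sum_eq_single v (fun b _ hb => h b hb) (by simp)] at h1
    rw [← h1]
    simp [pairing]
  · exact h v hv

/-- A loop ensemble is the normalized product of the projections onto the eigenvalue `1` of its
generators. -/
theorem isStabilizerState_loopState (hw : Λ.IsIndependentHoles w) (v₀ : Λ.Vertex)
    (p : ι → ZMod 2) :
    IsStabilizerState (Λ.loopState w p) (Λ.loopGenerators v₀ w p) := by
  classical
  set x : {v // v ≠ v₀} ⊕ ι → Λ.Edge → ZMod 2 := Sum.elim (fun v => Λ.star v.1) w with hx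
  set c : {v // v ≠ v₀} ⊕ ι → ZMod 2 := Sum.elim (fun _ => 0) p with hc
  have hg := loopGenerators_eq_diagonal (Λ := Λ) (w := w) v₀ p
  rw [← hx, ← hc] at hg
  refine ⟨isPauliOperator_loopGenerators v₀ p, isDensityMatrix_loopState hw p, fun i j => ?_,
    fun T hT h => ?_, ?_⟩
  · rw [hg, hg, Commute, SemiconjBy, Matrix.diagonal_mul_diagonal, Matrix.diagonal_mul_diagonal]
    simp only [mul_comm]
  -- A relation among the generators is a relation among the stars other than the one of `v₀` and
  -- the dual loops.
  · replace h := (noncommProd_eq_diagonal T _ _ hg _).symm.trans h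
    have h1 : ∀ s, ∑ j ∈ T, (c j + pairing (x j) s) = 0 := by
      intro s
      have := congrFun (congrFun h s) s
      rw [Matrix.diagonal_apply_eq, Matrix.one_apply_eq, ← zsign_sum, zsign_eq_one_iff] at this
      exact this
    have h2 : ∑ j ∈ T, c j = 0 := by
      have := h1 0
      simpa [pairing_zero] using this
    set k : {v // v ≠ v₀} ⊕ ι → ZMod 2 := fun j => if j ∈ T then 1 else 0 with hk
    have h3 : ∑ j, k j • x j = 0 := by
      ext e
      have := h1 (Pi.single e 1)
      rw [Finset.sum_add_distrib, h2, zero_add] at this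
      have h' : ∑ j ∈ T, x j e = 0 := by simpa [pairing, Pi.single_apply] using this
      rw [Finset.sum_apply, Pi.zero_apply, ← h', ← Finset.univ_inter T, ← Finset.sum_ite_mem]
      refine Finset.sum_congr rfl fun j _ => ?_
      simp only [hk]
      split_ifs <;> simp
    rw [Fintype.sum_sum_type] at h3
    set u : Λ.Vertex → ZMod 2 := fun v => if hv : v ≠ v₀ then k (Sum.inl ⟨v, hv⟩) else 0 with hu
    have h4 : ∑ v : {v // v ≠ v₀}, k (Sum.inl v) • x (Sum.inl v) = ∑ v, u v • Λ.star v := by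
      rw [← Finset.sum_subset (Finset.subset_univ (Finset.univ.filter (· ≠ v₀)))
        (fun v _ hv => by
          have : v = v₀ := by simpa using hv
          simp [hu, this]),
        Finset.sum_subtype (p := fun v => v ≠ v₀) (Finset.univ.filter (· ≠ v₀)) (by simp)]
      exact Finset.sum_congr rfl fun v _ => by simp only [hu, dif_pos v.2]; rfl
    rw [h4] at h3
    have h5 : (fun i => k (Sum.inr i)) = 0 := by
      refine hw.2 _ ⟨u, ?_⟩
      rw [zero_add]
      funext e
      exact (CharTwo.add_eq_zero.1 (congrFun h3 e)).symm
    have h6 : ∀ v, u v = 0 := by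
      intro v
      have h7 : ∑ i, k (Sum.inr i) • x (Sum.inr i) = 0 :=
        Finset.sum_eq_zero fun i _ => by
          have := congrFun h5 i
          simp only [Pi.zero_apply] at this
          rw [this, zero_smul]
      rw [h7, add_zero] at h3
      rw [Λ.eq_const_of_sum_smul_star_eq_zero h3 v v₀]
      simp [hu]
    obtain ⟨j, hj⟩ := hT
    have h8 : k j = 1 := by simp [hk, hj]
    rcases j with v | i
    · have := h6 v
      simp only [hu, dif_pos v.2] at this
      rw [h8] at this
      exact one_ne_zero this
    · have := congrFun h5 i
      simp only [h8, Pi.zero_apply] at this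
      exact one_ne_zero this
  · refine ⟨((Λ.loopSector w p).card : ℂ)⁻¹, ?_⟩
    refine Eq.trans ?_ (congrArg (((Λ.loopSector w p).card : ℂ)⁻¹ • ·)
      (noncommProd_eq_diagonal Finset.univ (fun j => (2⁻¹ : ℂ) • (1 + Λ.loopGenerators v₀ w p j))
      (fun j s => 2⁻¹ * (1 + zsign (c j + pairing (x j) s))) (fun j => by
        rw [hg, ← Matrix.diagonal_one, Matrix.diagonal_add, ← Matrix.diagonal_smul]
        rfl) _).symm)
    ext s t
    rw [loopState_apply, Matrix.smul_apply, Matrix.diagonal_apply]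
    by_cases hst : s = t
    · subst hst
      rw [if_pos rfl, smul_eq_mul]
      have hall : s ∈ Λ.loopSector w p ↔ ∀ j, c j + pairing (x j) s = 0 := by
        rw [mem_loopSector]
        constructor
        · rintro ⟨h1, h2⟩ (v | i)
          · simp [hc, hx, (Λ.isLoopConfig_iff s).1 h1]
          · simp only [hc, hx, Sum.elim_inr, h2]
            exact CharTwo.add_self_eq_zero _
        · intro h
          refine ⟨isLoopConfig_of_ne (v₀ := v₀) fun v hv => ?_, fun i => ?_⟩
          · simpa [hc, hx] using h (Sum.inl ⟨v, hv⟩)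
          · exact (CharTwo.add_eq_zero.1 (h (Sum.inr i))).symm
      by_cases hs : s ∈ Λ.loopSector w p
      · rw [if_pos ⟨rfl, hs⟩, Finset.prod_eq_one, mul_one]
        intro j _
        rw [hall.1 hs j, zsign_zero]
        norm_num
      · rw [if_neg (fun h => hs h.2)]
        rw [hall] at hs
        push Not at hs
        obtain ⟨j, hj⟩ := hs
        rw [Finset.prod_eq_zero (Finset.mem_univ j), mul_zero]
        have h : ∀ a : ZMod 2, a ≠ 0 → a = 1 := by decide
        rw [h _ hj, zsign_one]
        norm_num
    · rw [if_neg (fun h => hst h.1), if_neg hst, smul_zero]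

/-- Deformation of the dual loops across vertices changes neither their independence nor the loop
ensembles. -/
theorem IsIndependentHoles.of_homologous (hw : Λ.IsIndependentHoles w)
    {w' : ι → Λ.Edge → ZMod 2} (h : ∀ i, Homologous (w i) (w' i)) : Λ.IsIndependentHoles w' := by
  choose u hu using h
  refine ⟨fun i => ?_, fun a ha => ?_⟩
  · rw [hu i]
    exact (hw.1 i).add _ (Λ.isDualCycle_sum_smul_star _)
  · obtain ⟨u', hu'⟩ := ha
    refine hw.2 a ⟨fun v => u' v + ∑ i, a i * u i v, ?_⟩
    have h1 : ∑ i, a i • w' i = ∑ i, a i • w i + ∑ v, (∑ i, a i * u i v) • Λ.star v := by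
      simp only [hu, smul_add, Finset.sum_add_distrib, Finset.smul_sum, smul_smul, Finset.sum_smul]
      rw [Finset.sum_comm (s := Finset.univ (α := ι)) (t := Finset.univ (α := Λ.Vertex))]
    simp only [add_smul, Finset.sum_add_distrib]
    rw [zero_add] at hu' ⊢
    rw [← hu', h1]
    ext e
    simp only [Pi.add_apply]
    linear_combination
      -CharTwo.add_self_eq_zero ((∑ v, (∑ i, a i * u i v) • Λ.star v : Λ.Edge → ZMod 2) e)

theorem loopSector_eq_of_homologous {w' : ι → Λ.Edge → ZMod 2}
    (h : ∀ i, Homologous (w i) (w' i)) (p : ι → ZMod 2) :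
    Λ.loopSector w' p = Λ.loopSector w p := by
  ext s
  rw [mem_loopSector, mem_loopSector]
  refine and_congr_right fun hs => forall_congr' fun i => ?_
  obtain ⟨u, hu⟩ := h i
  rw [hu, add_pairing, sum_smul_pairing]
  simp [(Λ.isLoopConfig_iff s).1 hs]

theorem isStabilizerState_loopState_of_homologous (hw : Λ.IsIndependentHoles w)
    {w' : ι → Λ.Edge → ZMod 2} (h : ∀ i, Homologous (w i) (w' i)) (v₀ : Λ.Vertex)
    (p : ι → ZMod 2) :
    IsStabilizerState (Λ.loopState w p) (Λ.loopGenerators v₀ w' p) := by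
  have := isStabilizerState_loopState (hw.of_homologous h) v₀ p
  rwa [loopState, loopSector_eq_of_homologous h] at this

end CellulatedSurface

namespace CellulatedSurface

open Matrix

variable {Λ : CellulatedSurface} {ι : Type} [Fintype ι] [DecidableEq ι]
  {w : ι → Λ.Edge → ZMod 2}

/-! ### Conjugation with Pauli operators -/

/-- The Pauli operator `Z_x X_z`, up to a phase. -/
noncomputable def pauliZX (x z : Λ.Config) : Λ.Op :=
  Matrix.of fun s t => if t = s + z then zsign (pairing x s) else 0

theorem zsign_mul_self (a : ZMod 2) : zsign a * zsign a = 1 := by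
  rw [← zsign_add, CharTwo.add_self_eq_zero, zsign_zero]

theorem star_zsign (a : ZMod 2) : Star.star (zsign a) = zsign a := by
  rw [zsign, star_pow, star_neg, star_one]

theorem config_add_self (z : Λ.Config) : z + z = 0 := by
  ext e
  exact CharTwo.add_self_eq_zero _

theorem pauliZX_conj_apply (x z : Λ.Config) (σ : Λ.Op) (s t : Λ.Config) :
    (pauliZX x z * σ * (pauliZX x z)ᴴ) s t =
      zsign (pairing x s) * zsign (pairing x t) * σ (s + z) (t + z) := by
  have h1 : ∀ r, (pauliZX x z * σ) s r = zsign (pairing x s) * σ (s + z) r := by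
    intro r
    rw [Matrix.mul_apply, Finset.sum_eq_single (s + z)]
    · simp [pauliZX]
    · intro b _ hb; simp [pauliZX, hb]
    · simp
  rw [Matrix.mul_apply, Finset.sum_eq_single (t + z)]
  · rw [h1, conjTranspose_apply, pauliZX, Matrix.of_apply, if_pos rfl, star_zsign]
    ring
  · intro b _ hb; simp [pauliZX, hb]
  · simp

theorem pauliZX_conjTranspose_mul (x z : Λ.Config) : (pauliZX x z)ᴴ * pauliZX x z = 1 := by
  rw [mul_eq_one_comm]
  ext s t
  have := pauliZX_conj_apply x z 1 s t
  rw [Matrix.mul_one] at this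
  rw [this, Matrix.one_apply, Matrix.one_apply]
  by_cases h : s = t
  · subst h; simp [zsign_mul_self]
  · simp [h]

theorem pauliZX_zero : pauliZX (0 : Λ.Config) 0 = 1 := by
  ext s t
  rw [pauliZX, Matrix.of_apply, Matrix.one_apply]
  simp [pairing, zsign_zero, eq_comm]

theorem pauliZX_conj_conj (x z x' z' : Λ.Config) (σ : Λ.Op) :
    pauliZX x z * (pauliZX x' z' * σ * (pauliZX x' z')ᴴ) * (pauliZX x z)ᴴ =
      pauliZX (x + x') (z + z') * σ * (pauliZX (x + x') (z + z'))ᴴ := by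
  ext s t
  simp only [pauliZX_conj_apply, pairing_add, add_pairing, zsign_add, add_assoc]
  linear_combination (zsign (pairing x s) * zsign (pairing x t) * zsign (pairing x' s) *
    zsign (pairing x' t) * σ (s + (z + z')) (t + (z + z'))) * zsign_mul_self (pairing x' z)

theorem pauliZX_conj_isHermitian (x z : Λ.Config) {σ : Λ.Op} (hσ : σ.IsHermitian) :
    (pauliZX x z * σ * (pauliZX x z)ᴴ).IsHermitian := isHermitian_mul_mul_conjTranspose _ hσ

/-- The change of a state under the conjugation with a Pauli operator. -/
noncomputable def pauliDefect (σ : Λ.Op) (x z : Λ.Config) : ℝ :=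
  traceNorm (pauliZX x z * σ * (pauliZX x z)ᴴ - σ)

theorem pauliDefect_zero (σ : Λ.Op) : pauliDefect σ 0 0 = 0 := by
  rw [pauliDefect, pauliZX_zero]
  simp [traceNorm_zero]

theorem pauliDefect_add_le {σ : Λ.Op} (hσ : σ.IsHermitian) (x z x' z' : Λ.Config) :
    pauliDefect σ (x + x') (z + z') ≤ pauliDefect σ x z + pauliDefect σ x' z' := by
  have h1 := pauliZX_conj_isHermitian x' z' hσ
  rw [pauliDefect, ← pauliZX_conj_conj]
  refine (traceNorm_sub_le (pauliZX_conj_isHermitian x z h1)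
    (pauliZX_conj_isHermitian x z hσ) hσ).trans ?_
  rw [← Matrix.sub_mul, ← Matrix.mul_sub,
    traceNorm_conj (h1.sub hσ) (pauliZX_conjTranspose_mul x z)]
  rw [add_comm]
  rfl

/-- The defects of products of Pauli operators are bounded by the sums of the defects. -/
theorem pauliDefect_sum_le {σ : Λ.Op} (hσ : σ.IsHermitian) {κ : Type*} (T : Finset κ)
    (u : κ → ZMod 2) (x z : κ → Λ.Config) {b : ℝ} (hb : 0 ≤ b)
    (h : ∀ i ∈ T, pauliDefect σ (x i) (z i) ≤ b) :
    pauliDefect σ (∑ i ∈ T, u i • x i) (∑ i ∈ T, u i • z i) ≤ T.card * b := by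
  classical
  induction T using Finset.induction_on with
  | empty => simp [pauliDefect_zero]
  | insert a T ha ih =>
    rw [Finset.sum_insert ha, Finset.sum_insert ha, Finset.card_insert_of_notMem ha]
    refine (pauliDefect_add_le hσ _ _ _ _).trans ?_
    have h1 : pauliDefect σ (u a • x a) (u a • z a) ≤ b := by
      have h2 : ∀ c : ZMod 2, c = 0 ∨ c = 1 := by decide
      rcases h2 (u a) with h3 | h3
      · simp [h3, pauliDefect_zero, hb]
      · simpa [h3] using h a (Finset.mem_insert_self _ _)
    have h2 := ih fun i hi => h i (Finset.mem_insert_of_mem hi)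
    push_cast
    linarith

/-! ### Approximate Markov states with the local properties of a loop ensemble -/

theorem restrict_posSemidef {n : Type*} [Fintype n] [DecidableEq n] {σ : Matrix n n ℂ}
    (hσ : σ.PosSemidef) (p : n → Prop) [DecidablePred p] :
    (Matrix.of fun s t => if p s ∧ p t then σ s t else 0).PosSemidef := by
  have h : (Matrix.of fun s t => if p s ∧ p t then σ s t else 0) =
      diagonal (fun s => if p s then (1 : ℂ) else 0) * σ *
        (diagonal fun s => if p s then (1 : ℂ) else 0)ᴴ := by
    ext s t
    rw [diagonal_conjTranspose, Matrix.mul_diagonal, Matrix.diagonal_mul, Matrix.of_apply,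
      Pi.star_apply]
    by_cases h1 : p s <;> by_cases h2 : p t <;> simp [h1, h2]
  rw [h]
  exact hσ.mul_mul_conjTranspose_same _

theorem trace_restrict_le {n : Type*} [Fintype n] [DecidableEq n] {σ : Matrix n n ℂ}
    (hσ : σ.PosSemidef) (p : n → Prop) [DecidablePred p] :
    (Matrix.of fun s t => if p s ∧ p t then σ s t else 0).trace.re ≤ σ.trace.re := by
  rw [Matrix.trace, Matrix.trace, Complex.re_sum, Complex.re_sum]
  refine Finset.sum_le_sum fun s _ => ?_
  rw [Matrix.diag_apply, Matrix.diag_apply, Matrix.of_apply]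
  have : 0 ≤ (σ s s).re := (Complex.le_def.1 hσ.diag_nonneg).1
  split_ifs
  · exact le_rfl
  · simpa using this

/-- The average of a state over the Pauli operators `Z` on the qubits of a region and the loop
operators `X` inside it. -/
noncomputable def loopTwirl (A : Finset Λ.Edge) (σ : Λ.Op) : Λ.Op :=
  ((Fintype.card ((A → ZMod 2) × cyclesIn A) : ℂ))⁻¹ • ∑ i : (A → ZMod 2) × cyclesIn A,
    pauliZX (extend A i.1) (extend A i.2) * σ * (pauliZX (extend A i.1) (extend A i.2))ᴴ

theorem card_smul_loopTwirl (A : Finset Λ.Edge) (σ : Λ.Op) :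
    (Fintype.card ((A → ZMod 2) × cyclesIn A) : ℂ) • loopTwirl A σ =
      ∑ i : (A → ZMod 2) × cyclesIn A,
        pauliZX (extend A i.1) (extend A i.2) * σ * (pauliZX (extend A i.1) (extend A i.2))ᴴ := by
  have hc : (Fintype.card ((A → ZMod 2) × cyclesIn A) : ℂ) ≠ 0 :=
    Nat.cast_ne_zero.2 Fintype.card_ne_zero
  unfold loopTwirl
  exact smul_inv_smul₀ hc _

theorem pauliZX_conj_loopTwirl (A : Finset Λ.Edge) (σ : Λ.Op) (i : (A → ZMod 2) × cyclesIn A) :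
    pauliZX (extend A i.1) (extend A i.2) * loopTwirl A σ *
      (pauliZX (extend A i.1) (extend A i.2))ᴴ = loopTwirl A σ := by
  have h1 : pauliZX (extend A i.1) (extend A i.2) *
      (∑ j : (A → ZMod 2) × cyclesIn A,
        pauliZX (extend A j.1) (extend A j.2) * σ * (pauliZX (extend A j.1) (extend A j.2))ᴴ) *
      (pauliZX (extend A i.1) (extend A i.2))ᴴ = ∑ j : (A → ZMod 2) × cyclesIn A,
        pauliZX (extend A j.1) (extend A j.2) * σ * (pauliZX (extend A j.1) (extend A j.2))ᴴ := by
    rw [Matrix.mul_sum, Matrix.sum_mul]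
    refine Fintype.sum_equiv (Equiv.addLeft i) _ _ fun j => ?_
    rw [pauliZX_conj_conj, Equiv.coe_addLeft, Prod.fst_add, Prod.snd_add, AddSubgroup.coe_add,
      map_add, map_add]
  have h2 : ∀ (c : ℂ) (g M : Λ.Op), g * (c • M) * gᴴ = c • (g * M * gᴴ) := fun c g M => by
    rw [Matrix.mul_smul, Matrix.smul_mul]
  unfold loopTwirl
  rw [h2]
  rw [h1]

theorem loopTwirl_isHermitian (A : Finset Λ.Edge) {σ : Λ.Op} (hσ : σ.IsHermitian) :
    (loopTwirl A σ).IsHermitian := by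
  have h : ∀ (n : ℕ) (M : Λ.Op), M.IsHermitian → ((n : ℂ)⁻¹ • M).IsHermitian := fun n M hM => by
    rw [Matrix.IsHermitian, conjTranspose_smul, hM.eq, star_inv₀, star_natCast]
  refine h _ _ ?_
  rw [Matrix.IsHermitian, conjTranspose_sum]
  exact Finset.sum_congr rfl fun i _ => pauliZX_conj_isHermitian _ _ hσ

theorem trace_loopTwirl (A : Finset Λ.Edge) (σ : Λ.Op) : (loopTwirl A σ).trace = σ.trace := by
  rw [loopTwirl, Matrix.trace_smul, Matrix.trace_sum]
  have h2 : ∀ x z : Λ.Config, (pauliZX x z * σ * (pauliZX x z)ᴴ).trace = σ.trace := fun x z => by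
    rw [Matrix.trace_mul_comm, ← Matrix.mul_assoc, pauliZX_conjTranspose_mul, Matrix.one_mul]
  simp only [h2, Finset.sum_const, Finset.card_univ, nsmul_eq_mul, smul_eq_mul]
  exact inv_mul_cancel_left₀ (Nat.cast_ne_zero.2 Fintype.card_ne_zero) _

theorem reduced_compl_pauliZX_conj {A : Finset Λ.Edge} (σ : Λ.Op) (x z : A → ZMod 2) :
    reduced (pauliZX (extend A x) (extend A z) * σ * (pauliZX (extend A x) (extend A z))ᴴ) Aᶜ =
      reduced σ Aᶜ := by
  ext b b'
  simp only [reduced, Matrix.of_apply, pauliZX_conj_apply]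
  rw [← Equiv.sum_comp (Equiv.addRight fun e : {e // e ∉ Aᶜ} => extend A z e)
    (fun c => σ (glue Aᶜ b c) (glue Aᶜ b' c))]
  refine Finset.sum_congr rfl fun c _ => ?_
  have h1 : ∀ b : ↥Aᶜ → ZMod 2, glue Aᶜ b c + extend A z =
      glue Aᶜ b (c + fun e : {e // e ∉ Aᶜ} => extend A z e) := by
    intro b
    ext e
    by_cases he : e ∈ A
    · simp [glue, he]
    · rw [Pi.add_apply, extend_apply_notMem z he]
      simp [glue, he]
  have h2 : pairing (extend A x) (glue Aᶜ b c) = pairing (extend A x) (glue Aᶜ b' c) := by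
    refine Finset.sum_congr rfl fun e _ => ?_
    by_cases he : e ∈ A
    · simp [glue, he]
    · rw [extend_apply_notMem x he, zero_mul, zero_mul]
  rw [h1, h1, h2, zsign_mul_self, one_mul]
  rfl

/-- The averaging acts on `A` only. -/
theorem reduced_compl_loopTwirl (A : Finset Λ.Edge) (σ : Λ.Op) :
    reduced (loopTwirl A σ) Aᶜ = reduced σ Aᶜ := by
  have h1 : ∀ {κ : Type} [Fintype κ] (c : ℂ) (f : κ → Λ.Op),
      reduced (c • ∑ i, f i) Aᶜ = c • ∑ i, reduced (f i) Aᶜ := by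
    intro κ _ c f
    ext a b
    simp only [reduced, Matrix.of_apply, Matrix.smul_apply, Matrix.sum_apply, Finset.smul_sum]
    exact Finset.sum_comm
  rw [loopTwirl, h1]
  simp only [reduced_compl_pauliZX_conj, Finset.sum_const, Finset.card_univ]
  rw [← Nat.cast_smul_eq_nsmul ℂ]
  exact inv_smul_smul₀ (Nat.cast_ne_zero.2 Fintype.card_ne_zero) _

/-- The averaged state is diagonal on the region. -/
theorem loopTwirl_apply_ne_zero {A : Finset Λ.Edge} {σ : Λ.Op} {s t : Λ.Config}
    (h : loopTwirl A σ s t ≠ 0) : ∀ e ∈ A, s e = t e := by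
  intro e he
  have h1 := congrFun (congrFun (pauliZX_conj_loopTwirl A σ (Pi.single ⟨e, he⟩ 1, 0)) s) t
  have h2 : ∀ s, pairing (extend A (Pi.single (⟨e, he⟩ : A) 1)) s = s e := by
    intro s
    rw [pairing, Finset.sum_eq_single e]
    · rw [extend_apply_mem _ he, Pi.single_eq_same, one_mul]
    · intro e' _ hne
      by_cases he' : e' ∈ A
      · rw [extend_apply_mem _ he', Pi.single_eq_of_ne (by simpa using hne), zero_mul]
      · rw [extend_apply_notMem _ he', zero_mul]
    · simp
  simp only [pauliZX_conj_apply, h2, AddSubgroup.coe_zero, map_zero, add_zero] at h1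
  rw [← zsign_add] at h1
  have h3 := mul_right_cancel₀ h (h1.trans (one_mul _).symm)
  exact CharTwo.add_eq_zero.1 ((zsign_eq_one_iff _).1 h3)

/-- The averaged state is invariant under the loop configurations in the region. -/
theorem loopTwirl_add_extend {A : Finset Λ.Edge} (σ : Λ.Op) {z : A → ZMod 2}
    (hz : z ∈ cyclesIn A) (s t : Λ.Config) :
    loopTwirl A σ (s + extend A z) (t + extend A z) = loopTwirl A σ s t := by
  have h1 := congrFun (congrFun (pauliZX_conj_loopTwirl A σ (0, ⟨z, hz⟩)) s) t
  simpa [pauliZX_conj_apply, pairing, zsign_zero] using h1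

/-- The entropy of the averaged state is determined by the reduced state outside of the region: the
region contributes the logarithm of the number of its loop configurations. -/
theorem vonNeumannEntropy_loopTwirl {A : Finset Λ.Edge} {σ : Λ.Op} (hσ : σ.IsHermitian)
    (h : ∀ s t, σ s t ≠ 0 → LoopNear A s ∧ LoopNear A t) :
    vonNeumannEntropy (loopTwirl A σ) = vonNeumannEntropy (reduced σ Aᶜ) +
      σ.trace.re * Real.log (Fintype.card (cyclesIn A)) := by
  rw [← reduced_compl_loopTwirl A σ, ← trace_loopTwirl A σ]
  refine vonNeumannEntropy_eq_reduced_compl_add (loopTwirl_isHermitian A hσ)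
    (fun s t hst => ⟨loopTwirl_apply_ne_zero hst, ?_⟩)
    (fun z hz s t => loopTwirl_add_extend σ hz s t)
  obtain ⟨i, hi⟩ : ∃ i : (A → ZMod 2) × cyclesIn A, (pauliZX (extend A i.1) (extend A i.2) * σ *
      (pauliZX (extend A i.1) (extend A i.2))ᴴ) s t ≠ 0 := by
    by_contra! h0
    refine hst ?_
    have h1 : (∑ i : (A → ZMod 2) × cyclesIn A, pauliZX (extend A i.1) (extend A i.2) * σ *
      (pauliZX (extend A i.1) (extend A i.2))ᴴ) s t = 0 := by
      rw [Matrix.sum_apply]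
      exact Finset.sum_eq_zero fun i _ => h0 i
    rw [← card_smul_loopTwirl, Matrix.smul_apply, smul_eq_mul] at h1
    exact (mul_eq_zero.1 h1).resolve_left (Nat.cast_ne_zero.2 Fintype.card_ne_zero)
  rw [pauliZX_conj_apply] at hi
  have h1 := h _ _ (right_ne_zero_of_mul hi)
  have h3 : LoopNear A (extend A i.2.1) := IsLoopConfig.loopNear i.2.2 A
  have h4 := h1.1.add h3
  have h5 := h1.2.add h3
  rw [add_assoc, config_add_self, add_zero] at h4 h5
  exact ⟨h4, h5⟩

theorem log_card_config_div_le (S : Finset Λ.Edge) {η : ℝ} (hη : 0 < η) :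
    Real.log (Fintype.card (S → ZMod 2) / η) ≤
      Real.log (2 ^ Fintype.card Λ.Edge / η) := by
  have h1 : Fintype.card (S → ZMod 2) = 2 ^ S.card := by simp [ZMod.card]
  rw [h1]
  push_cast
  have h2 : (2 : ℝ) ^ S.card ≤ 2 ^ Fintype.card Λ.Edge :=
    pow_le_pow_right₀ (by norm_num) (Finset.card_le_univ S)
  exact Real.log_le_log (by positivity) (by gcongr)

/-- The modulus of continuity of the entropy of the qubits of `Λ` for states at distance `T`, with a
free parameter `η` which keeps the logarithm finite. -/
noncomputable def entropyModulus (Λ : CellulatedSurface) (T η : ℝ) : ℝ :=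
  T * (Real.log (2 ^ Fintype.card Λ.Edge / η) + 1) + η

theorem log_card_div_nonneg {η : ℝ} (hη : 0 < η) (hη1 : η ≤ 1 / 2) :
    0 ≤ Real.log (2 ^ Fintype.card Λ.Edge / η) := by
  refine Real.log_nonneg ?_
  rw [le_div_iff₀ hη]
  have : (1 : ℝ) ≤ 2 ^ Fintype.card Λ.Edge := one_le_pow₀ (by norm_num)
  linarith

/-- Continuity of the entropy of a region, with a modulus which does not depend on the region. -/
theorem vonNeumannEntropy_reduced_le (S : Finset Λ.Edge) {σ τ : Λ.Op} (hσ : σ.PosSemidef)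
    (hτ : τ.PosSemidef) (hτ1 : τ.trace.re ≤ 1) {η T : ℝ} (hη : 0 < η) (hη1 : η ≤ 1 / 2)
    (hT : traceNorm (reduced σ S - reduced τ S) ≤ T) :
    vonNeumannEntropy (reduced σ S) ≤ vonNeumannEntropy (reduced τ S) +
      entropyModulus Λ T η := by
  refine (vonNeumannEntropy_le_add (reduced_posSemidef hσ S) (reduced_posSemidef hτ S)
    (by rwa [trace_reduced]) hη hη1).trans ?_
  have h1 := log_card_config_div_le S hη
  have h2 := log_card_div_nonneg (Λ := Λ) hη hη1
  have h3 := traceNorm_nonneg (reduced σ S - reduced τ S)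
  have h4 := mul_le_mul_of_nonneg_left (add_le_add_left h1 1) h3
  have h5 := mul_le_mul_of_nonneg_right hT (add_nonneg h2 zero_le_one)
  rw [entropyModulus]
  linarith

theorem sqrt_four_mul (a : ℝ) : √(4 * a) = 2 * √a := by
  rw [Real.sqrt_mul (by norm_num), show √(4 : ℝ) = 2 by
    rw [show (4 : ℝ) = 2 ^ 2 by norm_num, Real.sqrt_sq (by norm_num)]]

/-- If the reduced state of `σ` on `A ∪ B` is close to the one of a loop ensemble, and the
conditional mutual information is small, then `σ` is almost invariant under the Pauli operators `Z`
and the loop operators `X` in `A`. In fact, the averaged state has, up to continuity errors, the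
entropy that `σ` would have if the conditional mutual information vanished. -/
theorem pauliDefect_le (hw : Λ.IsIndependentHoles w) {A B : Finset Λ.Edge}
    (hAB : Λ.IsMarkovPartition A B) {σ : Λ.Op} (hσ : IsDensityMatrix σ) {ε δ η : ℝ}
    (hη : 0 < η) (hη1 : η ≤ 1 / 2)
    (hε : traceNorm (reduced σ (A ∪ B) - reduced (Λ.loopState w 0) (A ∪ B)) ≤ ε)
    (hδ : cmi σ A B ≤ δ) (x z : A → ZMod 2) (hz : z ∈ cyclesIn A) :
    pauliDefect σ (extend A x) (extend A z) ≤
      4 * √ε + 4 * √(δ + 4 * entropyModulus Λ (ε + 2 * √ε) η) := by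
  classical
  set ρ := Λ.loopState w 0 with hρdef
  have hρ : IsDensityMatrix ρ := isDensityMatrix_loopState hw 0
  have hρc : ρ ∈ convexHull ℝ (Set.range fun p : ι → ZMod 2 => Λ.loopState w p) :=
    subset_convexHull ℝ _ ⟨0, rfl⟩
  obtain ⟨-, hρ1, hρ2, -⟩ := convexHull_loopState_properties hw hρc
  have hε0 : 0 ≤ ε := (traceNorm_nonneg _).trans hε
  have hσ1 : σ.trace.re = 1 := by rw [hσ.2]; rfl
  have hρtr : ρ.trace.re = 1 := by rw [hρ.2]; rfl
  -- The projection onto configurations without end points near `A`.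
  set σ' : Λ.Op := Matrix.of fun s t => if LoopNear A s ∧ LoopNear A t then σ s t else 0 with hσ'
  have hσ'p : σ'.PosSemidef := restrict_posSemidef hσ.1 _
  have hσ'1 : σ'.trace.re ≤ 1 := hσ1 ▸ trace_restrict_le hσ.1 _
  have hclose : traceNorm (σ - σ') ≤ 2 * √ε := by
    refine (traceNorm_sub_restrict_le hσ.1 hσ1.le (LoopNear A)).trans ?_
    gcongr
    have h1 := abs_sum_diag_sub_le hσ.1.1 hρ.1.1 (A ∪ B) (fun s => ¬ LoopNear A s)
      (fun s t hst => not_congr (LoopNear.congr hAB.vert_mem hst))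
    have h2 : ∑ s with ¬ LoopNear A s, (ρ s s).re = 0 := by
      refine Finset.sum_eq_zero fun s hs => ?_
      by_contra h3
      refine (Finset.mem_filter.1 hs).2 ((hρ1 s s fun h4 => h3 ?_).2.loopNear A)
      rw [h4, Complex.zero_re]
    rw [h2, sub_zero] at h1
    exact (le_abs_self _).trans (h1.trans hε)
  have hpin := traceNorm_sub_twirl_sq_le hσ'p hσ'1
    (fun i : (A → ZMod 2) × cyclesIn A => pauliZX (extend A i.1) (extend A i.2))
    (fun i => pauliZX_conjTranspose_mul _ _) (card_smul_loopTwirl A σ')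
    (pauliZX_conj_loopTwirl A σ') 0 (by simp [pauliZX_zero])
  have hgτ := pauliZX_conj_loopTwirl A σ' (x, ⟨z, hz⟩)
  have hτH := loopTwirl_isHermitian A hσ'p.1
  have hSτ := vonNeumannEntropy_loopTwirl (A := A) hσ'p.1 (fun s t h => by
    rw [hσ', Matrix.of_apply] at h
    exact (ite_ne_right_iff.1 h).1)
  generalize loopTwirl A σ' = τ at hpin hgτ hτH hSτ
  -- The entropies of the averaged state and of the loop ensemble.
  have hSρ : vonNeumannEntropy (reduced ρ (A ∪ B)) = vonNeumannEntropy (reduced ρ B) +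
      ρ.trace.re * Real.log (Fintype.card (cyclesIn A)) := by
    refine vonNeumannEntropy_reduced_union hAB.1 hAB.vert_mem hρ.1.1 (fun s t h => ?_)
      (fun z hz => hρ2 _ (extend_mem_loopSector hw hAB.2.1 hz))
    obtain ⟨rfl, h1⟩ := hρ1 s t h
    exact ⟨fun _ _ => rfl, h1.loopNear A, h1.loopNear A⟩
  rw [hρtr, one_mul] at hSρ
  have hlog : 0 ≤ Real.log (Fintype.card (cyclesIn A)) :=
    Real.log_nonneg (by exact_mod_cast Fintype.card_pos)
  -- Four applications of the continuity of the entropy.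
  set T := ε + 2 * √ε with hT
  have hTε : ε ≤ T := by have := Real.sqrt_nonneg ε; linarith
  have hTs : 2 * √ε ≤ T := by linarith
  have hσσ' : ∀ S, traceNorm (reduced σ' S - reduced σ S) ≤ T := fun S => by
    refine (traceNorm_reduced_sub_le hσ'p.1 hσ.1.1 S).trans ?_
    rw [traceNorm_sub_comm]
    exact hclose.trans hTs
  have c1 : vonNeumannEntropy (reduced σ' Aᶜ) ≤ vonNeumannEntropy (reduced σ Aᶜ) +
      entropyModulus Λ T η :=
    vonNeumannEntropy_reduced_le _ hσ'p hσ.1 hσ1.le hη hη1 (hσσ' _)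
  have c2 : vonNeumannEntropy σ ≤ vonNeumannEntropy σ' + entropyModulus Λ T η := by
    have := vonNeumannEntropy_reduced_le Finset.univ hσ.1 hσ'p hσ'1 hη hη1
      ((traceNorm_sub_comm _ _).trans_le (hσσ' Finset.univ))
    rwa [vonNeumannEntropy_reduced_of_eq_univ hσ.1.1 rfl,
      vonNeumannEntropy_reduced_of_eq_univ hσ'p.1 rfl] at this
  have c3 : vonNeumannEntropy (reduced ρ (A ∪ B)) ≤ vonNeumannEntropy (reduced σ (A ∪ B)) +
      entropyModulus Λ T η :=
    vonNeumannEntropy_reduced_le _ hρ.1 hσ.1 hσ1.le hη hη1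
      ((traceNorm_sub_comm _ _).trans_le (hε.trans hTε))
  have c4 : vonNeumannEntropy (reduced σ B) ≤ vonNeumannEntropy (reduced ρ B) +
      entropyModulus Λ T η :=
    vonNeumannEntropy_reduced_le _ hσ.1 hρ.1 hρtr.le hη hη1
      ((traceNorm_reduced_union_le hAB.1 hσ.1.1 hρ.1.1).trans (hε.trans hTε))
  -- The averaged state has the entropy `S(σ' outside A) + log |cyclesIn A|` at most, the loop
  -- ensemble has `log |cyclesIn A| = S(ρ on A ∪ B) - S(ρ on B)`, and the conditional mutual
  -- information compares the sum of these with the entropy of `σ`.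
  have hent : vonNeumannEntropy τ - vonNeumannEntropy σ' ≤ δ + 4 * entropyModulus Λ T η := by
    rw [cmi] at hδ
    have : σ'.trace.re * Real.log (Fintype.card (cyclesIn A)) ≤
      Real.log (Fintype.card (cyclesIn A)) := mul_le_of_le_one_left hlog hσ'1
    linarith
  have hστ : traceNorm (σ' - τ) ≤ 2 * √(δ + 4 * entropyModulus Λ T η) := by
    have h1 : traceNorm (σ' - τ) ^ 2 ≤ 4 * (δ + 4 * entropyModulus Λ T η) := by linarith
    exact (Real.le_sqrt_of_sq_le h1).trans_eq (sqrt_four_mul _)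
  -- Conjugation with the Pauli operator fixes the averaged state.
  dsimp only at hgτ
  set g := pauliZX (extend A x) (extend A z) with hg
  have hgg : gᴴ * g = 1 := pauliZX_conjTranspose_mul _ _
  have hd : ∀ {M N : Λ.Op}, M.IsHermitian → N.IsHermitian →
      traceNorm (g * M * gᴴ - g * N * gᴴ) = traceNorm (M - N) := by
    intro M N hM hN
    rw [← Matrix.sub_mul, ← Matrix.mul_sub, traceNorm_conj (hM.sub hN) hgg]
  have s1 : traceNorm (g * σ * gᴴ - τ) ≤ traceNorm (σ - τ) := by
    conv_lhs => rw [← hgτ]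
    exact (hd hσ.1.1 hτH).le
  have s2 := traceNorm_sub_le hσ.1.1 hσ'p.1 hτH
  have s3 := traceNorm_sub_le (isHermitian_mul_mul_conjTranspose g hσ.1.1) hτH hσ.1.1
  rw [traceNorm_sub_comm τ σ] at s3
  rw [pauliDefect, ← hg]
  linarith

/-! ### From local to global invariance -/

/-- Orthogonality of the characters of the group of configurations. -/
theorem sum_zsign_pairing_eq_zero {y : Λ.Config} (hy : y ≠ 0) :
    ∑ x : Λ.Config, zsign (pairing x y) = 0 := by
  obtain ⟨e, he⟩ := Function.ne_iff.1 hy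
  have h : ∀ a : ZMod 2, a ≠ 0 → a = 1 := by decide
  have h1 := Equiv.sum_comp (Equiv.addRight (Pi.single e 1 : Λ.Config))
    (fun x => zsign (pairing x y))
  simp only [Equiv.coe_addRight, add_pairing, zsign_add] at h1
  have h2 : pairing (Pi.single e 1 : Λ.Config) y = 1 := by
    have h3 : pairing (Pi.single e 1 : Λ.Config) y = y e := by simp [pairing, Pi.single_apply]
    rw [h3, h (y e) he]
  rw [← Finset.sum_mul, h2, zsign_one] at h1
  linear_combination -(1 / 2 : ℂ) * h1

/-- A state which is almost invariant under all the Pauli operators `Z` is almost diagonal. -/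
theorem traceNorm_sub_diagonal_le {σ : Λ.Op} (hσ : σ.IsHermitian) {b : ℝ}
    (h : ∀ x, pauliDefect σ x 0 ≤ b) :
    traceNorm (σ - Matrix.diagonal fun s => ((σ s s).re : ℂ)) ≤ b := by
  have hc : (Fintype.card Λ.Config : ℝ) ≠ 0 := by exact_mod_cast Fintype.card_ne_zero
  -- The average over all the operators `Z` removes the off-diagonal entries.
  have h1 : σ - Matrix.diagonal (fun s => ((σ s s).re : ℂ)) = ∑ x : Λ.Config,
      ((Fintype.card Λ.Config : ℝ)⁻¹ • (σ - pauliZX x 0 * σ * (pauliZX x 0)ᴴ)) := by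
    rw [← Finset.smul_sum, Finset.sum_sub_distrib, Finset.sum_const, Finset.card_univ, smul_sub,
      ← Nat.cast_smul_eq_nsmul ℝ, smul_smul, inv_mul_cancel₀ hc, one_smul]
    congr 1
    ext s t
    rw [Matrix.smul_apply, Matrix.sum_apply]
    simp only [pauliZX_conj_apply, add_zero, ← zsign_add, ← pairing_add]
    rw [← Finset.sum_mul, Matrix.diagonal_apply]
    by_cases hst : s = t
    · subst hst
      simp only [config_add_self, pairing_zero, zsign_zero, Finset.sum_const, Finset.card_univ,
        nsmul_eq_mul, mul_one, if_true]
      rw [Complex.real_smul]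
      push_cast
      rw [← mul_assoc, inv_mul_cancel₀ (by exact_mod_cast hc), one_mul]
      exact Complex.conj_eq_iff_re.1 (hσ.apply s s)
    · rw [if_neg hst, sum_zsign_pairing_eq_zero, zero_mul, smul_zero]
      intro h0
      refine hst (funext fun e => ?_)
      exact CharTwo.add_eq_zero.1 (congrFun h0 e)
  have hH : ∀ x, (σ - pauliZX x 0 * σ * (pauliZX x 0)ᴴ).IsHermitian := fun x =>
    hσ.sub (pauliZX_conj_isHermitian x 0 hσ)
  have hsm : ∀ (M : Λ.Op), M.IsHermitian → ∀ c : ℝ, 0 ≤ c →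
      (c • M).IsHermitian ∧ traceNorm (c • M) ≤ c * traceNorm M := by
    intro M hM c hc
    have hcM : (c • M).IsHermitian := by
      rw [Matrix.IsHermitian, conjTranspose_smul, star_trivial, hM]
    refine ⟨hcM, ?_⟩
    obtain ⟨V, hV, hV'⟩ := exists_unitary_traceNorm_eq hcM
    rw [← hV', Matrix.smul_mul, Matrix.trace_smul, Complex.smul_re, smul_eq_mul]
    exact mul_le_mul_of_nonneg_left ((le_abs_self _).trans
      (abs_re_trace_mul_le_traceNorm hM hV)) hc
  have hc0 : (0 : ℝ) ≤ (Fintype.card Λ.Config : ℝ)⁻¹ := by positivity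
  rw [h1]
  refine (traceNorm_sum_le _ _ fun x _ => (hsm _ (hH x) _ hc0).1).trans ?_
  have h2 : ∀ x ∈ Finset.univ, traceNorm ((Fintype.card Λ.Config : ℝ)⁻¹ •
      (σ - pauliZX x 0 * σ * (pauliZX x 0)ᴴ)) ≤ (Fintype.card Λ.Config : ℝ)⁻¹ * b := by
    intro x _
    refine (hsm _ (hH x) _ hc0).2.trans (mul_le_mul_of_nonneg_left ?_ hc0)
    rw [traceNorm_sub_comm]
    exact h x
  refine (Finset.sum_le_sum h2).trans (le_of_eq ?_)
  rw [Finset.sum_const, Finset.card_univ, nsmul_eq_mul, ← mul_assoc, mul_inv_cancel₀ hc, one_mul]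

/-- A probability distribution which is almost invariant under the sums of boundaries, and almost
supported on loop configurations, is close to a mixture of the loop ensembles. -/
theorem exists_mem_convexHull_diagonal (hw : Λ.IsIndependentHoles w) {P : Λ.Config → ℝ}
    (hP : ∀ s, 0 ≤ P s) (hP1 : ∑ s, P s = 1) {b q : ℝ}
    (hb : ∀ z ∈ Λ.loopSector w 0, ∑ s, |P (s + z) - P s| ≤ b)
    (hq : ∑ s ∈ (Finset.univ.biUnion (Λ.loopSector w))ᶜ, P s ≤ q) :
    ∃ τ ∈ convexHull ℝ (Set.range fun p : ι → ZMod 2 => Λ.loopState w p),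
      traceNorm ((Matrix.diagonal fun s => (P s : ℂ)) - τ) ≤ b + 2 * q := by
  classical
  set V := Λ.loopSector w 0 with hV
  have hVc : (0 : ℝ) < V.card := by exact_mod_cast Finset.card_pos.2 (loopSector_nonempty hw 0)
  set G := Finset.univ.biUnion (Λ.loopSector w) with hG
  have hdisj : ∀ p ∈ (Finset.univ : Finset (ι → ZMod 2)), ∀ p' ∈ Finset.univ, p ≠ p' →
      Disjoint (Λ.loopSector w p) (Λ.loopSector w p') := fun p _ p' _ hne =>
    Finset.disjoint_left.2 fun s hs hs' => hne (eq_of_mem_loopSector hs hs')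
  set W : (ι → ZMod 2) → ℝ := fun p => ∑ s ∈ Λ.loopSector w p, P s with hW
  have hWsum : ∑ p, W p = ∑ s ∈ G, P s := by
    rw [hG, Finset.sum_biUnion hdisj]
  set r := ∑ s ∈ Gᶜ, P s with hr
  have hr0 : 0 ≤ r := Finset.sum_nonneg fun s _ => hP s
  have hWr : ∑ p, W p + r = 1 := by
    rw [hWsum, hr, Finset.sum_add_sum_compl, hP1]
  have hW0 : ∀ p, 0 ≤ W p := fun p => Finset.sum_nonneg fun s _ => hP s
  -- The weights of the sectors; the remaining weight is put on the trivial one.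
  refine ⟨∑ p, (W p + if p = 0 then r else 0) • Λ.loopState w p,
    mem_convexHull_range_iff.2 ⟨_, fun p => ?_, ?_, rfl⟩, ?_⟩
  · have := hW0 p
    split_ifs <;> linarith
  · rw [Finset.sum_add_distrib, Finset.sum_ite_eq' Finset.univ (0 : ι → ZMod 2) (fun _ => r),
      if_pos (Finset.mem_univ _), hWr]
  have hmat : (Matrix.diagonal fun s => (P s : ℂ)) -
      ∑ p, (W p + if p = 0 then r else 0) • Λ.loopState w p = Matrix.diagonal fun s =>
      ((P s - ∑ p, (W p + if p = 0 then r else 0) *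
        (if s ∈ Λ.loopSector w p then (V.card : ℝ)⁻¹ else 0) : ℝ) : ℂ) := by
    ext s t
    rw [Matrix.sub_apply, Matrix.sum_apply, Matrix.diagonal_apply, Matrix.diagonal_apply]
    by_cases hst : s = t
    · subst hst
      rw [if_pos rfl, if_pos rfl]
      push_cast
      congr 1
      refine Finset.sum_congr rfl fun p _ => ?_
      rw [Matrix.smul_apply, loopState_apply, card_loopSector hw p, Complex.real_smul, ← hV]
      by_cases hs : s ∈ Λ.loopSector w p
      · simp only [hs, and_self, if_true]
        push_cast
        rfl
      · simp [hs]
    · rw [if_neg hst, if_neg hst, zero_sub, neg_eq_zero]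
      refine Finset.sum_eq_zero fun p _ => ?_
      have h : Λ.loopState w p s t = 0 := by rw [loopState_apply, if_neg fun h => hst h.1]
      rw [Matrix.smul_apply, h, smul_zero]
  rw [hmat, traceNorm_diagonal]
  have hsplit : ∀ s, |P s - ∑ p, (W p + if p = 0 then r else 0) *
        (if s ∈ Λ.loopSector w p then (V.card : ℝ)⁻¹ else 0)| ≤
      |P s - ∑ p, W p * (if s ∈ Λ.loopSector w p then (V.card : ℝ)⁻¹ else 0)| +
        if s ∈ V then r * (V.card : ℝ)⁻¹ else 0 := by
    intro s
    have h1 : ∑ p, (W p + if p = 0 then r else 0) *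
        (if s ∈ Λ.loopSector w p then (V.card : ℝ)⁻¹ else 0) =
        ∑ p, W p * (if s ∈ Λ.loopSector w p then (V.card : ℝ)⁻¹ else 0) +
          if s ∈ V then r * (V.card : ℝ)⁻¹ else 0 := by
      simp only [add_mul, Finset.sum_add_distrib, ite_mul, zero_mul]
      rw [Finset.sum_ite_eq' Finset.univ (0 : ι → ZMod 2), if_pos (Finset.mem_univ _), mul_ite,
        mul_zero]
    rw [h1, ← sub_sub]
    refine (abs_sub _ _).trans (le_of_eq ?_)
    congr 1
    refine abs_of_nonneg ?_
    split_ifs <;> positivity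
  refine (Finset.sum_le_sum fun s _ => hsplit s).trans ?_
  rw [Finset.sum_add_distrib]
  have hsecond : ∑ s, (if s ∈ V then r * (V.card : ℝ)⁻¹ else 0) = r := by
    rw [← Finset.sum_filter, Finset.filter_univ_mem, Finset.sum_const, nsmul_eq_mul]
    field_simp
  -- On a sector, the mixture is the average over the sums of boundaries.
  have hsector : ∀ s ∈ G, ∑ p, W p * (if s ∈ Λ.loopSector w p then (V.card : ℝ)⁻¹ else 0) =
      (V.card : ℝ)⁻¹ * ∑ z ∈ V, P (s + z) := by
    intro s hs
    obtain ⟨p, -, hp⟩ := Finset.mem_biUnion.1 hs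
    rw [Finset.sum_eq_single p (fun p' _ hp' => by
      rw [if_neg fun h => hp' (eq_of_mem_loopSector h hp), mul_zero]) (by simp),
      if_pos hp, mul_comm]
    congr 1
    refine (Finset.sum_bij (fun z _ => s + z) (fun z hz => ?_) (fun z _ z' _ h => ?_)
      (fun t ht => ?_) (fun z _ => rfl)).symm
    · rw [add_mem_loopSector_iff_of_zero hz]
      exact hp
    · exact add_left_cancel h
    · refine ⟨s + t, ?_, ?_⟩
      · have := add_mem_loopSector hp ht
        have h2 : p + p = 0 := funext fun i => CharTwo.add_self_eq_zero _
        rwa [h2] at this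
      · rw [← add_assoc, config_add_self, zero_add]
  have hfirst : ∑ s, |P s - ∑ p, W p *
      (if s ∈ Λ.loopSector w p then (V.card : ℝ)⁻¹ else 0)| ≤ b + r := by
    rw [← Finset.sum_add_sum_compl G]
    refine add_le_add ?_ ?_
    · have h1 : ∀ s ∈ G, |P s - ∑ p, W p *
          (if s ∈ Λ.loopSector w p then (V.card : ℝ)⁻¹ else 0)| ≤
          (V.card : ℝ)⁻¹ * ∑ z ∈ V, |P (s + z) - P s| := by
        intro s hs
        have h2 : P s = (V.card : ℝ)⁻¹ * ∑ z ∈ V, P s := by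
          rw [Finset.sum_const, nsmul_eq_mul]
          field_simp
        rw [hsector s hs]
        conv_lhs => rw [h2]
        rw [← mul_sub, ← Finset.sum_sub_distrib, abs_mul, abs_of_nonneg (inv_nonneg.2 hVc.le)]
        refine mul_le_mul_of_nonneg_left ((Finset.abs_sum_le_sum_abs _ _).trans ?_)
          (inv_nonneg.2 hVc.le)
        exact Finset.sum_le_sum fun z _ => (abs_sub_comm _ _).le
      refine (Finset.sum_le_sum h1).trans ?_
      refine (Finset.sum_le_sum_of_subset_of_nonneg (Finset.subset_univ G) fun s _ _ =>
        mul_nonneg (inv_nonneg.2 hVc.le) (Finset.sum_nonneg fun _ _ => abs_nonneg _)).trans ?_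
      rw [← Finset.mul_sum, Finset.sum_comm]
      refine (mul_le_mul_of_nonneg_left (Finset.sum_le_sum hb) (inv_nonneg.2 hVc.le)).trans ?_
      rw [Finset.sum_const, nsmul_eq_mul]
      apply le_of_eq
      field_simp
    · refine Finset.sum_le_sum fun s hs => ?_
      rw [Finset.sum_eq_zero, sub_zero, abs_of_nonneg (hP s)]
      intro p _
      rw [if_neg, mul_zero]
      intro h
      exact (Finset.mem_compl.1 hs) (Finset.mem_biUnion.2 ⟨p, Finset.mem_univ _, h⟩)
  rw [hsecond]
  linarith

theorem card_dart_le : Fintype.card Λ.Dart ≤ 2 * Fintype.card Λ.Edge := by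
  have h := Finset.card_eq_sum_card_fiberwise (s := (Finset.univ : Finset Λ.Dart))
    (t := (Finset.univ : Finset Λ.Edge)) (f := Λ.edge)
    (fun _ _ => Finset.mem_coe.2 (Finset.mem_univ _))
  rw [Finset.card_univ] at h
  rw [h]
  have h1 : ∀ e ∈ (Finset.univ : Finset Λ.Edge),
      (Finset.univ.filter fun d => Λ.edge d = e).card ≤ 2 := by
    intro e _
    obtain ⟨d, rfl⟩ := Λ.edge_surjective e
    have := Λ.sum_edge_fiber (fun _ => 1) d
    rw [← Finset.card_eq_sum_ones] at this
    exact this.le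
  refine (Finset.sum_le_sum h1).trans (le_of_eq ?_)
  rw [Finset.sum_const, Finset.card_univ, smul_eq_mul, mul_comm]

theorem card_vertex_le : Fintype.card Λ.Vertex ≤ 2 * Fintype.card Λ.Edge :=
  (Fintype.card_le_of_surjective _ Λ.vert_surjective).trans card_dart_le

theorem card_face_le : Fintype.card Λ.Face ≤ 2 * Fintype.card Λ.Edge :=
  (Fintype.card_le_of_surjective _ Λ.face_surjective).trans card_dart_le

theorem sum_biUnion_le {α β : Type*} [DecidableEq β] {f : β → ℝ} (hf : ∀ b, 0 ≤ f b)
    (s : Finset α) (t : α → Finset β) : ∑ b ∈ s.biUnion t, f b ≤ ∑ a ∈ s, ∑ b ∈ t a, f b := by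
  classical
  induction s using Finset.induction_on with
  | empty => simp
  | insert a s ha ih =>
    rw [Finset.biUnion_insert, Finset.sum_insert ha]
    have h1 := Finset.sum_union_inter (s₁ := t a) (s₂ := s.biUnion t) (f := f)
    have h2 : 0 ≤ ∑ b ∈ t a ∩ s.biUnion t, f b := Finset.sum_nonneg fun b _ => hf b
    linarith

theorem exists_extend_eq {A : Finset Λ.Edge} {x : Λ.Config} (hx : ∀ e, e ∉ A → x e = 0) :
    ∃ a : A → ZMod 2, extend A a = x := by
  refine ⟨fun e => x e, funext fun e => ?_⟩
  by_cases he : e ∈ A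
  · rw [extend_apply_mem _ he]
  · rw [extend_apply_notMem _ he, hx e he]

/-- A state which cannot be distinguished from the loop ensemble on simply connected regions, and
which is approximately Markov around every qubit, is close to a mixture of the loop ensembles. -/
theorem exists_mem_convexHull_traceNorm_sub_le {k : ℕ} (hk : Λ.HasGenus k)
    {w : Fin (2 * k) → Λ.Edge → ZMod 2} (hw : Λ.IsIndependentHoles w) {σ : Λ.Op}
    (hσ : IsDensityMatrix σ) {ε δ η : ℝ} (hη : 0 < η) (hη1 : η ≤ 1 / 2)
    (hε : ∀ A, Λ.IsSimplyConnected A →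
      traceNorm (reduced σ A - reduced (Λ.loopState w 0) A) ≤ ε)
    (hδ : ∀ e, ∃ A B, Λ.IsMarkovPartition A B ∧ (∀ e', Λ.Touch e e' → e' ∈ A) ∧
      cmi σ A B ≤ δ) :
    ∃ τ ∈ convexHull ℝ (Set.range fun p : Fin (2 * k) → ZMod 2 => Λ.loopState w p),
      traceNorm (σ - τ) ≤ Fintype.card Λ.Edge *
        (12 * √ε + 12 * √(δ + 4 * entropyModulus Λ (ε + 2 * √ε) η) + 4 * ε) := by
  classical
  set b := 4 * √ε + 4 * √(δ + 4 * entropyModulus Λ (ε + 2 * √ε) η) with hb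
  have hb0 : 0 ≤ b := by positivity
  set N : ℝ := (Fintype.card Λ.Edge : ℝ) with hN
  have hN0 : 0 ≤ N := Nat.cast_nonneg _
  -- Invariance under the Pauli operators on single qubits and under the boundaries of faces.
  have hZ : ∀ e : Λ.Edge, pauliDefect σ (Pi.single e 1) 0 ≤ b := by
    intro e
    obtain ⟨A, B, hAB, hA, hcmi⟩ := hδ e
    obtain ⟨d, hd⟩ := Λ.edge_surjective e
    obtain ⟨x, hx⟩ := exists_extend_eq (A := A) (x := Pi.single e 1) (fun e' he' => by
      refine Pi.single_eq_of_ne ?_ _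
      rintro rfl
      exact he' (hA _ ⟨d, d, hd, hd, Or.inl rfl⟩))
    have := pauliDefect_le hw hAB hσ hη hη1 (hε _ hAB.2.2.1) hcmi x 0 (zero_mem _)
    rwa [hx, map_zero] at this
  have hX : ∀ f : Λ.Face, pauliDefect σ 0 (Λ.faceBoundary f) ≤ b := by
    intro f
    obtain ⟨d, hd⟩ := Λ.face_surjective f
    obtain ⟨A, B, hAB, hA, hcmi⟩ := hδ (Λ.edge d)
    obtain ⟨z, hz⟩ := exists_extend_eq (A := A) (x := Λ.faceBoundary f) (fun e' he' => by
      refine Finset.sum_eq_zero fun d' hd' => ?_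
      exfalso
      obtain ⟨h1, h2⟩ := (Finset.mem_filter.1 hd').2
      exact he' (hA _ ⟨d, d', rfl, h2, Or.inr (hd.trans h1.symm)⟩))
    have := pauliDefect_le hw hAB hσ hη hη1 (hε _ hAB.2.2.1) hcmi 0 z (by
      change Λ.IsLoopConfig (extend A z)
      rw [hz]
      exact Λ.isLoopConfig_faceBoundary f)
    rwa [hz, map_zero] at this
  have hZall : ∀ x, pauliDefect σ x 0 ≤ N * b := by
    intro x
    have h1 := pauliDefect_sum_le hσ.1.1 Finset.univ x (fun e => Pi.single e 1) (fun _ => 0) hb0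
      (fun e _ => hZ e)
    have h2 : ∑ e, x e • (Pi.single e 1 : Λ.Config) = x := by
      ext e
      simp [Finset.sum_apply, Pi.single_apply]
    simpa [h2] using h1
  have hXall : ∀ z ∈ Λ.loopSector w 0, pauliDefect σ 0 z ≤ 2 * N * b := by
    intro z hz
    obtain ⟨u, rfl⟩ := exists_eq_sum_smul_faceBoundary hk hw (mem_loopSector.1 hz).1
      (mem_loopSector.1 hz).2
    have h1 := pauliDefect_sum_le hσ.1.1 Finset.univ u (fun _ => 0) Λ.faceBoundary hb0
      (fun f _ => hX f)
    simp only [smul_zero, Finset.sum_const_zero, Finset.card_univ] at h1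
    refine h1.trans (mul_le_mul_of_nonneg_right ?_ hb0)
    rw [hN]
    exact_mod_cast card_face_le
  set P : Λ.Config → ℝ := fun s => (σ s s).re with hP
  have hP0 : ∀ s, 0 ≤ P s := fun s => (Complex.le_def.1 hσ.1.diag_nonneg).1
  have hP1 : ∑ s, P s = 1 := by
    have := congrArg Complex.re hσ.2
    rwa [Matrix.trace, Complex.re_sum, Complex.one_re] at this
  have hinv : ∀ z ∈ Λ.loopSector w 0, ∑ s, |P (s + z) - P s| ≤ 2 * N * b := by
    intro z hz
    refine le_trans (le_of_eq ?_) ((sum_abs_re_diag_le_traceNorm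
      ((pauliZX_conj_isHermitian 0 z hσ.1.1).sub hσ.1.1)).trans (hXall z hz))
    refine Finset.sum_congr rfl fun s _ => ?_
    rw [Matrix.sub_apply, pauliZX_conj_apply]
    simp [pairing, zsign_zero, hP]
  -- The weight of the configurations with end points.
  have hloop : ∑ s ∈ (Finset.univ.biUnion (Λ.loopSector w))ᶜ, P s ≤ 2 * N * ε := by
    have hv : ∀ v : Λ.Vertex, ∑ s with pairing (Λ.star v) s ≠ 0, P s ≤ ε := by
      intro v
      obtain ⟨d, hd⟩ := Λ.vert_surjective v
      obtain ⟨A, B, hAB, hA, -⟩ := hδ (Λ.edge d)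
      have h1 := abs_sum_diag_sub_le hσ.1.1 (isDensityMatrix_loopState hw 0).1.1 A
        (fun s => pairing (Λ.star v) s ≠ 0) (fun s t hst => by
          rw [pairing_star, pairing_star, Finset.sum_congr rfl fun d' hd' =>
            hst _ (hA _ ⟨d, d', rfl, rfl, Or.inl (hd.trans (Finset.mem_filter.1 hd').2.symm)⟩)])
      have h2 : ∑ s with pairing (Λ.star v) s ≠ 0, (Λ.loopState w 0 s s).re = 0 := by
        refine Finset.sum_eq_zero fun s hs => ?_
        rw [loopState_apply, if_neg, Complex.zero_re]
        rintro ⟨-, h3⟩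
        exact (Finset.mem_filter.1 hs).2 ((Λ.isLoopConfig_iff s).1 (mem_loopSector.1 h3).1 v)
      rw [h2, sub_zero] at h1
      exact (le_abs_self _).trans (h1.trans (hε A hAB.2.1))
    have hsub : (Finset.univ.biUnion (Λ.loopSector w))ᶜ ⊆
        Finset.univ.biUnion fun v : Λ.Vertex =>
          Finset.univ.filter fun s => pairing (Λ.star v) s ≠ 0 := by
      intro s hs
      by_contra h1
      simp only [Finset.mem_biUnion, Finset.mem_univ, true_and, Finset.mem_filter, not_exists,
        not_not] at h1
      refine (Finset.mem_compl.1 hs) (Finset.mem_biUnion.2 ⟨fun i => pairing (w i) s,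
        Finset.mem_univ _, mem_loopSector.2 ⟨(Λ.isLoopConfig_iff s).2 h1, fun _ => rfl⟩⟩)
    have hε0 : 0 ≤ ε := by
      obtain ⟨d⟩ := Λ.nonempty
      obtain ⟨A, B, hAB, -, -⟩ := hδ (Λ.edge d)
      exact (traceNorm_nonneg _).trans (hε A hAB.2.1)
    calc _ ≤ ∑ s ∈ Finset.univ.biUnion fun v : Λ.Vertex =>
          Finset.univ.filter fun s => pairing (Λ.star v) s ≠ 0, P s :=
          Finset.sum_le_sum_of_subset_of_nonneg hsub fun s _ _ => hP0 s
      _ ≤ ∑ v : Λ.Vertex, ∑ s with pairing (Λ.star v) s ≠ 0, P s := by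
          exact sum_biUnion_le hP0 _ _
      _ ≤ ∑ v : Λ.Vertex, ε := Finset.sum_le_sum fun v _ => hv v
      _ = Fintype.card Λ.Vertex * ε := by rw [Finset.sum_const, Finset.card_univ, nsmul_eq_mul]
      _ ≤ 2 * N * ε := by
          refine mul_le_mul_of_nonneg_right ?_ hε0
          rw [hN]
          exact_mod_cast card_vertex_le
  obtain ⟨τ, hτ, hτ'⟩ := exists_mem_convexHull_diagonal hw hP0 hP1 hinv hloop
  refine ⟨τ, hτ, ?_⟩
  have h1 := traceNorm_sub_diagonal_le hσ.1.1 hZall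
  have hdH : (Matrix.diagonal fun s => ((P s : ℝ) : ℂ)).IsHermitian := by
    rw [Matrix.IsHermitian, diagonal_conjTranspose]
    congr 1
    ext s
    simp
  have h2 := traceNorm_sub_le hσ.1.1 hdH (convexHull_loopState_properties hw hτ).1.1.1
  refine h2.trans ((add_le_add h1 hτ').trans (le_of_eq ?_))
  rw [hb]
  ring

end CellulatedSurface

/-! ### Negligible sequences -/

theorem IsNegligible.mono {x y : ℕ+ → ℝ} (hx : IsNegligible x)
    (h : ∀ᶠ L in atTop, |y L| ≤ |x L|) : IsNegligible y :=
  Asymptotics.SuperpolynomialDecay.trans_eventually_abs_le hx h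

theorem IsNegligible.abs {x : ℕ+ → ℝ} (hx : IsNegligible x) : IsNegligible fun L => |x L| :=
  hx.mono (Eventually.of_forall fun _ => (abs_abs _).le)

theorem IsNegligible.add {x y : ℕ+ → ℝ} (hx : IsNegligible x) (hy : IsNegligible y) :
    IsNegligible fun L => x L + y L :=
  Asymptotics.SuperpolynomialDecay.add hx hy

theorem IsNegligible.const_mul {x : ℕ+ → ℝ} (hx : IsNegligible x) (c : ℝ) :
    IsNegligible fun L => c * x L :=
  Asymptotics.SuperpolynomialDecay.const_mul hx c

theorem IsNegligible.pow_mul {x : ℕ+ → ℝ} (hx : IsNegligible x) (m : ℕ) :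
    IsNegligible fun L => (L : ℝ) ^ m * x L :=
  Asymptotics.SuperpolynomialDecay.param_pow_mul hx m

theorem IsNegligible.mul_of_le {x N : ℕ+ → ℝ} (hx : IsNegligible x) {K : ℝ} {m : ℕ}
    (hN : ∀ L, |N L| ≤ K * (L : ℝ) ^ m) : IsNegligible fun L => N L * x L := by
  refine ((hx.pow_mul m).const_mul K).mono (Eventually.of_forall fun L => ?_)
  have hp : (0 : ℝ) ≤ (L : ℝ) ^ m := by positivity
  rw [abs_mul, abs_mul, abs_mul, ← mul_assoc, abs_of_nonneg hp]
  refine mul_le_mul_of_nonneg_right ((hN L).trans ?_) (abs_nonneg _)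
  exact mul_le_mul_of_nonneg_right (le_abs_self K) (pow_nonneg (Nat.cast_nonneg _) m)

theorem IsNegligible.sqrt {x : ℕ+ → ℝ} (hx : IsNegligible x) : IsNegligible fun L => √(x L) := by
  intro n
  have h := (Real.continuous_sqrt.tendsto 0).comp (hx (2 * n))
  rw [Real.sqrt_zero] at h
  refine h.congr fun L => ?_
  rw [Function.comp_apply, Real.sqrt_mul (pow_nonneg (Nat.cast_nonneg _) _), mul_comm 2 n,
    _root_.pow_mul,
    Real.sqrt_sq (pow_nonneg (Nat.cast_nonneg _) _)]

theorem isNegligible_exp_neg {a : ℝ} (ha : 0 < a) :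
    IsNegligible fun L : ℕ+ => Real.exp (-(a * L)) := by
  intro n
  have h1 : Tendsto (fun L : ℕ+ => a * (L : ℝ)) atTop atTop :=
    (tendsto_natCast_atTop_atTop.comp tendsto_PNat_val_atTop_atTop).const_mul_atTop ha
  have h2 := ((Real.tendsto_pow_mul_exp_neg_atTop_nhds_zero n).comp h1).const_mul ((a ^ n)⁻¹)
  rw [mul_zero] at h2
  refine h2.congr fun L => ?_
  rw [Function.comp_apply, mul_pow, ← mul_assoc, ← mul_assoc, inv_mul_cancel₀ (pow_pos ha n).ne',
    one_mul]

theorem isNegligible_zero : IsNegligible fun _ => 0 := fun n => by simp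

/-! ### Families of states -/

open CellulatedSurface

/-- If the conditional mutual information vanishes, then every `ξ > 0` is admissible in the Markov
length. -/
theorem markovLength_eq_zero {Λ : ℕ+ → CellulatedSurface} {σ : StateFamily Λ}
    (h : ∀ L A B, (Λ L).IsMarkovPartition A B → cmi (σ L) A B = 0) : markovLength σ = 0 := by
  refine le_antisymm (le_of_forall_gt fun b hb => ?_) (zero_le)
  obtain ⟨ξ, h1, h3⟩ := ENNReal.lt_iff_exists_nnreal_btwn.1 hb
  refine lt_of_le_of_lt (iInf₂_le (ξ : ℝ) ⟨NNReal.coe_pos.2 (ENNReal.coe_pos.1 h1), 0, 0,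
    fun L A B hAB => by rw [h L A B hAB, zero_mul, zero_mul]⟩) ?_
  rwa [ENNReal.ofReal_coe_nnreal]

section LatticeFamily

variable {Λ : ℕ+ → CellulatedSurface}

theorem markovLength_eq_zero_of_mem_convFamily {ι : Type} [Fintype ι] [DecidableEq ι]
    {w : ∀ L, ι → (Λ L).Edge → ZMod 2} (hw : ∀ L, (Λ L).IsIndependentHoles (w L))
    {σ : StateFamily Λ}
    (hσ : σ ∈ convFamily (Λ := Λ) fun (p : ι → ZMod 2) L => (Λ L).loopState (w L) p) :
    markovLength σ = 0 :=
  markovLength_eq_zero fun L _ _ hAB => cmi_eq_zero_of_mem_convexHull (hw L) (hσ L) hAB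

theorem convFamily_subset_locallyIndistinguishableSet {ι : Type} [Fintype ι] [DecidableEq ι]
    {w : ∀ L, ι → (Λ L).Edge → ZMod 2} (hw : ∀ L, (Λ L).IsIndependentHoles (w L)) (ξ₀ : ENNReal) :
    convFamily (Λ := Λ) (fun (p : ι → ZMod 2) L => (Λ L).loopState (w L) p) ⊆
      locallyIndistinguishableSet (fun L => (Λ L).loopState (w L) 0) ξ₀ := by
  intro σ hσ
  refine ⟨fun L => (convexHull_loopState_properties (hw L) (hσ L)).1, ?_, fun _ => 0,
    isNegligible_zero, fun L A hA => ?_⟩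
  · rw [markovLength_eq_zero_of_mem_convFamily hw hσ]
    exact zero_le
  · rw [(convexHull_loopState_properties (hw L) (hσ L)).2.2.2 A hA, sub_self, traceNorm_zero]

/-- The error bound of the finite-size rigidity estimate is negligible if the local errors are. -/
theorem isNegligible_rigidity_bound {K : ℝ} {m : ℕ}
    (hN : ∀ L : ℕ+, (Fintype.card (Λ L).Edge : ℝ) ≤ K * (L : ℝ) ^ m) {ε δ : ℕ+ → ℝ}
    (hε : IsNegligible ε) (hδ : IsNegligible δ) :
    IsNegligible fun L => Fintype.card (Λ L).Edge * (12 * √(ε L) + 12 * √(δ L +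
      4 * entropyModulus (Λ L) (ε L + 2 * √(ε L)) (Real.exp (-(1 * L)) / 2)) + 4 * ε L) := by
  have hN' : ∀ L : ℕ+, |(Fintype.card (Λ L).Edge : ℝ)| ≤ K * (L : ℝ) ^ m := fun L => by
    rw [abs_of_nonneg (Nat.cast_nonneg _)]
    exact hN L
  have hη : IsNegligible fun L : ℕ+ => Real.exp (-(1 * L)) / 2 :=
    ((isNegligible_exp_neg one_pos).const_mul (1 / 2)).mono
      (Eventually.of_forall fun L => le_of_eq (by ring_nf))
  have hT : IsNegligible fun L => ε L + 2 * √(ε L) := hε.add (hε.sqrt.const_mul 2)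
  have hmod : IsNegligible fun L =>
      entropyModulus (Λ L) (ε L + 2 * √(ε L)) (Real.exp (-(1 * L)) / 2) := by
    -- With `η = exp (-L) / 2` the logarithm in the modulus of continuity grows only polynomially.
    have h1 := (((hT.mul_of_le hN').const_mul (Real.log 2)).add
      (hT.const_mul (Real.log 2 + 1))).add ((hT.pow_mul 1).add hη)
    refine h1.mono (Eventually.of_forall fun L => le_of_eq ?_)
    have h2 : Real.log (2 ^ Fintype.card (Λ L).Edge / (Real.exp (-(1 * L)) / 2)) =
        Fintype.card (Λ L).Edge * Real.log 2 + Real.log 2 + L := by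
      rw [Real.log_div (by positivity) (by positivity), Real.log_pow,
        Real.log_div (Real.exp_ne_zero _) two_ne_zero, Real.log_exp]
      ring
    congr 1
    rw [entropyModulus, h2]
    ring
  exact ((((hε.sqrt.const_mul 12).add ((hδ.add (hmod.const_mul 4)).sqrt.const_mul 12)).add
    (hε.const_mul 4))).mul_of_le hN'

/-- A family of states with finite Markov length which cannot be distinguished from the loop
ensemble on simply connected regions is asymptotically a mixture of the loop ensembles. -/
theorem exists_mem_convFamily_asympEq {k : ℕ} {w : ∀ L, Fin (2 * k) → (Λ L).Edge → ZMod 2}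
    (hk : ∀ L, (Λ L).HasGenus k) (hΛ : IsLatticeFamily Λ)
    (hw : ∀ L, (Λ L).IsIndependentHoles (w L)) {ξ₀ : ENNReal} (hξ₀ : ξ₀ ≠ ⊤) {σ : StateFamily Λ}
    (hσ : σ ∈ locallyIndistinguishableSet (fun L => (Λ L).loopState (w L) 0) ξ₀) :
    ∃ τ ∈ convFamily (Λ := Λ) (fun (p : Fin (2 * k) → ZMod 2) L => (Λ L).loopState (w L) p),
      AsympEq σ τ := by
  classical
  obtain ⟨hσd, hσξ, ε, hε, hσε⟩ := hσ
  obtain ⟨⟨K, m, hN⟩, c, hc, hpart⟩ := hΛ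
  obtain ⟨ξ, hξ⟩ := iInf_lt_iff.1 (hσξ.trans_lt hξ₀.lt_top)
  obtain ⟨⟨hξ0, K', m', hcmi⟩, -⟩ := iInf_lt_iff.1 hξ
  set δ : ℕ+ → ℝ := fun L => |K'| * ((L : ℝ) ^ m' * Real.exp (-(c / ξ * L))) with hδ
  have hδn : IsNegligible δ :=
    ((isNegligible_exp_neg (div_pos hc hξ0)).pow_mul m').const_mul |K'|
  have hbound := isNegligible_rigidity_bound hN hε.abs hδn
  have hex : ∀ L, ∃ τ ∈ convexHull ℝ (Set.range fun p : Fin (2 * k) → ZMod 2 =>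
      (Λ L).loopState (w L) p), (∀ e, ∃ A B, (Λ L).IsMarkovPartition A B ∧
        (∀ e', (Λ L).Touch e e' → e' ∈ A) ∧ c * L ≤ (Λ L).regionDist A (A ∪ B)ᶜ) →
      traceNorm (σ L - τ) ≤ Fintype.card (Λ L).Edge * (12 * √|ε L| + 12 * √(δ L +
      4 * entropyModulus (Λ L) (|ε L| + 2 * √|ε L|) (Real.exp (-(1 * L)) / 2)) + 4 * |ε L|) := by
    intro L
    by_cases hL : ∀ e, ∃ A B, (Λ L).IsMarkovPartition A B ∧
        (∀ e', (Λ L).Touch e e' → e' ∈ A) ∧ c * L ≤ (Λ L).regionDist A (A ∪ B)ᶜ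
    · have hη : Real.exp (-(1 * L)) / 2 ≤ 1 / 2 := by
        have : Real.exp (-(1 * (L : ℝ))) ≤ 1 := Real.exp_le_one_iff.2 (by simp)
        linarith
      obtain ⟨τ, h1, h2⟩ := exists_mem_convexHull_traceNorm_sub_le (hk L) (hw L) (hσd L)
        (ε := |ε L|) (δ := δ L) (div_pos (Real.exp_pos (-(1 * (L : ℝ)))) two_pos) hη
        (fun A hA => (hσε L A hA).trans (le_abs_self _)) (fun e => by
          obtain ⟨A, B, hAB, hA, hd⟩ := hL e
          refine ⟨A, B, hAB, hA, (hcmi L A B hAB).trans ?_⟩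
          simp only [hδ]
          rw [← mul_assoc]
          refine mul_le_mul (mul_le_mul_of_nonneg_right (le_abs_self _) (by positivity))
            (Real.exp_le_exp.2 ?_) (Real.exp_pos _).le (by positivity)
          rw [neg_div, neg_le_neg_iff, div_mul_eq_mul_div]
          exact div_le_div_of_nonneg_right hd hξ0.le)
      exact ⟨τ, h1, fun _ => h2⟩
    · exact ⟨(Λ L).loopState (w L) 0, subset_convexHull ℝ _ ⟨0, rfl⟩, fun h => absurd h hL⟩
  choose τ hτ hτ' using hex
  refine ⟨τ, hτ, hbound.mono ?_⟩
  filter_upwards [hpart] with L hL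
  rw [abs_of_nonneg (traceNorm_nonneg _)]
  exact (hτ' L hL).trans (le_abs_self _)

end LatticeFamily

namespace CellulatedSurface

variable {Λ : CellulatedSurface} {A : Finset Λ.Edge}

/-! ### Homotopy of edge paths -/

/-- Homotopy, within `A` and relative to the end points, of edge paths from `x` to `y`. -/
def PathHomotopic (Λ : CellulatedSurface) (A : Finset Λ.Edge) (x y : Λ.Point) :
    List Λ.Step → List Λ.Step → Prop :=
  Relation.EqvGen fun p q => Λ.IsPath A x y p ∧ Λ.IsPath A x y q ∧ Λ.Move A p q

theorem PathHomotopic.refl {x y : Λ.Point} (p : List Λ.Step) : Λ.PathHomotopic A x y p p :=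
  Relation.EqvGen.refl p

theorem PathHomotopic.symm {x y : Λ.Point} {p q : List Λ.Step} (h : Λ.PathHomotopic A x y p q) :
    Λ.PathHomotopic A x y q p :=
  Relation.EqvGen.symm _ _ h

theorem PathHomotopic.trans {x y : Λ.Point} {p q r : List Λ.Step}
    (h : Λ.PathHomotopic A x y p q) (h' : Λ.PathHomotopic A x y q r) :
    Λ.PathHomotopic A x y p r :=
  Relation.EqvGen.trans _ _ _ h h'

theorem Move.context {p q : List Λ.Step} (h : Λ.Move A p q) (l m : List Λ.Step) :
    Λ.Move A (l ++ p ++ m) (l ++ q ++ m) := by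
  cases h with
  | backtrack p q s hs =>
    have := Move.backtrack (l ++ p) (q ++ m) s hs
    simpa only [List.append_assoc] using this
  | tile p q d hd =>
    have := Move.tile (l ++ p) (q ++ m) d hd
    simpa only [List.append_assoc] using this

theorem PathHomotopic.context {x y z u : Λ.Point} {p q l m : List Λ.Step}
    (h : Λ.PathHomotopic A y z p q) (hl : Λ.IsPath A x y l) (hm : Λ.IsPath A z u m) :
    Λ.PathHomotopic A x u (l ++ p ++ m) (l ++ q ++ m) := by
  induction h with
  | rel p q h =>
    exact Relation.EqvGen.rel _ _ ⟨(hl.append h.1).append hm, (hl.append h.2.1).append hm,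
      h.2.2.context l m⟩
  | refl => exact .refl _
  | symm _ _ _ ih => exact ih.symm
  | trans _ _ _ _ _ ih1 ih2 => exact ih1.trans ih2

theorem PathHomotopic.append_left {x y z : Λ.Point} {p q l : List Λ.Step}
    (h : Λ.PathHomotopic A y z p q) (hl : Λ.IsPath A x y l) :
    Λ.PathHomotopic A x z (l ++ p) (l ++ q) := by
  have := h.context hl (m := []) rfl
  simpa only [List.append_nil] using this

theorem PathHomotopic.append_right {x y z : Λ.Point} {p q m : List Λ.Step}
    (h : Λ.PathHomotopic A x y p q) (hm : Λ.IsPath A y z m) :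
    Λ.PathHomotopic A x z (p ++ m) (q ++ m) :=
  h.context (l := []) rfl hm

theorem pathHomotopic_backtrack {s : Λ.Step} (hs : s.InRegion A) :
    Λ.PathHomotopic A s.source s.source [s, s.reverse] [] := by
  refine Relation.EqvGen.rel _ _ ⟨⟨hs, rfl, hs, ?_, ?_⟩, rfl, Move.backtrack [] [] s hs⟩ <;>
    simp [IsPath]

theorem IsPath.reversePath_append_self {x y : Λ.Point} {p : List Λ.Step}
    (hp : Λ.IsPath A x y p) : Λ.PathHomotopic A y y (CellulatedSurface.reversePath p ++ p) [] := by
  induction p generalizing x with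
  | nil => exact .refl _
  | cons s p ih =>
    have h1 := pathHomotopic_backtrack (A := A) (s := s.reverse) hp.1
    rw [Step.source_reverse, Step.reverse_reverse] at h1
    have h2 := h1.context hp.2.2.reversePath hp.2.2
    rw [CellulatedSurface.reversePath_cons]
    simp only [List.append_assoc, List.cons_append, List.nil_append] at h2 ⊢
    exact h2.trans (ih hp.2.2)

theorem pathHomotopic_tileBoundary {d : Λ.Dart} (hd : Λ.edge d ∈ A)
    (h : Λ.IsPath A (Sum.inl (Λ.vert d)) (Sum.inl (Λ.vert d)) (Λ.tileBoundary d)) :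
    Λ.PathHomotopic A (Sum.inl (Λ.vert d)) (Sum.inl (Λ.vert d)) (Λ.tileBoundary d) [] :=
  Relation.EqvGen.rel _ _ ⟨h, rfl, by simpa using Move.tile (A := A) [] [] d hd⟩

/-- A closed path may be read from another one of its points. -/
theorem PathHomotopic.rotate {x y : Λ.Point} {p q : List Λ.Step} (hp : Λ.IsPath A x y p)
    (hq : Λ.IsPath A y x q) (h : Λ.PathHomotopic A x x (p ++ q) []) :
    Λ.PathHomotopic A y y (q ++ p) [] := by
  have h1 := hp.reversePath_append_self
  have h2 : Λ.PathHomotopic A y y (reversePath p ++ (p ++ q) ++ p) (q ++ p) := by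
    have := h1.append_right (hq.append hp)
    simpa only [List.append_assoc, List.nil_append] using this
  have h3 := h.context hp.reversePath hp
  rw [List.append_nil] at h3
  exact h2.symm.trans (h3.trans h1)

/-- If the closed path `p q⁻¹` is contractible, then `p` and `q` are homotopic. -/
theorem PathHomotopic.of_append_reversePath {x y : Λ.Point} {p q : List Λ.Step}
    (hp : Λ.IsPath A x y p) (hq : Λ.IsPath A x y q)
    (h : Λ.PathHomotopic A x x (p ++ reversePath q) []) : Λ.PathHomotopic A x y p q := by
  have h1 := h.append_right hq
  have h2 := hq.reversePath_append_self.append_left hp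
  rw [List.append_nil] at h2
  simp only [List.append_assoc, List.nil_append] at h1 h2
  exact h2.symm.trans h1

/-! ### The distance of qubits -/

theorem tileGraph_reachable_of_touch {e e' : Λ.Edge} (h : Λ.Touch e e') :
    Λ.tileGraph.Reachable e e' := by
  by_cases he : e = e'
  · rw [he]
  · exact SimpleGraph.Adj.reachable ((SimpleGraph.fromRel_adj _ _ _).2 ⟨he, Or.inl h⟩)

theorem tileGraph_reachable (e e' : Λ.Edge) : Λ.tileGraph.Reachable e e' := by
  obtain ⟨d, rfl⟩ := Λ.edge_surjective e
  obtain ⟨d', rfl⟩ := Λ.edge_surjective e'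
  obtain ⟨g, hg, rfl⟩ := Λ.connected d d'
  have key : ∀ g ∈ Subgroup.closure {Λ.rot, Λ.flip}, ∀ d,
      Λ.tileGraph.Reachable (Λ.edge d) (Λ.edge (g d)) := by
    intro g hg
    induction hg using Subgroup.closure_induction with
    | mem g hg =>
      intro d
      obtain rfl | rfl := hg
      · exact tileGraph_reachable_of_touch ⟨d, Λ.rot d, rfl, rfl, Or.inl (Λ.vert_rot d).symm⟩
      · rw [Λ.edge_flip]
    | one => exact fun d => .rfl
    | mul g h _ _ ihg ihh => exact fun d => (ihh d).trans (ihg _)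
    | inv g _ ih =>
      intro d
      have := ih (g⁻¹ d)
      have h : g (g⁻¹ d) = d := g.apply_symm_apply d
      rw [h] at this
      exact this.symm
  exact key g hg d

/-- A lower bound for the length of the walks between two regions is one for their distance. Since
the surface is connected, the distance `0` of unreachable vertices does not occur. -/
theorem le_regionDist {A C : Finset Λ.Edge} (hA : A.Nonempty) (hC : C.Nonempty) {n : ℕ}
    (h : ∀ a ∈ A, ∀ c ∈ C, ∀ p : Λ.tileGraph.Walk a c, n ≤ p.length) :
    n ≤ Λ.regionDist A C := by
  obtain ⟨a, ha⟩ := hA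
  obtain ⟨c, hc⟩ := hC
  obtain ⟨a', ha', c', hc', hn⟩ := Nat.sInf_mem
    (s := {n | ∃ a ∈ A, ∃ c ∈ C, n = Λ.tileGraph.dist a c}) ⟨_, a, ha, c, hc, rfl⟩
  obtain ⟨p, hp⟩ := (tileGraph_reachable a' c').exists_walk_length_eq_dist
  rw [regionDist, hn, ← hp]
  exact h a' ha' c' hc' p

/-! ### Rectangular regions -/

/-- Coordinates of a quadrangulation which looks, locally, like the square grid: the points
`pt i j`, the sides `hstep i j` and `vstep i j` from `pt i j` to `pt (i + 1) j` and to
`pt i (j + 1)`, and the tiles `tile i j` with the lower left corner `pt i j`. They may be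
periodic. -/
structure GridChart (Λ : CellulatedSurface) where
  pt : ℤ → ℤ → Λ.Point
  tile : ℤ → ℤ → Λ.Edge
  hstep : ℤ → ℤ → Λ.Step
  vstep : ℤ → ℤ → Λ.Step
  hstep_source : ∀ i j, (hstep i j).source = pt i j
  hstep_target : ∀ i j, (hstep i j).target = pt (i + 1) j
  vstep_source : ∀ i j, (vstep i j).source = pt i j
  vstep_target : ∀ i j, (vstep i j).target = pt i (j + 1)
  hstep_inRegion : ∀ i j A, (hstep i j).InRegion A ↔ tile i j ∈ A ∨ tile i (j - 1) ∈ A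
  vstep_inRegion : ∀ i j A, (vstep i j).InRegion A ↔ tile i j ∈ A ∨ tile (i - 1) j ∈ A
  eq_step : ∀ i j (s : Λ.Step), s.source = pt i j → s = hstep i j ∨ s = vstep i j ∨
    s = (hstep (i - 1) j).reverse ∨ s = (vstep i (j - 1)).reverse
  corner : ∀ i j d, Λ.edge d = tile i j →
    (∃ a b : ℤ, 0 ≤ a ∧ a ≤ 1 ∧ 0 ≤ b ∧ b ≤ 1 ∧ Sum.inl (Λ.vert d) = pt (i + a) (j + b)) ∧
    ∃ a b : ℤ, 0 ≤ a ∧ a ≤ 1 ∧ 0 ≤ b ∧ b ≤ 1 ∧ Sum.inr (Λ.face d) = pt (i + a) (j + b)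
  square : ∀ i j A, tile i j ∈ A → Λ.PathHomotopic A (pt i j) (pt (i + 1) (j + 1))
    [vstep i j, hstep i (j + 1)] [hstep i j, vstep (i + 1) j]

namespace GridChart

variable (G : GridChart Λ)

/-- The square of `n × n` tiles with the lower left corner `pt 0 0`. -/
def block (n : ℕ) : Finset Λ.Edge :=
  (Finset.range n ×ˢ Finset.range n).image fun i => G.tile i.1 i.2

theorem mem_block {n : ℕ} {e : Λ.Edge} :
    e ∈ G.block n ↔ ∃ i j : ℕ, i < n ∧ j < n ∧ G.tile i j = e := by
  simp only [block, Finset.mem_image, Finset.mem_product, Finset.mem_range, Prod.exists, and_assoc]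

/-- The coordinates of the tiles are injective on the square and on the tiles next to it. -/
def TileInjOn (n : ℕ) : Prop :=
  ∀ i j i' j' : ℤ, -1 ≤ i → i ≤ n → -1 ≤ j → j ≤ n → 0 ≤ i' → i' < n → 0 ≤ j' → j' < n →
    G.tile i j = G.tile i' j' → i = i' ∧ j = j'

/-- The coordinates of the points are injective on the closed square. -/
def PtInjOn (n : ℕ) : Prop :=
  ∀ i j i' j' : ℕ, i ≤ n → j ≤ n → i' ≤ n → j' ≤ n → G.pt i j = G.pt i' j' → i = i' ∧ j = j'

variable {G} {n : ℕ}

theorem TileInjOn.mem_block_iff (h : G.TileInjOn n) {i j : ℤ} (hi : -1 ≤ i) (hi' : i ≤ n)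
    (hj : -1 ≤ j) (hj' : j ≤ n) :
    G.tile i j ∈ G.block n ↔ 0 ≤ i ∧ i < n ∧ 0 ≤ j ∧ j < n := by
  rw [mem_block]
  constructor
  · rintro ⟨a, b, ha, hb, hab⟩
    obtain ⟨rfl, rfl⟩ := h i j a b hi hi' hj hj' (by lia) (by lia) (by lia) (by lia) hab.symm
    lia
  · rintro ⟨h1, h2, h3, h4⟩
    refine ⟨i.toNat, j.toNat, by lia, by lia, ?_⟩
    rw [Int.toNat_of_nonneg h1, Int.toNat_of_nonneg h3]

theorem tile_mem_block {i j : ℕ} (hi : i < n) (hj : j < n) : G.tile i j ∈ G.block n :=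
  G.mem_block.2 ⟨i, j, hi, hj, rfl⟩

theorem hstep_mem_block {i j : ℕ} (hi : i < n) (hj : j ≤ n) :
    (G.hstep i j).InRegion (G.block n) := by
  rw [G.hstep_inRegion]
  rcases hj.lt_or_eq with h | rfl
  · exact Or.inl (tile_mem_block hi h)
  · obtain ⟨m, rfl⟩ : ∃ m, j = m + 1 := ⟨j - 1, by lia⟩
    right
    have := tile_mem_block (G := G) hi (Nat.lt_succ_self m)
    simpa using this

theorem vstep_mem_block {i j : ℕ} (hi : i ≤ n) (hj : j < n) :
    (G.vstep i j).InRegion (G.block n) := by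
  rw [G.vstep_inRegion]
  rcases hi.lt_or_eq with h | rfl
  · exact Or.inl (tile_mem_block h hj)
  · obtain ⟨m, rfl⟩ : ∃ m, i = m + 1 := ⟨i - 1, by lia⟩
    right
    have := tile_mem_block (G := G) (Nat.lt_succ_self m) hj
    simpa using this

variable (G) in
/-- The path from `pt 0 0` to `pt i j` that first goes to `pt i 0`. -/
def canon (i : ℕ) : ℕ → List Λ.Step
  | 0 => (List.range i).map fun k => G.hstep k 0
  | j + 1 => canon i j ++ [G.vstep i j]

theorem canon_succ_zero (i : ℕ) : G.canon (i + 1) 0 = G.canon i 0 ++ [G.hstep i 0] := by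
  simp [canon, List.range_succ]

theorem isPath_canon {i : ℕ} (hi : i ≤ n) : ∀ {j : ℕ}, j ≤ n →
    Λ.IsPath (G.block n) (G.pt 0 0) (G.pt i j) (G.canon i j)
  | 0, _ => by
    induction i with
    | zero => rfl
    | succ i ih =>
      rw [canon_succ_zero]
      refine (ih (by lia)).append ?_
      have := isPath_singleton (hstep_mem_block (G := G) (i := i) (j := 0) (n := n) (by lia)
        (by lia))
      rw [G.hstep_source, G.hstep_target] at this
      exact_mod_cast this
  | j + 1, hj => by
    refine (isPath_canon hi (by lia : j ≤ n)).append ?_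
    have := isPath_singleton (vstep_mem_block (G := G) (i := i) (j := j) hi (by lia))
    rw [G.vstep_source, G.vstep_target] at this
    exact_mod_cast this

/-- The canonical paths are compatible, up to homotopy, with horizontal steps: the square between
two neighbouring paths is filled tile by tile. -/
theorem canon_append_hstep {i : ℕ} (hi : i < n) : ∀ {j : ℕ}, j ≤ n →
    Λ.PathHomotopic (G.block n) (G.pt 0 0) (G.pt (i + 1 : ℕ) j) (G.canon i j ++ [G.hstep i j])
      (G.canon (i + 1) j)
  | 0, _ => by
    rw [canon_succ_zero]
    exact .refl _
  | j + 1, hj => by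
    have h1 := (G.square i j _ (tile_mem_block hi (by lia : j < n))).append_left
      (isPath_canon hi.le (by lia : j ≤ n))
    have h2 := isPath_singleton (vstep_mem_block (G := G) (i := i + 1) (j := j) hi (by lia))
    rw [G.vstep_source, G.vstep_target] at h2
    have h3 := (canon_append_hstep hi (by lia : j ≤ n)).append_right h2
    simp only [List.append_assoc, List.cons_append, List.nil_append] at h3
    simp only [canon, List.append_assoc, List.cons_append, List.nil_append]
    push_cast at h1 h3 ⊢
    exact h1.trans h3

/-- Extension of a canonical path by a step is homotopic to the canonical path to the new end point.
-/
theorem canon_append_step (h : G.TileInjOn n) {i j : ℕ} (hi : i ≤ n) (hj : j ≤ n) {s : Λ.Step}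
    (hs : s.source = G.pt i j) (hsA : s.InRegion (G.block n)) :
    ∃ i' j' : ℕ, i' ≤ n ∧ j' ≤ n ∧ s.target = G.pt i' j' ∧
      Λ.PathHomotopic (G.block n) (G.pt 0 0) (G.pt i' j') (G.canon i j ++ [s])
        (G.canon i' j') := by
  rcases G.eq_step i j s hs with rfl | rfl | rfl | rfl
  · rw [G.hstep_inRegion, h.mem_block_iff (by lia) (by lia) (by lia) (by lia),
      h.mem_block_iff (by lia) (by lia) (by lia) (by lia)] at hsA
    have hi' : i < n := by lia
    exact ⟨i + 1, j, hi', hj, by rw [G.hstep_target]; push_cast; rfl, canon_append_hstep hi' hj⟩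
  · rw [G.vstep_inRegion, h.mem_block_iff (by lia) (by lia) (by lia) (by lia),
      h.mem_block_iff (by lia) (by lia) (by lia) (by lia)] at hsA
    exact ⟨i, j + 1, hi, by lia, by rw [G.vstep_target]; push_cast; rfl, .refl _⟩
  · have hsA' : (G.hstep (i - 1) j).InRegion (G.block n) := hsA
    rw [G.hstep_inRegion, h.mem_block_iff (by lia) (by lia) (by lia) (by lia),
      h.mem_block_iff (by lia) (by lia) (by lia) (by lia)] at hsA'
    obtain ⟨k, rfl⟩ : ∃ k, i = k + 1 := ⟨i - 1, by lia⟩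
    have e : ((k + 1 : ℕ) : ℤ) - 1 = k := by push_cast; ring
    rw [e] at hsA ⊢
    refine ⟨k, j, by lia, hj, by rw [Step.target_reverse, G.hstep_source], ?_⟩
    have h1 := isPath_singleton hsA
    rw [Step.source_reverse, Step.target_reverse, G.hstep_source, G.hstep_target] at h1
    have h2 := (canon_append_hstep (G := G) (by lia : k < n) hj).append_right
      (z := G.pt k j) (m := [(G.hstep k j).reverse]) (by exact_mod_cast h1)
    have h3 := pathHomotopic_backtrack (s := G.hstep k j) hsA
    rw [G.hstep_source] at h3
    have h4 := h3.append_left (isPath_canon (by lia : k ≤ n) hj)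
    simp only [List.append_assoc, List.cons_append, List.nil_append, List.append_nil] at h2 h4
    exact h2.symm.trans h4
  · have hsA' : (G.vstep i (j - 1)).InRegion (G.block n) := hsA
    rw [G.vstep_inRegion, h.mem_block_iff (by lia) (by lia) (by lia) (by lia),
      h.mem_block_iff (by lia) (by lia) (by lia) (by lia)] at hsA'
    obtain ⟨k, rfl⟩ : ∃ k, j = k + 1 := ⟨j - 1, by lia⟩
    have e : ((k + 1 : ℕ) : ℤ) - 1 = k := by push_cast; ring
    rw [e] at hsA ⊢
    refine ⟨i, k, hi, by lia, by rw [Step.target_reverse, G.vstep_source], ?_⟩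
    have h3 := pathHomotopic_backtrack (s := G.vstep i k) hsA
    rw [G.vstep_source] at h3
    have h4 := h3.append_left (isPath_canon hi (by lia : k ≤ n))
    simp only [canon, List.append_assoc, List.cons_append, List.nil_append, List.append_nil] at h4 ⊢
    exact h4

/-- Every path in a square of tiles is, relative to the canonical paths, homotopically trivial. -/
theorem canon_append_path (h : G.TileInjOn n) {y : Λ.Point} {p : List Λ.Step} :
    ∀ {i j : ℕ}, i ≤ n → j ≤ n → Λ.IsPath (G.block n) (G.pt i j) y p →
    ∃ i' j' : ℕ, i' ≤ n ∧ j' ≤ n ∧ y = G.pt i' j' ∧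
      Λ.PathHomotopic (G.block n) (G.pt 0 0) (G.pt i' j') (G.canon i j ++ p) (G.canon i' j') := by
  induction p with
  | nil =>
    intro i j hi hj hp
    refine ⟨i, j, hi, hj, Eq.symm hp, ?_⟩
    rw [List.append_nil]
    exact .refl _
  | cons s p ih =>
    intro i j hi hj hp
    obtain ⟨a, b, ha, hb, hab, h1⟩ := canon_append_step h hi hj hp.2.1 hp.1
    have hp' := hp.2.2
    rw [hab] at hp'
    obtain ⟨i', j', hi', hj', rfl, h2⟩ := ih ha hb hp'
    refine ⟨i', j', hi', hj', rfl, ?_⟩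
    have h3 := h1.append_right hp'
    simp only [List.append_assoc, List.cons_append, List.nil_append] at h3
    exact h3.trans h2

theorem exists_of_pointInRegion {x : Λ.Point} (hx : Λ.PointInRegion (G.block n) x) :
    ∃ i j : ℕ, i ≤ n ∧ j ≤ n ∧ x = G.pt i j := by
  obtain ⟨d, hd, hx⟩ := hx
  obtain ⟨i, j, hi, hj, hij⟩ := G.mem_block.1 hd
  obtain ⟨h1, h2⟩ := G.corner i j d hij.symm
  rcases hx with rfl | rfl
  · obtain ⟨a, b, ha, ha', hb, hb', h⟩ := h1
    refine ⟨(i + a).toNat, (j + b).toNat, by lia, by lia, ?_⟩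
    rw [h, Int.toNat_of_nonneg (by lia), Int.toNat_of_nonneg (by lia)]
  · obtain ⟨a, b, ha, ha', hb, hb', h⟩ := h2
    refine ⟨(i + a).toNat, (j + b).toNat, by lia, by lia, ?_⟩
    rw [h, Int.toNat_of_nonneg (by lia), Int.toNat_of_nonneg (by lia)]

/-- A square of tiles which does not wrap around the surface is simply connected. -/
theorem isSimplyConnected_block (hn : 0 < n) (ht : G.TileInjOn n) (hp : G.PtInjOn n) :
    Λ.IsSimplyConnected (G.block n) := by
  refine ⟨⟨_, tile_mem_block hn hn⟩, fun x y hx hy => ?_, fun x hx p hpath => ?_⟩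
  · obtain ⟨i, j, hi, hj, rfl⟩ := exists_of_pointInRegion hx
    obtain ⟨i', j', hi', hj', rfl⟩ := exists_of_pointInRegion hy
    exact ⟨_, (isPath_canon hi hj).reversePath.append (isPath_canon hi' hj')⟩
  · obtain ⟨i, j, hi, hj, rfl⟩ := exists_of_pointInRegion hx
    obtain ⟨i', j', hi', hj', h1, h2⟩ := canon_append_path ht hi hj hpath
    obtain ⟨rfl, rfl⟩ := hp i j i' j' hi hj hi' hj' h1
    have h3 := isPath_canon (G := G) hi hj
    have h4 := h3.reversePath_append_self
    have h5 := h2.append_left h3.reversePath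
    have h6 := h4.append_right hpath
    simp only [List.append_assoc, List.nil_append] at h5 h6
    exact h6.symm.trans (h5.trans h4)

end GridChart

end CellulatedSurface

namespace SquareTorus

variable {L : ℕ}

/-! ### The quadrangulation of the torus -/

/-- The vertices (`Sum.inl`) and the faces (`Sum.inr`) of the square lattice. They form a square
grid, rotated by 45 degrees. -/
abbrev GridPoint (L : ℕ) : Type := Site L ⊕ Site L

/-- The step of the rotated grid by half a lattice spacing to the upper right. -/
def moveRight (L : ℕ) : Equiv.Perm (GridPoint L) where
  toFun := Sum.elim (fun v => Sum.inr v) fun f => Sum.inl (f + (1, 1))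
  invFun := Sum.elim (fun v => Sum.inr (v - (1, 1))) fun f => Sum.inl f
  left_inv x := by rcases x with x | x <;> simp
  right_inv x := by rcases x with x | x <;> simp

/-- The step of the rotated grid by half a lattice spacing to the upper left. -/
def moveUp (L : ℕ) : Equiv.Perm (GridPoint L) where
  toFun := Sum.elim (fun v => Sum.inr (v - (1, 0))) fun f => Sum.inl (f + (0, 1))
  invFun := Sum.elim (fun v => Sum.inr (v - (0, 1))) fun f => Sum.inl (f + (1, 0))
  left_inv x := by rcases x with x | x <;> simp
  right_inv x := by rcases x with x | x <;> simp

/-- The translations of the lattice. -/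
def shift (L : ℕ) (c : Site L) : Equiv.Perm (GridPoint L) :=
  Equiv.Perm.sumCongr (Equiv.addRight c) (Equiv.addRight c)

theorem shift_mul (c d : Site L) : shift L c * shift L d = shift L (c + d) := by
  refine Equiv.ext fun x => ?_
  rcases x with x | x
  · exact congrArg Sum.inl (by rw [add_comm c]; exact add_assoc x d c)
  · exact congrArg Sum.inr (by rw [add_comm c]; exact add_assoc x d c)

theorem shift_zpow (c : Site L) (n : ℤ) : shift L c ^ n = shift L (n • c) := by
  have h0 : shift L 0 = 1 := by
    refine Equiv.ext fun x => ?_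
    rcases x with x | x
    · exact congrArg Sum.inl (add_zero x)
    · exact congrArg Sum.inr (add_zero x)
  induction n using Int.induction_on with
  | zero => rw [zpow_zero, zero_smul, h0]
  | succ n ih => rw [zpow_add_one, ih, shift_mul, add_smul, one_smul]
  | pred n ih =>
    rw [← mul_left_inj (shift L c), ← zpow_add_one, sub_add_cancel, ih, shift_mul, sub_smul,
      one_smul, sub_add_cancel]

theorem moveRight_mul_moveUp : moveRight L * moveUp L = shift L (0, 1) := by
  ext1 x
  rcases x with ⟨x, y⟩ | ⟨x, y⟩
  · change (Sum.inl ((x, y) - (1, 0) + (1, 1)) : GridPoint L) = Sum.inl ((x, y) + (0, 1))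
    simp
  · change (Sum.inr ((x, y) + (0, 1)) : GridPoint L) = Sum.inr ((x, y) + (0, 1))
    rfl

theorem commute_move : Commute (moveRight L) (moveUp L) := by
  refine Equiv.ext fun x => ?_
  rcases x with ⟨x, y⟩ | ⟨x, y⟩
  · change (Sum.inl ((x, y) - (1, 0) + (1, 1)) : GridPoint L) = Sum.inl ((x, y) + (0, 1))
    simp
  · change (Sum.inr ((x, y) + (0, 1)) : GridPoint L) = Sum.inr ((x, y) + (1, 1) - (1, 0))
    simp

theorem moveRight_pt (i j : ℤ) (b : GridPoint L) :
    (moveRight L ^ (i + 1) * moveUp L ^ j) b =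
      moveRight L ((moveRight L ^ i * moveUp L ^ j) b) := by
  rw [add_comm, zpow_one_add, mul_assoc, Equiv.Perm.mul_apply]

theorem moveUp_pt (i j : ℤ) (b : GridPoint L) :
    (moveRight L ^ i * moveUp L ^ (j + 1)) b = moveUp L ((moveRight L ^ i * moveUp L ^ j) b) := by
  rw [add_comm, zpow_one_add, ← mul_assoc, (commute_move.zpow_left i).eq, mul_assoc,
    Equiv.Perm.mul_apply]

theorem moveRight_inv_pt (i j : ℤ) (b : GridPoint L) :
    (moveRight L)⁻¹ ((moveRight L ^ i * moveUp L ^ j) b) =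
      (moveRight L ^ (i - 1) * moveUp L ^ j) b := by
  rw [Equiv.Perm.inv_eq_iff_eq, ← moveRight_pt, sub_add_cancel]

theorem moveUp_inv_pt (i j : ℤ) (b : GridPoint L) :
    (moveUp L)⁻¹ ((moveRight L ^ i * moveUp L ^ j) b) =
      (moveRight L ^ i * moveUp L ^ (j - 1)) b := by
  rw [Equiv.Perm.inv_eq_iff_eq, ← moveUp_pt, sub_add_cancel]

theorem moveRight_mul_moveUp_inv : moveRight L * (moveUp L)⁻¹ = shift L (1, 0) := by
  ext1 x
  rcases x with ⟨x, y⟩ | ⟨x, y⟩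
  · change (Sum.inl ((x, y) - (0, 1) + (1, 1)) : GridPoint L) = Sum.inl ((x, y) + (1, 0))
    simp
  · change (Sum.inr ((x, y) + (1, 0)) : GridPoint L) = Sum.inr ((x, y) + (1, 0))
    rfl

/-- The moves of the rotated grid with an even number of steps are translations of the lattice. -/
theorem move_zpow (a b : ℤ) : moveRight L ^ (b + a) * moveUp L ^ (b - a) =
    shift L ((a : ZMod L), (b : ZMod L)) := by
  have h1 : shift L (0, 1) ^ b * shift L (1, 0) ^ a = shift L ((a : ZMod L), (b : ZMod L)) := by
    rw [shift_zpow, shift_zpow]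
    ext1 x
    rcases x with ⟨x, y⟩ | ⟨x, y⟩ <;> simp [shift]
  rw [← h1, ← moveRight_mul_moveUp, ← moveRight_mul_moveUp_inv, commute_move.mul_zpow,
    commute_move.inv_right.mul_zpow, inv_zpow', zpow_add, sub_eq_add_neg, zpow_add]
  have h := (commute_move (L := L)).zpow_zpow a b
  rw [mul_assoc, mul_assoc, ← mul_assoc (moveRight L ^ a), h.eq, mul_assoc]

/-- The steps of the rotated grid generate a free action up to the periodicity of the lattice. -/
theorem eq_zero_of_move_eq {p q : ℤ} (hp : |p| < L) (hq : |q| < L) {x : GridPoint L}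
    (h : (moveRight L ^ p * moveUp L ^ q) x = x) : p = 0 ∧ q = 0 := by
  obtain ⟨b, hb | hb⟩ := Int.even_or_odd' (p + q)
  · obtain ⟨a, ha⟩ : ∃ a, p = b + a := ⟨p - b, by ring⟩
    obtain rfl : q = b - a := by lia
    subst ha
    rw [move_zpow] at h
    have h1 : (a : ZMod L) = 0 ∧ (b : ZMod L) = 0 := by
      rcases x with ⟨x, y⟩ | ⟨x, y⟩ <;> simpa [shift] using h
    have h2 : a = 0 := Int.eq_zero_of_abs_lt_dvd ((ZMod.intCast_zmod_eq_zero_iff_dvd a L).1 h1.1)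
      (abs_lt.2 (by rw [abs_lt] at hp hq; lia))
    have h3 : b = 0 := Int.eq_zero_of_abs_lt_dvd ((ZMod.intCast_zmod_eq_zero_iff_dvd b L).1 h1.2)
      (abs_lt.2 (by rw [abs_lt] at hp hq; lia))
    lia
  · exfalso
    obtain ⟨a, ha⟩ : ∃ a, p = 1 + (b + a) := ⟨p - b - 1, by ring⟩
    obtain rfl : q = b - a := by lia
    subst ha
    rw [zpow_one_add, mul_assoc, move_zpow] at h
    rcases x with x | x <;> simp [shift, moveRight] at h

/-- The qubit whose tile has the lower corner `x`. -/
def tileOf (L : ℕ) : GridPoint L → Edge L :=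
  Sum.elim (fun v => (v, 1)) fun f => (f + (0, 1), 0)

theorem tileOf_injective : Function.Injective (tileOf L) := by
  rintro (x | x) (y | y) h <;> simp [tileOf] at h <;> simp [h]

theorem tileOf_surjective : Function.Surjective (tileOf L) := by
  rintro ⟨v, k⟩
  fin_cases k
  · exact ⟨Sum.inr (v - (0, 1)), by simp [tileOf]⟩
  · exact ⟨Sum.inl v, rfl⟩

/-- The side of the tiles from `x` to `moveRight L x`. -/
def rightStep (L : ℕ) : GridPoint L → Dart L × Bool :=
  Sum.elim (fun v => ((v, 0), true)) fun f => ((f + (1, 1), 2), false)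

/-- The side of the tiles from `x` to `moveUp L x`. -/
def upStep (L : ℕ) : GridPoint L → Dart L × Bool :=
  Sum.elim (fun v => ((v, 1), true)) fun f => ((f + (0, 1), 3), false)

/-- The corners of a tile in the rotated grid: the starting point of a dart of its edge and the face
beside this dart. -/
theorem tile_corners (x : GridPoint L) (d : Dart L) (h : edge L d = tileOf L x) :
    ((Sum.inl d.1 : GridPoint L) = x ∧ Sum.inr (face L d) = moveUp L x) ∨
    ((Sum.inl d.1 : GridPoint L) = moveUp L (moveRight L x) ∧
      Sum.inr (face L d) = moveRight L x) ∨
    ((Sum.inl d.1 : GridPoint L) = moveUp L x ∧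
      Sum.inr (face L d) = moveUp L (moveRight L x)) ∨
    ((Sum.inl d.1 : GridPoint L) = moveRight L x ∧ Sum.inr (face L d) = x) := by
  obtain ⟨⟨a, b⟩, k⟩ := d
  rcases x with ⟨x, y⟩ | ⟨x, y⟩ <;> fin_cases k <;>
    simp [edge, tileOf, face, moveUp, moveRight, sub_eq_iff_eq_add] at h ⊢ <;> simp [h]

variable [NeZero L]

open CellulatedSurface

theorem rightStep_source (x : GridPoint L) :
    Step.source (Λ := squareTorus L) (rightStep L x) = x := by
  rcases x with ⟨x, y⟩ | ⟨x, y⟩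
  · rfl
  · change (Sum.inr ((x, y) + (1, 1) - (1, 1)) : GridPoint L) = Sum.inr (x, y)
    simp

theorem rightStep_target (x : GridPoint L) :
    Step.target (Λ := squareTorus L) (rightStep L x) = moveRight L x := by
  rcases x with ⟨x, y⟩ | ⟨x, y⟩ <;> rfl

theorem upStep_source (x : GridPoint L) :
    Step.source (Λ := squareTorus L) (upStep L x) = x := by
  rcases x with ⟨x, y⟩ | ⟨x, y⟩
  · rfl
  · change (Sum.inr ((x, y) + (0, 1) - (0, 1)) : GridPoint L) = Sum.inr (x, y)
    simp

theorem upStep_target (x : GridPoint L) :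
    Step.target (Λ := squareTorus L) (upStep L x) = moveUp L x := by
  rcases x with ⟨x, y⟩ | ⟨x, y⟩ <;> rfl

theorem rightStep_inRegion (x : GridPoint L) (A : Finset (squareTorus L).Edge) :
    Step.InRegion (Λ := squareTorus L) A (rightStep L x) ↔
      tileOf L x ∈ A ∨ tileOf L ((moveUp L)⁻¹ x) ∈ A := by
  rcases x with ⟨x, y⟩ | ⟨x, y⟩
  · have h : tileOf L ((moveUp L)⁻¹ (Sum.inl (x, y))) = ((x, y), 0) := by
      change (((x, y) - (0, 1) + (0, 1), 0) : Edge L) = _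
      simp
    rw [h]
    exact or_comm
  · have h : edge L (((x, y) + (1, 1), 2) : Dart L) = tileOf L (Sum.inr (x, y)) := by
      change (((x, y) + (1, 1) - (1, 0), 0) : Edge L) = ((x, y) + (0, 1), 0)
      simp
    have h' : edge L (((x, y) + (1, 1), 3) : Dart L) =
        tileOf L ((moveUp L)⁻¹ (Sum.inr (x, y))) := by
      change (((x, y) + (1, 1) - (0, 1), 1) : Edge L) = ((x, y) + (1, 0), 1)
      simp
    rw [← h, ← h']
    rfl

theorem upStep_inRegion (x : GridPoint L) (A : Finset (squareTorus L).Edge) :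
    Step.InRegion (Λ := squareTorus L) A (upStep L x) ↔
      tileOf L x ∈ A ∨ tileOf L ((moveRight L)⁻¹ x) ∈ A := by
  rcases x with ⟨x, y⟩ | ⟨x, y⟩
  · have h : tileOf L ((moveRight L)⁻¹ (Sum.inl (x, y))) = ((x, y) - (1, 0), 0) := by
      change (((x, y) - (1, 1) + (0, 1), 0) : Edge L) = _
      simp
    rw [h]
    rfl
  · have h : edge L (((x, y) + (0, 1), 3) : Dart L) =
        tileOf L ((moveRight L)⁻¹ (Sum.inr (x, y))) := by
      change (((x, y) + (0, 1) - (0, 1), 1) : Edge L) = ((x, y), 1)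
      simp
    rw [← h, or_comm]
    rfl

/-- Four sides of tiles start at every point. -/
theorem eq_step_of_source (s : Dart L × Bool) (x : GridPoint L)
    (hs : Step.source (Λ := squareTorus L) s = x) :
    s = rightStep L x ∨ s = upStep L x ∨
      s = Step.reverse (Λ := squareTorus L) (rightStep L ((moveRight L)⁻¹ x)) ∨
      s = Step.reverse (Λ := squareTorus L) (upStep L ((moveUp L)⁻¹ x)) := by
  subst hs
  obtain ⟨⟨⟨x, y⟩, k⟩, b⟩ := s
  cases b <;> fin_cases k
  · exact Or.inr (Or.inr (Or.inl rfl))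
  · refine Or.inr (Or.inr (Or.inr ?_))
    change ((((x, y), 1), false) : Dart L × Bool) = (((x, y) - (1, 0) + (1, 0), 1), false)
    simp
  · refine Or.inl ?_
    change ((((x, y), 2), false) : Dart L × Bool) = (((x, y) - (1, 1) + (1, 1), 2), false)
    simp
  · refine Or.inr (Or.inl ?_)
    change ((((x, y), 3), false) : Dart L × Bool) = (((x, y) - (0, 1) + (0, 1), 3), false)
    simp
  · exact Or.inl rfl
  · exact Or.inr (Or.inl rfl)
  · refine Or.inr (Or.inr (Or.inl ?_))
    change ((((x, y), 2), true) : Dart L × Bool) = (((x, y) - (1, 1) + (1, 1), 2), true)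
    simp
  · refine Or.inr (Or.inr (Or.inr ?_))
    change ((((x, y), 3), true) : Dart L × Bool) = (((x, y) - (0, 1) + (0, 1), 3), true)
    simp

/-- The two ways around a tile are homotopic; the boundary of a tile is read from its lower corner,
which is a vertex or a face. -/
theorem square_homotopic (x : GridPoint L) {A : Finset (squareTorus L).Edge}
    (hA : tileOf L x ∈ A) :
    (squareTorus L).PathHomotopic A x (moveUp L (moveRight L x))
      [upStep L x, rightStep L (moveUp L x)] [rightStep L x, upStep L (moveRight L x)] := by
  have hR := isPath_singleton ((rightStep_inRegion x A).2 (Or.inl hA))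
  have hU := isPath_singleton ((upStep_inRegion x A).2 (Or.inl hA))
  have hRU := isPath_singleton ((rightStep_inRegion (moveUp L x) A).2
    (Or.inr (by rwa [Equiv.Perm.inv_def, Equiv.symm_apply_apply])))
  have hUR := isPath_singleton ((upStep_inRegion (moveRight L x) A).2
    (Or.inr (by rwa [Equiv.Perm.inv_def, Equiv.symm_apply_apply])))
  rw [rightStep_source, rightStep_target] at hR hRU
  rw [upStep_source, upStep_target] at hU hUR
  have hcomm : moveRight L (moveUp L x) = moveUp L (moveRight L x) :=
    congrArg (fun g : Equiv.Perm (GridPoint L) => g x) commute_move.eq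
  rw [hcomm] at hRU
  have hp := hU.append hRU
  have hq := hR.append hUR
  refine PathHomotopic.of_append_reversePath hp hq ?_
  have key : ∀ (d : Dart L) (l : List (squareTorus L).Step), edge L d ∈ A →
      l = (squareTorus L).tileBoundary d →
      (squareTorus L).IsPath A (Sum.inl d.1) (Sum.inl d.1) l →
      (squareTorus L).PathHomotopic A (Sum.inl d.1) (Sum.inl d.1) l [] := by
    rintro d l hd rfl hl
    exact pathHomotopic_tileBoundary hd hl
  have hb : ∀ d d' : (squareTorus L).Dart, (squareTorus L).flip d = d' →
      (squareTorus L).tileBoundary d = [(d, true), ((squareTorus L).rot⁻¹ d', false), (d', true),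
        ((squareTorus L).rot⁻¹ d, false)] := by
    rintro d d' rfl
    rfl
  rcases x with ⟨x, y⟩ | ⟨x, y⟩
  · refine key ((x, y), 1) _ hA ?_ (hp.append hq.reversePath)
    refine Eq.trans ?_ (hb ((x, y), 1) ((x, y) + (0, 1), 3) rfl).symm
    change ([(((x, y), 1), true), (((x, y) - (1, 0) + (1, 1), 2), false),
      (((x, y) + (0, 1), 3), true), (((x, y), 0), false)] : List (Dart L × Bool)) =
      [(((x, y), 1), true), (((x, y) + (0, 1), 2), false), (((x, y) + (0, 1), 3), true),
        (((x, y), 0), false)]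
    simp
  · have h := key ((x, y) + (0, 1), 0) _ hA ?_ (hRU.append (hq.reversePath.append hU))
    · rw [← List.append_assoc] at h
      have h2 := PathHomotopic.rotate (hRU.append hq.reversePath) hU h
      rw [← List.append_assoc] at h2
      exact h2
    · refine Eq.trans ?_ (hb ((x, y) + (0, 1), 0) ((x, y) + (0, 1) + (1, 0), 2) rfl).symm
      change ([(((x, y) + (0, 1), 0), true), (((x, y) + (1, 1), 1), false),
        (((x, y) + (1, 1), 2), true), (((x, y) + (0, 1), 3), false)] : List (Dart L × Bool)) =
        [(((x, y) + (0, 1), 0), true), (((x, y) + (0, 1) + (1, 0), 1), false),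
          (((x, y) + (0, 1) + (1, 0), 2), true), (((x, y) + (0, 1), 3), false)]
      simp

/-! ### Squares of tiles on the torus -/

/-- The coordinates with the origin `b` on the torus. -/
def chart (b : GridPoint L) : GridChart (squareTorus L) where
  pt i j := (moveRight L ^ i * moveUp L ^ j) b
  tile i j := tileOf L ((moveRight L ^ i * moveUp L ^ j) b)
  hstep i j := rightStep L ((moveRight L ^ i * moveUp L ^ j) b)
  vstep i j := upStep L ((moveRight L ^ i * moveUp L ^ j) b)
  hstep_source i j := rightStep_source _
  hstep_target i j := by rw [rightStep_target, ← moveRight_pt]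
  vstep_source i j := upStep_source _
  vstep_target i j := by rw [upStep_target, ← moveUp_pt]
  hstep_inRegion i j A := by rw [rightStep_inRegion, moveUp_inv_pt]; exact Iff.rfl
  vstep_inRegion i j A := by rw [upStep_inRegion, moveRight_inv_pt]; exact Iff.rfl
  eq_step i j s hs := by
    rw [← moveUp_inv_pt, ← moveRight_inv_pt]
    exact eq_step_of_source s _ hs
  corner i j d hd := by
    have h00 : (moveRight L ^ (i + 0) * moveUp L ^ (j + 0)) b =
      (moveRight L ^ i * moveUp L ^ j) b := by rw [add_zero, add_zero]
    have h01 : (moveRight L ^ (i + 0) * moveUp L ^ (j + 1)) b =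
      moveUp L ((moveRight L ^ i * moveUp L ^ j) b) := by rw [add_zero, moveUp_pt]
    have h10 : (moveRight L ^ (i + 1) * moveUp L ^ (j + 0)) b =
      moveRight L ((moveRight L ^ i * moveUp L ^ j) b) := by rw [add_zero, moveRight_pt]
    have h11 : (moveRight L ^ (i + 1) * moveUp L ^ (j + 1)) b =
      moveUp L (moveRight L ((moveRight L ^ i * moveUp L ^ j) b)) := by
        rw [← moveRight_pt, moveUp_pt]
    rcases tile_corners _ d hd with h | h | h | h
    · exact ⟨⟨0, 0, by decide, by decide, by decide, by decide, h.1.trans h00.symm⟩,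
        0, 1, by decide, by decide, by decide, by decide, h.2.trans h01.symm⟩
    · exact ⟨⟨1, 1, by decide, by decide, by decide, by decide, h.1.trans h11.symm⟩,
        1, 0, by decide, by decide, by decide, by decide, h.2.trans h10.symm⟩
    · exact ⟨⟨0, 1, by decide, by decide, by decide, by decide, h.1.trans h01.symm⟩,
        1, 1, by decide, by decide, by decide, by decide, h.2.trans h11.symm⟩
    · exact ⟨⟨1, 0, by decide, by decide, by decide, by decide, h.1.trans h10.symm⟩,
        0, 0, by decide, by decide, by decide, by decide, h.2.trans h00.symm⟩
  square i j A hA := by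
    have := square_homotopic _ hA
    rwa [← moveRight_pt, ← moveUp_pt, ← moveUp_pt] at this

end SquareTorus

namespace SquareTorus

variable {L : ℕ}

theorem move_mul_move (i j k l : ℤ) (x : GridPoint L) :
    (moveRight L ^ i * moveUp L ^ j) ((moveRight L ^ k * moveUp L ^ l) x) =
      (moveRight L ^ (i + k) * moveUp L ^ (j + l)) x := by
  rw [← Equiv.Perm.mul_apply, (commute_move.symm.zpow_zpow j k).mul_mul_mul_comm, ← zpow_add,
    ← zpow_add]

/-- Different moves by less than the size of the torus lead to different points. -/
theorem eq_of_move_eq {i j i' j' : ℤ} (hi : |i - i'| < L) (hj : |j - j'| < L) {x : GridPoint L}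
    (h : (moveRight L ^ i * moveUp L ^ j) x = (moveRight L ^ i' * moveUp L ^ j') x) :
    i = i' ∧ j = j' := by
  have h1 := congrArg (moveRight L ^ (-i') * moveUp L ^ (-j')) h
  rw [move_mul_move, move_mul_move, neg_add_cancel, neg_add_cancel] at h1
  have h2 := eq_zero_of_move_eq (by rwa [neg_add_eq_sub]) (by rwa [neg_add_eq_sub]) h1
  lia

variable [NeZero L]

open CellulatedSurface

/-- The square of `(2 r + 1) × (2 r + 1)` tiles around the tile `tileOf L x`. -/
def centeredBlock (x : GridPoint L) (r : ℕ) : Finset (squareTorus L).Edge :=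
  (chart ((moveRight L ^ (-r : ℤ) * moveUp L ^ (-r : ℤ)) x)).block (2 * r + 1)

theorem mem_centeredBlock {x : GridPoint L} {r : ℕ} {e : (squareTorus L).Edge} :
    e ∈ centeredBlock x r ↔
      ∃ i j : ℤ, |i| ≤ r ∧ |j| ≤ r ∧ tileOf L ((moveRight L ^ i * moveUp L ^ j) x) = e := by
  rw [centeredBlock, GridChart.mem_block]
  constructor
  · rintro ⟨i, j, hi, hj, rfl⟩
    refine ⟨i - r, j - r, abs_le.2 (by lia), abs_le.2 (by lia), ?_⟩
    change _ = tileOf L ((moveRight L ^ (i : ℤ) * moveUp L ^ (j : ℤ)) _)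
    rw [move_mul_move, ← sub_eq_add_neg, ← sub_eq_add_neg]
  · rintro ⟨i, j, hi, hj, rfl⟩
    rw [abs_le] at hi hj
    refine ⟨(i + r).toNat, (j + r).toNat, by lia, by lia, ?_⟩
    rw [Int.toNat_of_nonneg (by lia), Int.toNat_of_nonneg (by lia)]
    change tileOf L ((moveRight L ^ (i + r) * moveUp L ^ (j + r)) _) = _
    rw [move_mul_move, add_neg_cancel_right, add_neg_cancel_right]

theorem isSimplyConnected_centeredBlock (x : GridPoint L) {r : ℕ} (hr : 2 * r + 1 < L) :
    (squareTorus L).IsSimplyConnected (centeredBlock x r) := by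
  refine GridChart.isSimplyConnected_block (by lia) ?_ ?_
  · intro i j i' j' h1 h2 h3 h4 h5 h6 h7 h8 h
    exact eq_of_move_eq (abs_lt.2 (by lia)) (abs_lt.2 (by lia)) (tileOf_injective h)
  · intro i j i' j' h1 h2 h3 h4 h
    have := eq_of_move_eq (abs_lt.2 (by lia)) (abs_lt.2 (by lia)) h
    lia

/-- Tiles which touch are at most one step apart in both directions of the rotated grid. -/
theorem exists_of_touch {x : GridPoint L} {e : (squareTorus L).Edge}
    (h : (squareTorus L).Touch (tileOf L x) e) :
    ∃ i j : ℤ, |i| ≤ 1 ∧ |j| ≤ 1 ∧ tileOf L ((moveRight L ^ i * moveUp L ^ j) x) = e := by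
  obtain ⟨y, rfl⟩ := tileOf_surjective e
  obtain ⟨d, d', hd, hd', h⟩ := h
  have h00 : ∀ x : GridPoint L, (chart x).tile 0 0 = tileOf L x := fun x => rfl
  have key : ∀ (z : GridPoint L) (a b a' b' : ℤ), 0 ≤ a → a ≤ 1 → 0 ≤ b → b ≤ 1 →
      0 ≤ a' → a' ≤ 1 → 0 ≤ b' → b' ≤ 1 → z = (chart x).pt (0 + a) (0 + b) →
      z = (chart y).pt (0 + a') (0 + b') → ∃ i j : ℤ, |i| ≤ 1 ∧ |j| ≤ 1 ∧
        tileOf L ((moveRight L ^ i * moveUp L ^ j) x) = tileOf L y := by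
    intro z a b a' b' h1 h2 h3 h4 h5 h6 h7 h8 hx hy
    refine ⟨-a' + a, -b' + b, abs_le.2 (by lia), abs_le.2 (by lia), congrArg _ ?_⟩
    rw [zero_add, zero_add] at hx hy
    have h9 : z = (moveRight L ^ a * moveUp L ^ b) x := hx
    have h10 : z = (moveRight L ^ a' * moveUp L ^ b') y := hy
    rw [← move_mul_move, ← h9, h10, move_mul_move, neg_add_cancel, neg_add_cancel]
    rfl
  obtain ⟨⟨a, b, h1, h2, h3, h4, h5⟩, a', b', h1', h2', h3', h4', h5'⟩ :=
    (chart x).corner 0 0 d hd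
  obtain ⟨⟨p, q, k1, k2, k3, k4, k5⟩, p', q', k1', k2', k3', k4', k5'⟩ :=
    (chart y).corner 0 0 d' hd'
  rcases h with h | h
  · rw [h] at h5
    exact key _ a b p q h1 h2 h3 h4 k1 k2 k3 k4 h5 k5
  · rw [h] at h5'
    exact key _ a' b' p' q' h1' h2' h3' h4' k1' k2' k3' k4' h5' k5'

theorem mem_centeredBlock_of_touch {x : GridPoint L} {r : ℕ} {e e' : (squareTorus L).Edge}
    (he : e ∈ centeredBlock x r) (h : (squareTorus L).Touch e e') :
    e' ∈ centeredBlock x (r + 1) := by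
  obtain ⟨i, j, hi, hj, rfl⟩ := mem_centeredBlock.1 he
  obtain ⟨a, b, ha, hb, rfl⟩ := exists_of_touch h
  rw [move_mul_move]
  refine mem_centeredBlock.2 ⟨_, _, ?_, ?_, rfl⟩
  · rw [abs_le] at *; push_cast; lia
  · rw [abs_le] at *; push_cast; lia

theorem mem_centeredBlock_of_walk {x : GridPoint L} {a c : (squareTorus L).Edge}
    (p : (squareTorus L).tileGraph.Walk a c) :
    ∀ {r : ℕ}, a ∈ centeredBlock x r → c ∈ centeredBlock x (r + p.length) := by
  induction p with
  | nil => exact fun h => h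
  | cons h p ih =>
    intro r ha
    have h1 := ((SimpleGraph.fromRel_adj _ _ _).1 h).2
    have h2 := ih (mem_centeredBlock_of_touch ha (h1.elim id fun h3 => by
      obtain ⟨d, d', hd, hd', h4⟩ := h3
      exact ⟨d', d, hd', hd, h4.imp Eq.symm Eq.symm⟩))
    rwa [SimpleGraph.Walk.length_cons, add_comm p.length, ← add_assoc]

theorem centeredBlock_mono (x : GridPoint L) {r r' : ℕ} (h : r ≤ r') :
    centeredBlock x r ⊆ centeredBlock x r' := by
  intro e he
  obtain ⟨i, j, hi, hj, rfl⟩ := mem_centeredBlock.1 he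
  exact mem_centeredBlock.2 ⟨i, j, hi.trans (by exact_mod_cast h), hj.trans (by exact_mod_cast h),
    rfl⟩

/-- Two concentric squares of tiles around a qubit give a partition for the Markov length. -/
theorem isMarkovPartition_centeredBlock (x : GridPoint L) {r : ℕ} (hr : 2 ≤ r)
    (hrL : 2 * r + 1 < L) :
    (squareTorus L).IsMarkovPartition (centeredBlock x 1) (centeredBlock x r \ centeredBlock x 1) ∧
      centeredBlock x 1 ∪ (centeredBlock x r \ centeredBlock x 1) = centeredBlock x r := by
  have h1 : centeredBlock x 1 ∪ (centeredBlock x r \ centeredBlock x 1) = centeredBlock x r :=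
    Finset.union_sdiff_of_subset (centeredBlock_mono x (by lia))
  refine ⟨⟨Finset.disjoint_sdiff, isSimplyConnected_centeredBlock x (by lia), ?_, ?_, ?_⟩, h1⟩
  · rw [h1]
    exact isSimplyConnected_centeredBlock x hrL
  · rw [h1]
    refine ⟨tileOf L ((moveRight L ^ (r + 1 : ℤ) * moveUp L ^ (0 : ℤ)) x), Finset.mem_compl.2 ?_⟩
    intro h
    obtain ⟨i, j, hi, hj, h2⟩ := mem_centeredBlock.1 h
    rw [abs_le] at hi hj
    have := eq_of_move_eq (abs_lt.2 (by lia)) (abs_lt.2 (by lia)) (tileOf_injective h2)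
    lia
  · rw [h1]
    intro a ha c hc hac
    exact (Finset.mem_compl.1 hc) (centeredBlock_mono x hr (mem_centeredBlock_of_touch ha hac))

end SquareTorus

/-- The square tori form a family of lattices: a square of `3 × 3` tiles inside a concentric one of
radius `L / 4` is at distance at least `L / 8` from the rest. -/
theorem isLatticeFamily_torusFamily : IsLatticeFamily torusFamily := by
  refine ⟨⟨2, 2, fun L => le_of_eq ?_⟩, 1 / 8, by norm_num, ?_⟩
  · have : Fintype.card (torusFamily L).Edge = (L : ℕ) * L * 2 := by
      change Fintype.card ((ZMod L × ZMod L) × Fin 2) = _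
      rw [Fintype.card_prod, Fintype.card_prod, ZMod.card, Fintype.card_fin]
    rw [this]
    push_cast
    ring
  · filter_upwards [eventually_ge_atTop (8 : ℕ+)] with L hL e
    have hL8 : 8 ≤ (L : ℕ) := hL
    obtain ⟨x, rfl⟩ := SquareTorus.tileOf_surjective (L := L) e
    obtain ⟨h1, h2⟩ := SquareTorus.isMarkovPartition_centeredBlock x (r := (L : ℕ) / 4)
      (by lia) (by lia)
    refine ⟨_, _, h1, fun e' he' => ?_, ?_⟩
    · obtain ⟨i, j, hi, hj, h3⟩ := SquareTorus.exists_of_touch he'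
      exact SquareTorus.mem_centeredBlock.2 ⟨i, j, by exact_mod_cast hi, by exact_mod_cast hj, h3⟩
    · have h3 : (L : ℕ) / 4 ≤ (squareTorus L).regionDist (SquareTorus.centeredBlock x 1)
          (SquareTorus.centeredBlock x 1 ∪ (SquareTorus.centeredBlock x ((L : ℕ) / 4) \
            SquareTorus.centeredBlock x 1))ᶜ := by
        refine CellulatedSurface.le_regionDist h1.2.1.1 h1.2.2.2.1 fun a ha c hc p => ?_
        by_contra! hp
        rw [h2] at hc
        exact (Finset.mem_compl.1 hc) (SquareTorus.centeredBlock_mono x (by lia)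
          (SquareTorus.mem_centeredBlock_of_walk p ha))
      refine le_trans ?_ (Nat.cast_le.2 h3)
      have h4 : (L : ℝ) ≤ 8 * ((L / 4 : ℕ) : ℝ) := by exact_mod_cast (by lia)
      linarith

theorem hasGenus_squareTorus (L : ℕ) [NeZero L] : (squareTorus L).HasGenus 1 := by
  have h1 : Fintype.card (squareTorus L).Vertex = L * L := by
    change Fintype.card (ZMod L × ZMod L) = _
    rw [Fintype.card_prod, ZMod.card]
  have h2 : Fintype.card (squareTorus L).Face = L * L := by
    change Fintype.card (ZMod L × ZMod L) = _
    rw [Fintype.card_prod, ZMod.card]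
  have h3 : Fintype.card (squareTorus L).Edge = L * L * 2 := by
    change Fintype.card ((ZMod L × ZMod L) × Fin 2) = _
    rw [Fintype.card_prod, Fintype.card_prod, ZMod.card, Fintype.card_fin]
  rw [CellulatedSurface.HasGenus, h1, h2, h3]
  push_cast
  ring

/-- Dual loops are independent if there are loops which are dual to them with respect to the
crossing parity. -/
theorem CellulatedSurface.isIndependentHoles_of_pairing {Λ : CellulatedSurface} {ι : Type}
    [Fintype ι] [DecidableEq ι] {w s : ι → Λ.Edge → ZMod 2} (hw : ∀ i, Λ.IsDualCycle (w i))
    (hs : ∀ i, Λ.IsLoopConfig (s i)) (h : ∀ i j, pairing (w i) (s j) = if i = j then 1 else 0) :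
    Λ.IsIndependentHoles w := by
  refine ⟨hw, fun a ⟨u, hu⟩ => funext fun j => ?_⟩
  have h1 : pairing (∑ i, a i • w i) (s j) = 0 := by
    rw [hu, zero_add, sum_smul_pairing]
    refine Finset.sum_eq_zero fun v _ => ?_
    rw [(Λ.isLoopConfig_iff _).1 (hs j) v, mul_zero]
  rw [sum_smul_pairing] at h1
  simpa [h] using h1

namespace SquareTorus

variable {L : ℕ} [NeZero L]

open CellulatedSurface

theorem sum_vert (g : Edge L → ZMod 2) (v : Site L) :
    ∑ d : Dart L with d.1 = v, g (edge L d) =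
      g (v, 0) + g (v, 1) + g (v - (1, 0), 0) + g (v - (0, 1), 1) := by
  rw [Finset.sum_filter, Fintype.sum_prod_type_right, Fin.sum_univ_four]
  simp [edge]

theorem sum_face (g : Edge L → ZMod 2) (f : Site L) :
    ∑ d : Dart L with face L d = f, g (edge L d) =
      g (f, 0) + g (f + (1, 0), 1) + g (f + (0, 1), 0) + g (f, 1) := by
  rw [Finset.sum_filter, Fintype.sum_prod_type_right, Fin.sum_univ_four]
  simp only [edge, face, Matrix.cons_val, sub_eq_iff_eq_add, Finset.sum_ite_eq', Finset.mem_univ,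
    if_true]
  have h : f + (1, 1) - (1, 0) = f + (0, 1) := by
    obtain ⟨x, y⟩ := f
    simp
  rw [h, add_sub_cancel_right]
  congr 3
  exact (Finset.sum_eq_single f (fun x _ hx => if_neg hx) (by simp)).trans (if_pos rfl)

/-- The straight loops of the lattice along the axes: `0` runs in the horizontal direction and `1`
in the vertical one. -/
def straightLoop (L : ℕ) : Fin 2 → Edge L → ZMod 2
  | 0 => fun e => if e.1.2 = 0 ∧ e.2 = 0 then 1 else 0
  | 1 => fun e => if e.1.1 = 0 ∧ e.2 = 1 then 1 else 0

theorem isLoopConfig_straightLoop (i : Fin 2) :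
    (squareTorus L).IsLoopConfig (straightLoop L i) := by
  intro v
  refine (sum_vert (straightLoop L i) v).trans ?_
  obtain ⟨x, y⟩ := v
  fin_cases i <;> simp [straightLoop, CharTwo.add_self_eq_zero]

theorem isDualCycle_torusWinding (i : Fin 2) :
    (squareTorus L).IsDualCycle (torusWinding L i) := by
  intro f
  refine (sum_face (torusWinding L i) f).trans ?_
  obtain ⟨x, y⟩ := f
  fin_cases i <;> simp [torusWinding, CharTwo.add_self_eq_zero]

theorem pairing_torusWinding_straightLoop (i j : Fin 2) :
    pairing (Λ := squareTorus L) (torusWinding L i) (straightLoop L j) =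
      if i = j then 1 else 0 := by
  change ∑ e : Edge L, torusWinding L i e * straightLoop L j e = _
  rw [Fintype.sum_prod_type, Fintype.sum_prod_type]
  fin_cases i <;> fin_cases j <;> simp [torusWinding, straightLoop, ite_and]

/-- The windings are independent because they are dual to the straight loops. -/
theorem isIndependentHoles_torusWinding :
    (squareTorus L).IsIndependentHoles (torusWinding L) :=
  isIndependentHoles_of_pairing isDualCycle_torusWinding isLoopConfig_straightLoop
    pairing_torusWinding_straightLoop

end SquareTorus

/-! ### The tetrahedron and the simplices -/

open CellulatedSurface SquareTorus

theorem convFamily_comp_equiv {Λ : ℕ+ → CellulatedSurface} {κ κ' : Type} (e : κ ≃ κ')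
    (ρ : κ' → StateFamily Λ) : convFamily (fun i => ρ (e i)) = convFamily ρ := by
  ext σ
  refine forall_congr' fun L => ?_
  rw [show (Set.range fun i => ρ (e i) L) = Set.range fun i => ρ i L from
    e.surjective.range_comp fun i => ρ i L]

/-- The classical loop state is the ensemble of the trivial sector. -/
theorem torusLoopState_zero_zero :
    torusLoopState 0 0 = fun L => (squareTorus L).loopState (torusWinding L) 0 := by
  have h : (![0, 0] : Fin 2 → ZMod 2) = 0 := by
    ext i
    fin_cases i <;> rfl
  unfold torusLoopState
  rw [h]

theorem mainTheorem5 :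
    -- The square lattice on the torus.
    (
      -- The four loop ensembles are stabilizer states, for every choice of the dual loops.
      (∀ (sx sy : ZMod 2) (L : ℕ+) (v₀ : (squareTorus L).Vertex)
          (w : Fin 2 → (squareTorus L).Edge → ZMod 2),
          (∀ i, CellulatedSurface.Homologous (torusWinding L i) (w i)) →
          CellulatedSurface.IsStabilizerState (torusLoopState sx sy L)
            ((squareTorus L).loopGenerators v₀ w ![sx, sy])) ∧
      -- They have zero Markov length.
      (∀ sx sy : ZMod 2, markovLength (torusLoopState sx sy) = 0) ∧
      -- They are (exactly) locally indistinguishable.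
      (∀ (sx sy tx ty : ZMod 2) (L : ℕ+) (A : Finset (squareTorus L).Edge),
          (squareTorus L).IsSimplyConnected A →
          CellulatedSurface.reduced (Λ := squareTorus L) (torusLoopState sx sy L) A =
            CellulatedSurface.reduced (Λ := squareTorus L) (torusLoopState tx ty L) A) ∧
      -- Their convex hull is the locally indistinguishable set of the classical loop state.
      (∀ ξ₀ : NNReal,
          convFamily (fun s : ZMod 2 × ZMod 2 => torusLoopState s.1 s.2) ⊆
            locallyIndistinguishableSet (torusLoopState 0 0) ξ₀ ∧
          ∀ σ ∈ locallyIndistinguishableSet (torusLoopState 0 0) ξ₀,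
            ∃ τ ∈ convFamily (fun s : ZMod 2 × ZMod 2 => torusLoopState s.1 s.2), AsympEq σ τ) ∧
      -- The convex hull is a tetrahedron, and it does not degenerate in the thermodynamic limit.
      (∀ L : ℕ+,
          AffineIndependent ℝ (fun s : ZMod 2 × ZMod 2 => torusLoopState s.1 s.2 L) ∧
          ((convexHull ℝ (Set.range fun s : ZMod 2 × ZMod 2 =>
            torusLoopState s.1 s.2 L)).extremePoints ℝ).ncard = 4 ∧
          ∀ c : ZMod 2 × ZMod 2 → ℝ,
            traceNorm (∑ s, c s • torusLoopState s.1 s.2 L) = ∑ s, |c s|)) ∧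
    -- Lattices on closed surfaces of genus `k`, with dual loops around the `2 * k` holes.
    (∀ (k : ℕ) (Λ : ℕ+ → CellulatedSurface) (w : ∀ L, Fin (2 * k) → (Λ L).Edge → ZMod 2),
      (∀ L, (Λ L).HasGenus k) → IsLatticeFamily Λ → (∀ L, (Λ L).IsIndependentHoles (w L)) →
      (∀ (p : Fin (2 * k) → ZMod 2) (L : ℕ+) (v₀ : (Λ L).Vertex)
          (w' : Fin (2 * k) → (Λ L).Edge → ZMod 2),
          (∀ i, CellulatedSurface.Homologous (w L i) (w' i)) →
          CellulatedSurface.IsStabilizerState ((Λ L).loopState (w L) p)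
            ((Λ L).loopGenerators v₀ w' p)) ∧
      (∀ p : Fin (2 * k) → ZMod 2,
          markovLength (Λ := Λ) (fun L => (Λ L).loopState (w L) p) = 0) ∧
      (∀ (p q : Fin (2 * k) → ZMod 2) (L : ℕ+) (A : Finset (Λ L).Edge),
          (Λ L).IsSimplyConnected A →
          CellulatedSurface.reduced ((Λ L).loopState (w L) p) A =
            CellulatedSurface.reduced ((Λ L).loopState (w L) q) A) ∧
      (∀ ξ₀ : NNReal,
          convFamily (Λ := Λ) (fun (p : Fin (2 * k) → ZMod 2) L => (Λ L).loopState (w L) p) ⊆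
            locallyIndistinguishableSet (fun L => (Λ L).loopState (w L) 0) ξ₀ ∧
          ∀ σ ∈ locallyIndistinguishableSet (Λ := Λ) (fun L => (Λ L).loopState (w L) 0) ξ₀,
            ∃ τ ∈ convFamily (Λ := Λ)
              (fun (p : Fin (2 * k) → ZMod 2) L => (Λ L).loopState (w L) p), AsympEq σ τ) ∧
      (∀ L : ℕ+,
          AffineIndependent ℝ (fun p : Fin (2 * k) → ZMod 2 => (Λ L).loopState (w L) p) ∧
          ((convexHull ℝ (Set.range fun p : Fin (2 * k) → ZMod 2 =>
            (Λ L).loopState (w L) p)).extremePoints ℝ).ncard = 2 ^ (2 * k) ∧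
          ∀ c : (Fin (2 * k) → ZMod 2) → ℝ,
            traceNorm (∑ p, c p • (Λ L).loopState (w L) p) = ∑ p, |c p|)) := by
  constructor
  · have hw : ∀ L : ℕ+, (squareTorus L).IsIndependentHoles (torusWinding L) := fun L =>
      isIndependentHoles_torusWinding
    have hconv : convFamily (fun s : ZMod 2 × ZMod 2 => torusLoopState s.1 s.2) =
        convFamily (Λ := torusFamily) fun (p : Fin 2 → ZMod 2) L =>
          (squareTorus L).loopState (torusWinding L) p :=
      convFamily_comp_equiv (Λ := torusFamily) (finTwoArrowEquiv (ZMod 2)).symm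
        fun (p : Fin 2 → ZMod 2) L => (squareTorus L).loopState (torusWinding L) p
    refine ⟨fun sx sy L v₀ w h => isStabilizerState_loopState_of_homologous (hw L) h v₀ _,
      fun sx sy => ?_, fun sx sy tx ty L A hA => reduced_loopState_eq (hw L) _ _ hA,
      fun ξ₀ => ?_, fun L => ?_⟩
    · exact markovLength_eq_zero_of_mem_convFamily (Λ := torusFamily) hw fun L =>
        subset_convexHull ℝ _ ⟨![sx, sy], rfl⟩
    · rw [hconv, torusLoopState_zero_zero]
      exact ⟨convFamily_subset_locallyIndistinguishableSet (Λ := torusFamily) hw ξ₀,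
        fun σ hσ => exists_mem_convFamily_asympEq (Λ := torusFamily) (k := 1)
          (fun L => hasGenus_squareTorus L) isLatticeFamily_torusFamily hw ENNReal.coe_ne_top hσ⟩
    · have hli := linearIndependent_loopState (hw L)
      have hrange : (Set.range fun s : ZMod 2 × ZMod 2 => torusLoopState s.1 s.2 L) =
          Set.range fun p : Fin 2 → ZMod 2 => (squareTorus L).loopState (torusWinding L) p :=
        (finTwoArrowEquiv (ZMod 2)).symm.surjective.range_comp
          fun p : Fin 2 → ZMod 2 => (squareTorus L).loopState (torusWinding L) p
      refine ⟨?_, ?_, fun c => ?_⟩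
      · exact (LinearIndependent.affineIndependent ℝ hli).comp_embedding
          (finTwoArrowEquiv (ZMod 2)).symm.toEmbedding
      · rw [hrange]
        exact ncard_extremePoints_convexHull_loopState (hw L)
      · have h1 := traceNorm_sum_smul_loopState (hw L) fun p => c (finTwoArrowEquiv (ZMod 2) p)
        rw [Equiv.sum_comp (finTwoArrowEquiv (ZMod 2)) fun s => |c s|,
          ← Equiv.sum_comp (finTwoArrowEquiv (ZMod 2)).symm] at h1
        simp only [Equiv.apply_symm_apply] at h1
        exact h1
  · intro k Λ w hk hΛ hw
    refine ⟨fun p L v₀ w' h => isStabilizerState_loopState_of_homologous (hw L) h v₀ p,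
      fun p => ?_, fun p q L A hA => reduced_loopState_eq (hw L) p q hA,
      fun ξ₀ => ⟨convFamily_subset_locallyIndistinguishableSet hw ξ₀,
        fun σ hσ => exists_mem_convFamily_asympEq hk hΛ hw ENNReal.coe_ne_top hσ⟩,
      fun L => ⟨(linearIndependent_loopState (hw L)).affineIndependent, ?_,
        traceNorm_sum_smul_loopState (hw L)⟩⟩
    · exact markovLength_eq_zero_of_mem_convFamily hw fun L => subset_convexHull ℝ _ ⟨p, rfl⟩
    · rw [ncard_extremePoints_convexHull_loopState (hw L), Fintype.card_fin]
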